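/- There is an absolute constant $C$ such that for every integer $k \ge 1$ there is an algorithm which solves \textsc{Max Partial $k$-Coloring} on all $(\mathrm{bull},\mathsf{E})$-free graphs, with no bound on the clique number, and which runs in at most $2^{C k \sqrt{n}\,\log_2^{3/2} n}$ steps on instances with $n \ge 2$ vertices; that is, the problem is solvable in time $2^{O(k\sqrt{n}\,\log^{3/2} n)}$. Here an instance of \textsc{Max Partial $k$-Coloring} is a finite simple graph $G$ together with a revenue function $\mathsf{rev} : V(G)\times\{1,\dots,k\} \to \mathbb{Q}_{\ge 0}$, and the task is to output a set $X \subseteq V(G)$ and a proper $k$-coloring $c$ of the induced subgraph $G[X]$ for which $\sum_{v\in X}\mathsf{rev}(v,c(v))$ is maximum. The bull is the triangle with two pendant vertices attached to two distinct vertices of the triangle; $\mathsf{E}$ is the path on five vertices with one pendant vertex attached to its middle vertex; $G$ is $(\mathrm{bull},\mathsf{E})$-free if neither of them is an induced subgraph of $G$. The graph is given by its adjacency matrix. Algorithms are programs (finite systems of mutually recursive first-order functions) over trees whose leaves are rational numbers or empty, each elementary evaluation step has unit cost, and additions, subtractions and comparisons of rational numbers (in particular of revenue values) take constant time. -/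

import Mathlib

/-! ## The two forbidden graphs -/

/-- The bull: a triangle `0, 1, 2` with a pendant vertex `3` attached to `0` and a pendant vertex
`4` attached to `1`. -/
def bullGraph : SimpleGraph (Fin 5) :=
  SimpleGraph.fromEdgeSet {s(0, 1), s(1, 2), s(0, 2), s(0, 3), s(1, 4)}

/-- The graph `E`: the path `0, 1, 2, 3, 4` with a pendant vertex `5` attached to its middle
vertex `2`. -/
def eGraph : SimpleGraph (Fin 6) :=
  SimpleGraph.fromEdgeSet {s(0, 1), s(1, 2), s(2, 3), s(3, 4), s(2, 5)}

/-- `G` is `(bull, E)`-free: it contains neither graph as an induced subgraph. -/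
def IsBullEFree {V : Type*} (G : SimpleGraph V) : Prop :=
  ¬ bullGraph.IsIndContained G ∧ ¬ eGraph.IsIndContained G

/-! ## Max Partial `k`-Coloring -/

/-- A feasible solution: a set `X` of vertices and a proper `k`-coloring of `G[X]`. -/
structure PartialColoring {V : Type*} (G : SimpleGraph V) (k : ℕ) where
  X : Finset V
  c : (G.induce (X : Set V)).Coloring (Fin k)

namespace PartialColoring

variable {V : Type*} {G : SimpleGraph V} {k : ℕ}

/-- The revenue `∑ v ∈ X, rev (v, c v)` of a feasible solution. -/
def revenue (rev : V → Fin k → NNRat) (S : PartialColoring G k) : NNRat :=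
  ∑ v : (S.X : Set V), rev v (S.c v)

/-- The feasible solution `S` has maximum revenue. -/
def IsOptimal (rev : V → Fin k → NNRat) (S : PartialColoring G k) : Prop :=
  ∀ S' : PartialColoring G k, S'.revenue rev ≤ S.revenue rev

end PartialColoring

/-! ## The model of computation

Programs are finite systems of mutually recursive first-order functions over trees (cons cells)
whose leaves are `nil` or rational numbers. Each evaluation step is charged one unit of time; in
particular adding, subtracting and comparing two rationals takes constant time, and no other
arithmetic is available. Arguments are passed by reference, so each step is executed in a constant
number of steps by a random access machine with unit-cost addition, subtraction and comparison of
rationals. -/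

/-- Data values. -/
inductive Val : Type
  | nil : Val
  | num : ℚ → Val
  | cons : Val → Val → Val

/-- The list with the given entries, as a chain of cons cells ending in `nil`. -/
def Val.ofList : List Val → Val
  | [] => Val.nil
  | a :: l => Val.cons a (Val.ofList l)

/-- Expressions. Variables are de Bruijn indices into the current environment. -/
inductive Exp : Type
  /-- the variable with the given index -/
  | var : ℕ → Exp
  /-- the constant `nil` -/
  | nil : Exp
  /-- a rational constant -/
  | num : ℚ → Exp
  /-- allocate a cons cell -/
  | cons : Exp → Exp → Exp
  /-- evaluate the first expression, bind variable `0` to its value, evaluate the second one -/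
  | letIn : Exp → Exp → Exp
  /-- `caseList a e₀ e₁`: evaluate `a`; if the value is `nil` continue with `e₀`, and if it is a
  cons cell, bind variables `0` and `1` to its head and its tail and continue with `e₁` -/
  | caseList : Exp → Exp → Exp → Exp
  /-- addition of two rationals -/
  | add : Exp → Exp → Exp
  /-- subtraction of two rationals -/
  | sub : Exp → Exp → Exp
  /-- `ifLe a b e₁ e₀`: continue with `e₁` if the value of `a` is at most that of `b`, and with
  `e₀` otherwise -/
  | ifLe : Exp → Exp → Exp → Exp → Exp
  /-- `call f a`: call the function number `f` of the program on the value of `a` -/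
  | call : ℕ → Exp → Exp

/-- A program: finitely many function bodies, which may call one another, and a main body. The
argument of a body is its variable `0`. -/
structure Program where
  funs : List Exp
  main : Exp

/-- `Eval F env e v t`: with the function bodies `F` and in the environment `env`, the evaluation
of `e` (call by value) terminates with value `v` after `t` steps. -/
inductive Eval (F : List Exp) : List Val → Exp → Val → ℕ → Prop
  | var {env : List Val} {i : ℕ} {v : Val} (h : env[i]? = some v) :
      Eval F env (Exp.var i) v 1
  | nil {env : List Val} :
      Eval F env Exp.nil Val.nil 1
  | num {env : List Val} {q : ℚ} :
      Eval F env (Exp.num q) (Val.num q) 1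
  | cons {env : List Val} {a b : Exp} {u v : Val} {s t : ℕ}
      (ha : Eval F env a u s) (hb : Eval F env b v t) :
      Eval F env (Exp.cons a b) (Val.cons u v) (s + t + 1)
  | letIn {env : List Val} {a b : Exp} {u v : Val} {s t : ℕ}
      (ha : Eval F env a u s) (hb : Eval F (u :: env) b v t) :
      Eval F env (Exp.letIn a b) v (s + t + 1)
  | caseNil {env : List Val} {a e₀ e₁ : Exp} {v : Val} {s t : ℕ}
      (ha : Eval F env a Val.nil s) (he : Eval F env e₀ v t) :
      Eval F env (Exp.caseList a e₀ e₁) v (s + t + 1)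
  | caseCons {env : List Val} {a e₀ e₁ : Exp} {x y v : Val} {s t : ℕ}
      (ha : Eval F env a (Val.cons x y) s) (he : Eval F (x :: y :: env) e₁ v t) :
      Eval F env (Exp.caseList a e₀ e₁) v (s + t + 1)
  | add {env : List Val} {a b : Exp} {p q : ℚ} {s t : ℕ}
      (ha : Eval F env a (Val.num p) s) (hb : Eval F env b (Val.num q) t) :
      Eval F env (Exp.add a b) (Val.num (p + q)) (s + t + 1)
  | sub {env : List Val} {a b : Exp} {p q : ℚ} {s t : ℕ}
      (ha : Eval F env a (Val.num p) s) (hb : Eval F env b (Val.num q) t) :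
      Eval F env (Exp.sub a b) (Val.num (p - q)) (s + t + 1)
  | ifLeTrue {env : List Val} {a b e₁ e₀ : Exp} {p q : ℚ} {v : Val} {s t r : ℕ}
      (ha : Eval F env a (Val.num p) s) (hb : Eval F env b (Val.num q) t)
      (hpq : p ≤ q) (he : Eval F env e₁ v r) :
      Eval F env (Exp.ifLe a b e₁ e₀) v (s + t + r + 1)
  | ifLeFalse {env : List Val} {a b e₁ e₀ : Exp} {p q : ℚ} {v : Val} {s t r : ℕ}
      (ha : Eval F env a (Val.num p) s) (hb : Eval F env b (Val.num q) t)
      (hpq : ¬ p ≤ q) (he : Eval F env e₀ v r) :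
      Eval F env (Exp.ifLe a b e₁ e₀) v (s + t + r + 1)
  | call {env : List Val} {f : ℕ} {a body : Exp} {u v : Val} {s t : ℕ}
      (hf : F[f]? = some body) (ha : Eval F env a u s) (hb : Eval F [u] body v t) :
      Eval F env (Exp.call f a) v (s + t + 1)

/-- Evaluation is deterministic: value and running time are unique. -/
theorem Eval.unique {F : List Exp} {env : List Val} {e : Exp} {v v' : Val} {t t' : ℕ}
    (h : Eval F env e v t) (h' : Eval F env e v' t') : v = v' ∧ t = t' := by
  induction h generalizing v' t' with
  | var h => cases h' with | var h2 => simp_all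
  | nil => cases h'; simp
  | num => cases h'; simp
  | cons _ _ iha ihb =>
    cases h' with | cons ha hb => simp [iha ha, ihb hb]
  | letIn _ _ iha ihb =>
    cases h' with
    | letIn ha hb =>
      obtain ⟨rfl, rfl⟩ := iha ha
      obtain ⟨rfl, rfl⟩ := ihb hb
      simp
  | caseNil _ _ iha ihb =>
    cases h' with
    | caseNil ha hb => simp [iha ha, ihb hb]
    | caseCons ha hb => simpa using (iha ha).1
  | caseCons _ _ iha ihb =>
    cases h' with
    | caseNil ha hb => simpa using (iha ha).1
    | caseCons ha hb =>
      obtain ⟨h1, rfl⟩ := iha ha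
      obtain ⟨rfl, rfl⟩ := Val.cons.inj h1
      simp [ihb hb]
  | add _ _ iha ihb =>
    cases h' with
    | add ha hb => simp [Val.num.inj (iha ha).1, Val.num.inj (ihb hb).1, (iha ha).2, (ihb hb).2]
  | sub _ _ iha ihb =>
    cases h' with
    | sub ha hb => simp [Val.num.inj (iha ha).1, Val.num.inj (ihb hb).1, (iha ha).2, (ihb hb).2]
  | ifLeTrue _ _ hpq _ iha ihb ihe =>
    cases h' with
    | ifLeTrue ha hb _ he => simp [(iha ha).2, (ihb hb).2, ihe he]
    | ifLeFalse ha hb hn he =>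
      rw [← Val.num.inj (iha ha).1, ← Val.num.inj (ihb hb).1] at hn
      exact absurd hpq hn
  | ifLeFalse _ _ hpq _ iha ihb ihe =>
    cases h' with
    | ifLeFalse ha hb _ he => simp [(iha ha).2, (ihb hb).2, ihe he]
    | ifLeTrue ha hb hn he =>
      rw [← Val.num.inj (iha ha).1, ← Val.num.inj (ihb hb).1] at hn
      exact absurd hn hpq
  | call hf _ _ iha ihb =>
    cases h' with
    | call hf2 ha hb =>
      obtain ⟨rfl, rfl⟩ := iha ha
      rw [hf] at hf2
      obtain rfl := Option.some.inj hf2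
      obtain ⟨rfl, rfl⟩ := ihb hb
      simp

/-- On input `x` the program `P` halts with output `y` after `t` steps. -/
def Program.Outputs (P : Program) (x y : Val) (t : ℕ) : Prop :=
  Eval P.funs [x] P.main y t

/-! ## Encoding of inputs and outputs -/

open Classical in
/-- The instance `(G, rev)` as a list with one entry per vertex `v`: a cons cell holding the row of
`v` in the adjacency matrix of `G` (a list of `0`s and `1`s) and the list of the revenues of `v`
for the `k` colors. -/
noncomputable def encodeInstance {n k : ℕ} (G : SimpleGraph (Fin n))
    (rev : Fin n → Fin k → NNRat) : Val :=
  Val.ofList (List.ofFn fun v : Fin n =>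
    Val.cons
      (Val.ofList (List.ofFn fun u : Fin n => Val.num (if G.Adj v u then 1 else 0)))
      (Val.ofList (List.ofFn fun i : Fin k => Val.num (rev v i : ℚ))))

/-- The solution `(X, c)` as a list with one entry per vertex `v`: the number of its color, counted
from `1`, if `v ∈ X`, and `0` if `v ∉ X`. -/
def encodeSolution {n k : ℕ} {G : SimpleGraph (Fin n)} (S : PartialColoring G k) : Val :=
  Val.ofList (List.ofFn fun v : Fin n =>
    Val.num (if h : v ∈ S.X then ((S.c ⟨v, h⟩ : Fin k) : ℚ) + 1 else 0))

/-! ## Forbidden configurations -/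

section Graph

open Finset

/-! View an instance as `k` layers, one per color, each listing the vertices that may still take
that color. Two vertices conflict if they are adjacent and share a layer; components of the conflict
graph can be solved independently. The search `solve` tries all short sequences of moves (delete
vertices from the front layer, change an auxiliary vertex set `Y`, rotate the layers, split into
components) and keeps the best result. Every branch returns a feasible solution (`feasible_solve`),
so it remains to show, for an arbitrary feasible `X`, that some sequence of moves loses no entry of
`X` and makes all components small (`reach_small_components`).

Let `m` vertices be alive and put `q = ⌊√m⌋`. While `X` uses, in some layer, a vertex with more than
`q` neighbours there, delete those neighbours; this happens at most `m / (q + 1) ≤ q` times per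
layer. Afterwards all vertices of larger degree can be discarded (`reach_degreeLE`), so a clique of
alive vertices has at most `k (q + 1)` elements.

A Gyárfás path in a `(bull, E)`-free graph needs only its first and its last three vertices to
separate: four neighbourhoods leave components of at most half the size
(`IsBullEFree.exists_separator`). Those neighbourhoods may themselves be large, so the separator is
taken inside the common neighbourhood of a largest clique that still has more than `2m/3` common
neighbours. This yields at most five cliques such that detaching each common neighbourhood from its
complement leaves pieces of at most `2m/3` vertices (`IsBullEFree.exists_cliques`). In a layer, the
vertices of `X` inside the common neighbourhood of a clique are independent, and at most `max 2 (q +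
1)` of them dominate what all of them dominate outside (`IsBullEFree.exists_dominating`). Guessing
these and deleting their outside neighbours permits the detachment without harming `X`
(`reach_decoupled`).

One round costs at most `33 k √m` moves and a split, and `m` drops to `2m/3`; the geometric series
gives a budget of `200 k √m` (`vtotal_le_solve`). A call makes about `5n` recursive calls, so the
time is polynomial times `(5n + 3)` to the power `O(k √n)`, which is `2^{O(k √n log n)}` and within
the required bound. -/

theorem isIndContained_of_map {V W : Type*} {H : SimpleGraph W} {G : SimpleGraph V} (f : W → V)
    (hf : ∀ i j, G.Adj (f i) (f j) ↔ H.Adj i j)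
    (hH : ∀ i j, (∀ l, H.Adj i l ↔ H.Adj j l) → i = j) : H.IsIndContained G :=
  ⟨{ toFun := f
     -- Vertices with equal images have equal neighbourhoods, and `hH` excludes such twins.
     inj' := fun i j hij => hH i j fun l => by rw [← hf, ← hf, hij]
     map_rel_iff' := fun {i j} => hf i j }⟩

variable {V : Type*} {G : SimpleGraph V}

theorem IsBullEFree.no_bull (h : IsBullEFree G) {a b c d e : V} (ab : G.Adj a b)
    (bc : G.Adj b c) (ac : G.Adj a c) (ad : G.Adj a d) (be : G.Adj b e) (ae : ¬ G.Adj a e)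
    (bd : ¬ G.Adj b d) (cd : ¬ G.Adj c d) (ce : ¬ G.Adj c e) (de : ¬ G.Adj d e) : False := by
  refine h.1 (isIndContained_of_map ![a, b, c, d, e] ?_ ?_)
  · intro i j
    fin_cases i <;> fin_cases j <;>
      simp_all [bullGraph, SimpleGraph.adj_comm]
  · unfold bullGraph
    simp only [SimpleGraph.fromEdgeSet_adj]
    decide

theorem IsBullEFree.no_e (h : IsBullEFree G) {a b c d e f : V} (ab : G.Adj a b)
    (bc : G.Adj b c) (cd : G.Adj c d) (de : G.Adj d e) (cf : G.Adj c f)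
    (ac : ¬ G.Adj a c) (ad : ¬ G.Adj a d) (ae : ¬ G.Adj a e) (af : ¬ G.Adj a f)
    (bd : ¬ G.Adj b d) (be : ¬ G.Adj b e) (bf : ¬ G.Adj b f) (ce : ¬ G.Adj c e)
    (df : ¬ G.Adj d f) (ef : ¬ G.Adj e f) : False := by
  refine h.2 (isIndContained_of_map ![a, b, c, d, e, f] ?_ ?_)
  · intro i j
    fin_cases i <;> fin_cases j <;>
      simp_all [eGraph, SimpleGraph.adj_comm]
  · unfold eGraph
    simp only [SimpleGraph.fromEdgeSet_adj]
    decide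

/-! ## Components of a vertex set -/

/-- The vertices that can be reached from `v` inside `S`. -/
def reachIn (G : SimpleGraph V) (S : Set V) (v : V) : Set V :=
  {u | Relation.ReflTransGen (fun a b => G.Adj a b ∧ b ∈ S) v u}

theorem self_mem_reachIn (S : Set V) (v : V) : v ∈ reachIn G S v := Relation.ReflTransGen.refl

theorem reachIn_closed {S : Set V} {v a b : V} (ha : a ∈ reachIn G S v) (hab : G.Adj a b)
    (hb : b ∈ S) : b ∈ reachIn G S v := Relation.ReflTransGen.tail ha ⟨hab, hb⟩

theorem reachIn_subset {S T : Set V} {v : V} (hv : v ∈ T)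
    (hT : ∀ a ∈ T, ∀ b ∈ S, G.Adj a b → b ∈ T) : reachIn G S v ⊆ T := by
  intro u hu
  induction hu with
  | refl => exact hv
  | tail _ h ih => exact hT _ ih _ h.2 h.1

theorem reachIn_subset_self {S : Set V} {v : V} (hv : v ∈ S) : reachIn G S v ⊆ S :=
  reachIn_subset hv fun _ _ _ hb _ => hb

/-- Only the endpoint of each step has to lie in `S`, so a path can be reversed once its start lies
in `S` as well. -/
theorem reachIn_symm {S : Set V} {v u : V} (hv : v ∈ S) (hu : u ∈ reachIn G S v) :
    v ∈ reachIn G S u := by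
  induction hu with
  | refl => exact Relation.ReflTransGen.refl
  | @tail b c hb h ih =>
    exact Relation.ReflTransGen.head ⟨h.1.symm, reachIn_subset_self hv hb⟩ ih

theorem reachIn_trans {S : Set V} {v u w : V} (hu : u ∈ reachIn G S v) (hw : w ∈ reachIn G S u) :
    w ∈ reachIn G S v := Relation.ReflTransGen.trans hu hw

/-- A set in which any two vertices are connected. -/
def JoinedSet (G : SimpleGraph V) (B : Set V) : Prop := ∀ a ∈ B, ∀ b ∈ B, b ∈ reachIn G B a

theorem joinedSet_reachIn {S : Set V} {v : V} : JoinedSet G (reachIn G S v) := by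
  have key : ∀ b ∈ reachIn G S v, b ∈ reachIn G (reachIn G S v) v := by
    intro b hb
    induction hb with
    | refl => exact Relation.ReflTransGen.refl
    | tail h1 h ih => exact reachIn_closed ih h.1 (reachIn_closed h1 h.1 h.2)
  intro a ha b hb
  exact reachIn_trans (reachIn_symm (self_mem_reachIn _ _) (key a ha)) (key b hb)

theorem JoinedSet.exists_boundary {B C : Set V} (hB : JoinedSet G B) (hC : C ⊆ B) {c b : V}
    (hc : c ∈ C) (hb : b ∈ B) (hbC : b ∉ C) : ∃ u ∈ C, ∃ w ∈ B, w ∉ C ∧ G.Adj u w := by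
  by_contra! hcon
  refine hbC (reachIn_subset (T := C) hc ?_ (hB c (hC hc) b hb))
  intro a ha b hb hab
  by_contra hbC
  exact hcon a ha b hb hbC hab

/-! ## Balanced separation by four neighbourhoods -/

/-- The data of an induced path `…, x, y, z` starting at `r` and a connected set `B` which lies
beyond the neighbourhoods of the path. -/
structure PathState (G : SimpleGraph V) (Y B : Set V) (r x y z : V) : Prop where
  sub : B ⊆ Y
  joined : JoinedSet G B
  rY : r ∈ Y
  xY : x ∈ Y
  yY : y ∈ Y
  zY : z ∈ Y
  anti_r : ∀ c ∈ B, ¬ G.Adj r c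
  anti_x : ∀ c ∈ B, ¬ G.Adj x c
  anti_y : ∀ c ∈ B, ¬ G.Adj y c
  bdry : ∀ u ∈ Y, u ∉ B → ∀ c ∈ B, G.Adj u c → G.Adj r u ∨ G.Adj x u ∨ G.Adj y u
  yz : G.Adj y z
  zB : ∃ c ∈ B, G.Adj z c
  pred : x = r ∨ (∃ w, G.Adj w x ∧ ¬ G.Adj w y ∧ ¬ G.Adj w z ∧ ∀ c ∈ B, ¬ G.Adj w c) ∧
    G.Adj x y ∧ ¬ G.Adj x z
  pred' : y = r ∨ G.Adj x y ∧ ¬ G.Adj x z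

/-- One step of the Gyárfás path argument: pass to a component of `B` minus the neighbours of `z`,
and extend the path by a vertex of `B` next to it. The vertex `x` can be forgotten, because a vertex
that sees `x` and `C` but none of `r`, `y`, `z` creates a bull or an `E` with the predecessor of
`x`. At the start of the path `x = r`, which is kept anyway. -/
theorem PathState.next (h : IsBullEFree G) {Y B C : Set V} {r x y z : V}
    (st : PathState G Y B r x y z) {v : V} (hv : v ∈ B) (hvz : ¬ G.Adj z v)
    (hC : C = reachIn G {u ∈ B | ¬ G.Adj z u} v) :
    C ⊆ B ∧ (∃ c ∈ B, c ∉ C) ∧ ∃ z', PathState G Y C r y z z' := by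
  have hCS : C ⊆ {u ∈ B | ¬ G.Adj z u} := hC ▸ reachIn_subset_self (by exact ⟨hv, hvz⟩)
  have hCB : C ⊆ B := fun u hu => (hCS hu).1
  have hCz : ∀ c ∈ C, ¬ G.Adj z c := fun u hu => (hCS hu).2
  have hvC : v ∈ C := hC ▸ self_mem_reachIn _ _
  obtain ⟨c₀, hc₀B, hc₀⟩ := st.zB
  have hc₀C : c₀ ∉ C := fun hc => hCz _ hc hc₀
  obtain ⟨u, hu, z', hz'B, hz'C, huz'⟩ := st.joined.exists_boundary hCB hvC hc₀B hc₀C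
  have hclosed : ∀ a ∈ C, ∀ b ∈ B, ¬ G.Adj z b → G.Adj a b → b ∈ C := by
    intro a ha b hb hzb hab
    rw [hC] at ha ⊢
    exact reachIn_closed ha hab ⟨hb, hzb⟩
  have hzz' : G.Adj z z' := by
    by_contra hcon
    exact hz'C (hclosed u hu z' hz'B hcon huz')
  refine ⟨hCB, ⟨c₀, hc₀B, hc₀C⟩, z', ?_⟩
  refine ⟨hCB.trans st.sub, hC ▸ joinedSet_reachIn, st.rY, st.yY, st.zY,
    st.sub hz'B, fun c hc => st.anti_r c (hCB hc), fun c hc => st.anti_y c (hCB hc), hCz, ?_, hzz',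
    ⟨u, hu, huz'.symm⟩, ?_, Or.inr ⟨st.yz, st.anti_y z' hz'B⟩⟩
  · intro p hpY hpC c hc hpc
    by_cases hpB : p ∈ B
    · right; right
      by_contra hcon
      exact hpC (hclosed c hc p hpB hcon hpc.symm)
    · rcases st.bdry p hpY hpB c (hCB hc) hpc with hp | hp | hp
      · exact Or.inl hp
      · by_contra! hcon
        obtain ⟨hpr, hpy, hpz⟩ := hcon
        rcases st.pred with rfl | ⟨⟨w, hwx, hwy, hwz, hwB⟩, hxy, hxz⟩
        · exact hpr hp
        · have cB := hCB hc
          -- With `w` the predecessor of `x`: either `x, p, w` is the triangle of a bull with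
          -- pendants `y` and `c`, or the path `c, p, x, y, z` with pendant `w` at `x` is an `E`.
          by_cases hwp : G.Adj w p
          · exact h.no_bull hp hwp.symm hwx.symm hxy hpc (st.anti_x c cB)
              (fun hh => hpy hh.symm) hwy (hwB c cB) (st.anti_y c cB)
          · exact h.no_e hpc.symm hp.symm hxy st.yz hwx.symm
              (fun hh => st.anti_x c cB hh.symm) (fun hh => st.anti_y c cB hh.symm)
              (fun hh => hCz c hc hh.symm) (fun hh => hwB c cB hh.symm)
              (fun hh => hpy hh.symm) (fun hh => hpz hh.symm) (fun hh => hwp hh.symm) hxz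
              (fun hh => hwy hh.symm) (fun hh => hwz hh.symm)
      · exact Or.inr (Or.inl hp)
  · rcases st.pred' with hy | ⟨hxy, hxz⟩
    · exact Or.inl hy
    · exact Or.inr ⟨⟨x, hxy, hxz, st.anti_x z' hz'B, fun c hc => st.anti_x c (hCB hc)⟩,
        st.yz, st.anti_y z' hz'B⟩

/-- While deleting the neighbours of `z` leaves a piece of `B` with more than `M / 2` vertices, the
path is extended and `B` shrinks strictly. When this stops, a component of what remains of `Y`
either misses `B`, which already holds more than half, or is confined to `B` by `bdry` and hence
small. -/
theorem PathState.exists_separator [Finite V] (h : IsBullEFree G) {Y : Set V} {M : ℕ}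
    (hM : Y.ncard ≤ M) : ∀ (N : ℕ) {B : Set V} {r x y z : V}, B.ncard ≤ N →
    PathState G Y B r x y z → M < 2 * B.ncard →
    ∃ p : List V, p.length ≤ 4 ∧ (∀ a ∈ p, a ∈ Y) ∧ ∀ v ∈ Y, (∀ a ∈ p, ¬ G.Adj a v) →
      2 * (reachIn G {u ∈ Y | ∀ a ∈ p, ¬ G.Adj a u} v).ncard ≤ M := by
  intro N
  induction N with
  | zero => intro B r x y z hB st hb; omega
  | succ N ih =>
    intro B r x y z hB st hb
    by_cases hbig : ∃ v ∈ B, ¬ G.Adj z v ∧ M < 2 * (reachIn G {u ∈ B | ¬ G.Adj z u} v).ncard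
    · obtain ⟨v, hv, hvz, hbig⟩ := hbig
      obtain ⟨hCB, ⟨c, hc, hcC⟩, z', st'⟩ := st.next h hv hvz rfl
      refine ih (Nat.lt_succ_iff.mp (lt_of_lt_of_le ?_ hB)) st' hbig
      exact Set.ncard_lt_ncard ⟨hCB, fun hh => hcC (hh hc)⟩ (Set.toFinite _)
    · push Not at hbig
      refine ⟨[r, x, y, z], by simp, by simp [st.rY, st.xY, st.yY, st.zY], ?_⟩
      intro v hv hvp
      by_contra! hcon
      set S := {u ∈ Y | ∀ a ∈ [r, x, y, z], ¬ G.Adj a u} with hS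
      set D := reachIn G S v
      have hvS : v ∈ S := ⟨hv, hvp⟩
      have hDS : D ⊆ S := reachIn_subset_self hvS
      have hDY : D ⊆ Y := fun u hu => (hDS hu).1
      obtain ⟨u, huD, huB⟩ : ∃ u ∈ D, u ∈ B := by
        by_contra! hdis
        have := Set.ncard_union_eq (s := D) (t := B) (Set.disjoint_left.mpr hdis)
          (Set.toFinite _) (Set.toFinite _)
        have h2 := Set.ncard_le_ncard (Set.union_subset hDY st.sub) (Set.toFinite _)
        omega
      have hnz : ∀ u ∈ D, ¬ G.Adj z u := fun u hu => (hDS hu).2 z (by simp)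
      have hsub : D ⊆ reachIn G {u ∈ B | ¬ G.Adj z u} u := by
        intro w hw
        have hwu : w ∈ reachIn G S u := reachIn_trans (reachIn_symm hvS huD) hw
        have hmem : reachIn G {u ∈ B | ¬ G.Adj z u} u ⊆ B := fun a ha =>
          (reachIn_subset_self (S := {u ∈ B | ¬ G.Adj z u}) ⟨huB, hnz u huD⟩ ha).1
        refine reachIn_subset (self_mem_reachIn _ _) ?_ hwu
        intro a ha b hb hab
        refine reachIn_closed ha hab ⟨?_, hb.2 z (by simp)⟩
        by_contra hbB
        rcases st.bdry b hb.1 hbB a (hmem ha) hab.symm with h1 | h1 | h1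
        · exact hb.2 r (by simp) h1
        · exact hb.2 x (by simp) h1
        · exact hb.2 y (by simp) h1
      have h1 := Set.ncard_le_ncard hsub (Set.toFinite _)
      have h2 := hbig u huB (hnz u huD)
      omega

/-- In a `(bull, E)`-free graph, four neighbourhoods suffice to break a vertex set into components
with at most half of the vertices. -/
theorem IsBullEFree.exists_separator [Finite V] (h : IsBullEFree G) {Y : Set V} {M : ℕ}
    (hM : Y.ncard ≤ M) (hM2 : 2 ≤ M) :
    ∃ p : List V, p.length ≤ 4 ∧ (∀ a ∈ p, a ∈ Y) ∧ ∀ v ∈ Y, (∀ a ∈ p, ¬ G.Adj a v) →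
      2 * (reachIn G {u ∈ Y | ∀ a ∈ p, ¬ G.Adj a u} v).ncard ≤ M := by
  by_cases hbig : ∃ r ∈ Y, M < 2 * (reachIn G Y r).ncard
  swap
  · push Not at hbig
    exact ⟨[], by simp, by simp, fun v hv _ => by simpa using hbig v hv⟩
  obtain ⟨r, hr, hbig⟩ := hbig
  by_cases hbig' : ∃ v ∈ Y, ¬ G.Adj r v ∧ M < 2 * (reachIn G {u ∈ Y | ¬ G.Adj r u} v).ncard
  swap
  · push Not at hbig'
    exact ⟨[r], by simp, by simp [hr], fun v hv hv' => by simpa using hbig' v hv (by simpa using hv')⟩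
  obtain ⟨v, hv, hvr, hbigC⟩ := hbig'
  set C := reachIn G {u ∈ Y | ¬ G.Adj r u} v with hC
  have hCS : C ⊆ {u ∈ Y | ¬ G.Adj r u} := reachIn_subset_self (by exact ⟨hv, hvr⟩)
  have hCY : C ⊆ Y := fun u hu => (hCS hu).1
  -- Two subsets of `Y` with more than `M / 2` vertices each must meet.
  obtain ⟨w, hwB, hwC⟩ : ∃ w ∈ reachIn G Y r, w ∈ C := by
    by_contra! hdis
    have := Set.ncard_union_eq (s := reachIn G Y r) (t := C) (Set.disjoint_left.mpr hdis)
      (Set.toFinite _) (Set.toFinite _)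
    have h2 := Set.ncard_le_ncard (Set.union_subset (reachIn_subset_self (G := G) hr) hCY)
      (Set.toFinite _)
    omega
  have hCB : C ⊆ reachIn G Y r := by
    intro u hu
    have h1 : u ∈ reachIn G {u ∈ Y | ¬ G.Adj r u} w :=
      reachIn_trans (reachIn_symm (by exact ⟨hv, hvr⟩) hwC) hu
    refine reachIn_subset hwB ?_ h1
    exact fun a ha b hb hab => reachIn_closed ha hab hb.1
  -- Open neighbourhoods are removed, so `r` itself survives as an isolated vertex; its component is
  -- not large because `2 ≤ M`.
  have hrC : r ∉ C := by
    intro hrC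
    have h1 : C ⊆ {r} := by
      intro u hu
      have h1 : u ∈ reachIn G {u ∈ Y | ¬ G.Adj r u} r :=
        reachIn_trans (reachIn_symm (by exact ⟨hv, hvr⟩) hrC) hu
      refine reachIn_subset (T := {r}) rfl ?_ h1
      rintro a rfl b hb hab
      exact absurd hab hb.2
    have h2 := Set.ncard_le_ncard h1 (Set.toFinite _)
    rw [Set.ncard_singleton] at h2
    omega
  obtain ⟨u, hu, z, hzB, hzC, huz⟩ := joinedSet_reachIn.exists_boundary hCB hwC
    (self_mem_reachIn _ _) hrC
  have hclosed : ∀ a ∈ C, ∀ b ∈ Y, ¬ G.Adj r b → G.Adj a b → b ∈ C :=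
    fun a ha b hb hrb hab => reachIn_closed ha hab ⟨hb, hrb⟩
  have hzY : z ∈ Y := reachIn_subset_self hr hzB
  have hanti : ∀ c ∈ C, ¬ G.Adj r c := fun c hc => (hCS hc).2
  -- So far the path is `r, z`, and `r` fills the three slots before `z`.
  have st : PathState G Y C r r r z :=
    ⟨hCY, joinedSet_reachIn, hr, hr, hr, hzY, hanti, hanti, hanti,
      fun p hpY hpC c hc hpc => Or.inl (by
        by_contra hcon
        exact hpC (hclosed c hc p hpY hcon hpc.symm)),
      by
        by_contra hcon
        exact hzC (hclosed u hu z hzY hcon huz),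
      ⟨u, hu, huz.symm⟩, Or.inl rfl, Or.inl rfl⟩
  exact st.exists_separator h hM _ le_rfl hbigC

/-! ### Balanced separation by cliques -/

/-- A bounded number of common neighbourhoods of cliques separate `U` into cells with at most two
thirds of the vertices. -/
theorem IsBullEFree.exists_cliques [Finite V] (h : IsBullEFree G) {U : Set V} {m : ℕ}
    (hU : U.ncard ≤ m) (hm : 2 ≤ m) :
    ∃ Ks : List (Finset V), Ks.length ≤ 5 ∧
      (∀ K ∈ Ks, K.Nonempty ∧ (∀ a ∈ K, a ∈ U) ∧ ∀ a ∈ K, ∀ b ∈ K, a ≠ b → G.Adj a b) ∧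
      ∀ v ∈ U, ∃ D ⊆ U, v ∈ D ∧ 3 * D.ncard ≤ 2 * m ∧ ∀ a ∈ D, ∀ b ∈ U, b ∉ D → G.Adj a b →
        ∃ K ∈ Ks, ¬ ((∀ x ∈ K, G.Adj x a) ↔ ∀ x ∈ K, G.Adj x b) := by
  classical
  let N : Finset V → Set V := fun K => {u ∈ U | ∀ x ∈ K, G.Adj x u}
  let P : Finset V → Prop := fun K => (∀ a ∈ K, a ∈ U) ∧
    (∀ a ∈ K, ∀ b ∈ K, a ≠ b → G.Adj a b) ∧ (K = ∅ ∨ 2 * m < 3 * (N K).ncard)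
  -- The empty clique is admitted unconditionally so that a largest candidate exists. By maximality,
  -- enlarging `K` by a vertex of `N K` brings the common neighbourhood down to at most `2m/3`.
  obtain ⟨K, hK, hmax⟩ : ∃ K, P K ∧ ∀ K', P K' → K'.card ≤ K.card := by
    have : Fintype V := Fintype.ofFinite V
    obtain ⟨K, hK, hmax⟩ := Finset.exists_max_image (univ.filter P) Finset.card
      ⟨∅, by simp [P]⟩
    exact ⟨K, by simpa using hK, fun K' hK' => hmax K' (by simpa using hK')⟩
  obtain ⟨hKU, hKc, hKN⟩ := hK
  have hNU : ∀ K, N K ⊆ U := fun K u hu => hu.1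
  have hNm : ∀ K, (N K).ncard ≤ m := fun K =>
    (Set.ncard_le_ncard (hNU K) (Set.toFinite _)).trans hU
  obtain ⟨p, hp4, hpN, hp⟩ := h.exists_separator (hNm K) hm
  have hpK : ∀ a ∈ p, a ∉ K := fun a ha haK => G.irrefl ((hpN a ha).2 a haK)
  have hpc : ∀ q ∈ p, ∀ a ∈ insert q K, ∀ b ∈ insert q K, a ≠ b → G.Adj a b := by
    intro q hq a ha b hb hab
    rcases mem_insert.mp ha with rfl | ha' <;> rcases mem_insert.mp hb with rfl | hb'
    · exact absurd rfl hab
    · exact ((hpN a hq).2 b hb').symm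
    · exact (hpN b hq).2 a ha'
    · exact hKc a ha' b hb' hab
  have hpU : ∀ q ∈ p, ∀ a ∈ insert q K, a ∈ U := by
    intro q hq a ha
    rcases mem_insert.mp ha with rfl | ha
    · exact (hpN a hq).1
    · exact hKU a ha
  have hpsmall : ∀ q ∈ p, 3 * (N (insert q K)).ncard ≤ 2 * m := by
    intro q hq
    by_contra! hcon
    have := hmax (insert q K) ⟨hpU q hq, hpc q hq, Or.inr hcon⟩
    rw [card_insert_of_notMem (hpK q hq)] at this
    omega
  -- The cells are `U \ N K` with fewer than `m/3` vertices, the sets `N (insert q K)` with at most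
  -- `2m/3`, and the components left inside `N K` with at most `m/2`. The empty clique separates
  -- nothing and is dropped.
  refine ⟨(if K = ∅ then [] else [K]) ++ p.map (fun q => insert q K), ?_, ?_, ?_⟩
  · split_ifs <;> simp <;> omega
  · intro K' hK'
    rcases List.mem_append.mp hK' with hK' | hK'
    · split_ifs at hK' with hKe
      · simp at hK'
      · obtain rfl := List.mem_singleton.mp hK'
        exact ⟨nonempty_iff_ne_empty.mpr hKe, hKU, hKc⟩
    · obtain ⟨q, hq, rfl⟩ := List.mem_map.mp hK'
      exact ⟨insert_nonempty _ _, hpU q hq, hpc q hq⟩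
  · intro v hv
    have memK : K ≠ ∅ → K ∈ (if K = ∅ then [] else [K]) ++ p.map (fun q => insert q K) := by
      intro hne
      simp [hne]
    have memp : ∀ q ∈ p, insert q K ∈
        (if K = ∅ then [] else [K]) ++ p.map (fun q => insert q K) := by
      intro q hq
      exact List.mem_append_right _ (List.mem_map.mpr ⟨q, hq, rfl⟩)
    by_cases hvK : ∀ x ∈ K, G.Adj x v
    swap
    · have hne : K ≠ ∅ := by
        rintro rfl
        simp at hvK
      refine ⟨U \ N K, Set.sdiff_subset, ⟨hv, fun hh => hvK hh.2⟩, ?_, ?_⟩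
      · have h1 := hKN.resolve_left hne
        have h2 := Set.ncard_sdiff_add_ncard_of_subset (hNU K) (Set.toFinite _)
        omega
      · intro a ha b hb hbD _
        refine ⟨K, memK hne, fun hh => ha.2 ⟨ha.1, hh.mpr ?_⟩⟩
        by_contra hcon
        exact hbD ⟨hb, fun h' => hcon h'.2⟩
    by_cases hvp : ∃ q ∈ p, G.Adj q v
    · obtain ⟨q, hq, hqv⟩ := hvp
      refine ⟨N (insert q K), hNU _, ⟨hv, ?_⟩, hpsmall q hq, ?_⟩
      · intro x hx
        rcases mem_insert.mp hx with rfl | hx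
        · exact hqv
        · exact hvK x hx
      · intro a ha b hb hbD _
        exact ⟨insert q K, memp q hq, fun hh => hbD ⟨hb, hh.mp ha.2⟩⟩
    · push Not at hvp
      set S := {u ∈ N K | ∀ a ∈ p, ¬ G.Adj a u} with hS
      have hvS : v ∈ S := ⟨⟨hv, hvK⟩, hvp⟩
      have hD : reachIn G S v ⊆ S := reachIn_subset_self hvS
      refine ⟨reachIn G S v, fun u hu => (hD hu).1.1, self_mem_reachIn _ _, ?_, ?_⟩
      · have := hp v ⟨hv, hvK⟩ hvp
        omega
      · intro a ha b hb hbD hab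
        have hbS : b ∉ S := fun hbS => hbD (reachIn_closed ha hab hbS)
        by_cases hbK : ∀ x ∈ K, G.Adj x b
        · obtain ⟨q, hq, hqb⟩ : ∃ q ∈ p, G.Adj q b := by
            by_contra! hcon
            exact hbS ⟨⟨hb, hbK⟩, hcon⟩
          refine ⟨insert q K, memp q hq, fun hh => (hD ha).2 q hq (hh.mpr ?_ q (mem_insert_self _ _))⟩
          intro x hx
          rcases mem_insert.mp hx with rfl | hx
          · exact hqb
          · exact hbK x hx
        · refine ⟨K, memK ?_, fun hh => hbK (hh.mp (hD ha).1.2)⟩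
          rintro rfl
          simp at hbK

/-! ## Small dominating subsets of an independent set -/

/-- Let `K` be a clique that is complete to the independent set `I`. Inside a graph of clique
number at most `ω`, at most `max 2 ω` vertices of `I` have the same neighbours as `I` among the
vertices of `A` that are not complete to `K`. -/
theorem IsBullEFree.exists_dominating [Finite V] (h : IsBullEFree G) {K I A : Set V} {ω : ℕ}
    (hK : ∀ a ∈ K, ∀ b ∈ K, a ≠ b → G.Adj a b) (hI : ∀ a ∈ I, ∀ b ∈ I, ¬ G.Adj a b)
    (hKI : ∀ v ∈ K, ∀ a ∈ I, G.Adj v a)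
    (hA : ∀ Q : Finset V, (∀ a ∈ Q, a ∈ A) → (∀ a ∈ Q, ∀ b ∈ Q, a ≠ b → G.Adj a b) →
      Q.card ≤ ω) :
    ∃ S : Finset V, (∀ s ∈ S, s ∈ I) ∧ S.card ≤ max 2 ω ∧
      ∀ w ∈ A, (∃ v ∈ K, ¬ G.Adj v w) → (∃ a ∈ I, G.Adj a w) → ∃ s ∈ S, G.Adj s w := by
  classical
  let P : Finset V → Prop := fun S => (∀ s ∈ S, s ∈ I) ∧
      ∀ w ∈ A, (∃ v ∈ K, ¬ G.Adj v w) → (∃ a ∈ I, G.Adj a w) → ∃ s ∈ S, G.Adj s w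
  have hex : ∃ S, P S := by
    refine ⟨(Set.toFinite I).toFinset, by simp, ?_⟩
    rintro w - - ⟨a, ha, haw⟩
    exact ⟨a, by simpa using ha, haw⟩
  obtain ⟨S, hS, hmin⟩ : ∃ S, P S ∧ ∀ T, P T → S.card ≤ T.card := by
    have hex' : ∃ N, ∃ S, P S ∧ S.card = N := by
      obtain ⟨S, hS⟩ := hex
      exact ⟨_, S, hS, rfl⟩
    obtain ⟨S, hS, hc⟩ := Nat.find_spec hex'
    exact ⟨S, hS, fun T hT => hc ▸ Nat.find_min' hex' ⟨T, hT, rfl⟩⟩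
  refine ⟨S, hS.1, ?_, hS.2⟩
  by_contra! hcard
  -- Minimality gives each vertex of `S` a private neighbour. Once `S` has three vertices these
  -- private neighbours form a clique in `A`, which bounds `S` by `ω`.
  have hpriv : ∀ a ∈ S, ∃ w ∈ A, (∃ v ∈ K, ¬ G.Adj v w) ∧ G.Adj a w ∧
      ∀ b ∈ S, b ≠ a → ¬ G.Adj b w := by
    intro a ha
    by_contra! hcon
    have hPe : P (S.erase a) := by
      refine ⟨fun s hs => hS.1 s (mem_of_mem_erase hs), ?_⟩
      intro w hw hKw hIw
      obtain ⟨s, hs, hsw⟩ := hS.2 w hw hKw hIw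
      by_cases hsa : s = a
      · subst hsa
        obtain ⟨b, hb, hbs, hbw⟩ := hcon w hw hKw hsw
        exact ⟨b, mem_erase.mpr ⟨hbs, hb⟩, hbw⟩
      · exact ⟨s, mem_erase.mpr ⟨hsa, hs⟩, hsw⟩
    have h1 := hmin _ hPe
    have h2 := card_erase_lt_of_mem ha
    omega
  choose! w hwA hwK haw hpriv using hpriv
  have hadj : ∀ a ∈ S, ∀ b ∈ S, a ≠ b → G.Adj (w a) (w b) := by
    intro a ha b hb hab
    -- This third vertex will be the pendant of an `E` or the apex of the triangle of a bull; hence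
    -- the `2` in `max 2 ω`.
    obtain ⟨c, hc, hca, hcb⟩ : ∃ c ∈ S, c ≠ a ∧ c ≠ b := by
      by_contra! hcon
      have : S ⊆ {a, b} := by
        intro c hc
        by_cases hca : c = a
        · simp [hca]
        · simp [hcon c hc hca]
      have h1 := card_le_card this
      have h2 := card_le_two (a := a) (b := b)
      omega
    by_contra hww
    have haI := hS.1 a ha
    have hbI := hS.1 b hb
    have hcI := hS.1 c hc
    obtain ⟨v, hv, hvw⟩ := hwK a ha
    obtain ⟨v', hv', hvw'⟩ := hwK b hb
    -- A vertex `v` of `K` that misses both private neighbours is the centre of an `E`: the path `w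
    -- a, a, v, b, w b` with pendant `c`. Otherwise `v` and `v'` miss one each, and `v, v', c` is
    -- the triangle of a bull with pendants `w b` and `w a`.
    have centre : ∀ v ∈ K, ¬ G.Adj v (w a) → ¬ G.Adj v (w b) → False := by
      intro v hv h1 h2
      exact h.no_e (haw a ha).symm (hKI v hv a haI).symm (hKI v hv b hbI) (haw b hb)
        (hKI v hv c hcI) (fun hh => h1 hh.symm) (fun hh => hpriv a ha b hb hab.symm hh.symm) hww
        (fun hh => hpriv a ha c hc hca hh.symm) (hI a haI b hbI) (hpriv b hb a ha hab)
        (hI a haI c hcI) h2 (hI b hbI c hcI) (fun hh => hpriv b hb c hc hcb hh.symm)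
    have h1 : G.Adj v (w b) := by
      by_contra hcon
      exact centre v hv hvw hcon
    have h2 : G.Adj v' (w a) := by
      by_contra hcon
      exact centre v' hv' hcon hvw'
    have hvv' : v ≠ v' := by
      rintro rfl
      exact hvw h2
    exact h.no_bull (hK v hv v' hv' hvv') (hKI v' hv' c hcI) (hKI v hv c hcI) h1 h2 hvw hvw'
      (hpriv b hb c hc hcb) (hpriv a ha c hc hca) (fun hh => hww hh.symm)
  have hinj : Set.InjOn w S := by
    intro a ha b hb hab
    by_contra hne
    have := hadj a ha b hb hne
    rw [hab] at this
    exact G.irrefl this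
  have h1 := hA (S.image w) (by simpa using hwA) (by
    simp only [mem_image, forall_exists_index, and_imp, forall_apply_eq_imp_iff₂]
    intro a ha b hb hab
    exact hadj a ha b hb fun hh => hab (hh ▸ rfl))
  rw [card_image_of_injOn hinj] at h1
  omega

end Graph

/-! ## The algorithm -/

namespace PartialColoringAlgorithm

/-- A partial assignment of (revenue, color) pairs to the vertices. -/
abbrev Vec (n : ℕ) := Fin n → Option (ℚ × ℚ)

variable {m n : ℕ}

def vzero : Vec n := fun _ => none

def vinter (a b : Vec n) : Vec n := fun v => if (b v).isSome then a v else none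

def vdiff (a b : Vec n) : Vec n := fun v => if (b v).isSome then none else a v

/-- The entry with the larger revenue. -/
def pick : Option (ℚ × ℚ) → Option (ℚ × ℚ) → Option (ℚ × ℚ)
  | none, y => y
  | some x, none => some x
  | some x, some y => if x.1 ≤ y.1 then some y else some x

def vmerge (a b : Vec n) : Vec n := fun v => pick (a v) (b v)

/-- The number of common elements of the supports. -/
def vdot (a b : Vec n) : ℕ := ∑ v, if (a v).isSome ∧ (b v).isSome then 1 else 0

/-- Keep the vertices with at most `q` neighbours in `T`. -/
def vfilt (rows : Fin m → Vec n) (T : Vec n) (q : ℕ) (a : Vec m) : Vec m :=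
  fun v => if vdot (rows v) T ≤ q then a v else none

def weight : Option (ℚ × ℚ) → ℚ
  | none => 0
  | some x => x.1

def vtotal (a : Vec n) : ℚ := ∑ v, weight (a v)

def better (a b : Vec n) : Vec n := if vtotal a ≤ vtotal b then b else a

/-- Each vertex takes the best color for which it has at most `q` competitors. -/
def leaf (rows : Fin n → Vec n) (q : ℕ) : List (Vec n) → Vec n
  | [] => vzero
  | A :: Ls => vmerge (vfilt rows A q A) (leaf rows q Ls)

/-- The filter with threshold `0` selects the vertices without a neighbour in `A ∩ C`, so the rest
of `A` is what joins `C`. -/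
def growBy (rows : Fin n → Vec n) (A C : Vec n) : Vec n :=
  vmerge C (vdiff A (vfilt rows (vinter A C) 0 A))

def growAll (rows : Fin n → Vec n) : List (Vec n) → Vec n → Vec n
  | [], C => C
  | A :: Ls, C => growAll rows Ls (growBy rows A C)

/-- The union of the components of the conflict graph that meet `C`. -/
def closure (rows : Fin n → Vec n) (Ls : List (Vec n)) (C : Vec n) : Vec n :=
  (growAll rows Ls)^[n] C

def vfirst (a : Vec n) : Vec n := fun v => if ∀ u < v, a u = none then a v else none

/-- Solve the components of the conflict graph inside `R` separately. -/
def comps (slv : List (Vec n) → Vec n) (rows : Fin n → Vec n) (Ls : List (Vec n)) :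
    ℕ → Vec n → Vec n
  | 0, _ => vzero
  | f + 1, R =>
    vmerge (slv (Ls.map fun A => vinter A (closure rows Ls (vfirst R))))
      (comps slv rows Ls f (vdiff R (closure rows Ls (vfirst R))))

/-- Deleting moves act on the first layer only; `rotMove` brings the other layers to the front. -/
def degMove (rows : Fin n → Vec n) (q : ℕ) : List (Vec n) → List (Vec n)
  | [] => []
  | A :: Ls => vfilt rows A q A :: Ls

/-- Harmless when the intended solution uses the vertex with row `r` in the first layer. Neighbours
inside `Y` are spared because only the outside of `Y` has to be cleared before a cut. -/
def nbrMove (r Y : Vec n) : List (Vec n) → List (Vec n)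
  | [] => []
  | A :: Ls => vdiff A (vdiff r Y) :: Ls

/-- Drops the vertices of `A ∩ Y` that have a neighbour in `A \ Y`, so that no edge of the layer
crosses the border of `Y`. -/
def cut (rows : Fin n → Vec n) (Y A : Vec n) : Vec n :=
  vmerge (vdiff A Y) (vfilt rows (vdiff A Y) 0 (vinter A Y))

def cutMove (rows : Fin n → Vec n) (Y : Vec n) : List (Vec n) → List (Vec n)
  | [] => []
  | A :: Ls => cut rows Y A :: Ls

def rotMove : List (Vec n) → List (Vec n)
  | [] => []
  | A :: Ls => Ls ++ [A]

/-- It is reached with `q = n`. With that threshold `leaf` keeps every vertex occurring in a layer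
and so provides the ground set for the splitting into components. -/
def loopEnd (slv : Vec n → List (Vec n) → Vec n) (rows : Fin n → Vec n) (q : ℕ) (Y : Vec n)
    (Ls : List (Vec n)) : Vec n :=
  better (leaf rows 0 Ls) (better (slv Y (cutMove rows Y Ls)) (better (slv Y (rotMove Ls))
    (comps (slv vzero) rows Ls n (leaf rows q Ls))))

/-- A single pass over the rows enumerates both the vertices (through `r`) and the degree thresholds
`0, …, n - 1` (through `q`). -/
def loop (slv : Vec n → List (Vec n) → Vec n) (rows : Fin n → Vec n) :
    List (Vec n) → ℕ → Vec n → List (Vec n) → Vec n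
  | [], q, Y, Ls => loopEnd slv rows q Y Ls
  | r :: rs, q, Y, Ls =>
    better (slv Y (degMove rows q Ls)) (better (slv Y (nbrMove r Y Ls)) (better (slv r Ls)
      (better (slv (vinter Y r) Ls) (loop slv rows rs (q + 1) Y Ls))))

/-- The best solution that is found with `b` moves. -/
def solve (rows : Fin n → Vec n) : ℕ → Vec n → List (Vec n) → Vec n
  | 0, _, Ls => leaf rows 0 Ls
  | b + 1, Y, Ls => loop (solve rows b) rows (List.ofFn rows) 0 Y Ls

open Classical in
noncomputable def adjRows (G : SimpleGraph (Fin n)) : Fin n → Vec n :=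
  fun v u => if G.Adj v u then some (0, 0) else none

/-! ### Supports -/

def supp (a : Vec n) : Set (Fin n) := {v | (a v).isSome}

theorem mem_supp {a : Vec n} {v : Fin n} : v ∈ supp a ↔ ∃ e, a v = some e :=
  Option.isSome_iff_exists

theorem mem_supp_of {a : Vec n} {v : Fin n} {e : ℚ × ℚ} (h : a v = some e) : v ∈ supp a :=
  mem_supp.mpr ⟨e, h⟩

theorem notMem_supp {a : Vec n} {v : Fin n} : v ∉ supp a ↔ a v = none := by
  simp [supp]

@[simp] theorem supp_vzero : supp (vzero : Vec n) = ∅ := by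
  ext v; simp [supp, vzero]

theorem vinter_eq_some {a b : Vec n} {v : Fin n} {e : ℚ × ℚ} :
    vinter a b v = some e ↔ a v = some e ∧ v ∈ supp b := by
  unfold vinter supp
  split_ifs with h <;> simp [h]

theorem vdiff_eq_some {a b : Vec n} {v : Fin n} {e : ℚ × ℚ} :
    vdiff a b v = some e ↔ a v = some e ∧ v ∉ supp b := by
  unfold vdiff supp
  split_ifs with h <;> simp [h]

theorem supp_vinter (a b : Vec n) : supp (vinter a b) = supp a ∩ supp b := by
  ext v; simp [mem_supp, vinter_eq_some]

theorem supp_vdiff (a b : Vec n) : supp (vdiff a b) = supp a \ supp b := by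
  ext v; simp only [mem_supp, vdiff_eq_some, Set.mem_sdiff]; simp

theorem pick_eq_some {x y : Option (ℚ × ℚ)} {e : ℚ × ℚ} (h : pick x y = some e) :
    x = some e ∨ y = some e := by
  rcases x with _ | x <;> rcases y with _ | y <;> simp only [pick] at h
  · simp at h
  · exact Or.inr h
  · exact Or.inl h
  · split_ifs at h
    · exact Or.inr h
    · exact Or.inl h

theorem exists_pick_left (x : ℚ × ℚ) (y : Option (ℚ × ℚ)) :
    ∃ e, pick (some x) y = some e ∧ x.1 ≤ e.1 := by
  rcases y with _ | y <;> simp only [pick]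
  · exact ⟨x, rfl, le_rfl⟩
  · split_ifs with h
    · exact ⟨y, rfl, h⟩
    · exact ⟨x, rfl, le_rfl⟩

theorem exists_pick_right (x : Option (ℚ × ℚ)) (y : ℚ × ℚ) :
    ∃ e, pick x (some y) = some e ∧ y.1 ≤ e.1 := by
  rcases x with _ | x <;> simp only [pick]
  · exact ⟨y, rfl, le_rfl⟩
  · split_ifs with h
    · exact ⟨y, rfl, le_rfl⟩
    · exact ⟨x, rfl, (not_le.mp h).le⟩

theorem supp_vmerge (a b : Vec n) : supp (vmerge a b) = supp a ∪ supp b := by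
  ext v
  simp only [Set.mem_union, mem_supp, vmerge]
  constructor
  · rintro ⟨e, he⟩
    exact (pick_eq_some he).imp (fun h => ⟨e, h⟩) fun h => ⟨e, h⟩
  · rintro (⟨e, he⟩ | ⟨e, he⟩) <;> rw [he]
    · obtain ⟨e', h, -⟩ := exists_pick_left e (b v)
      exact ⟨e', h⟩
    · obtain ⟨e', h, -⟩ := exists_pick_right (a v) e
      exact ⟨e', h⟩

theorem vfilt_eq_some {rows : Fin m → Vec n} {T : Vec n} {q : ℕ} {a : Vec m} {v : Fin m}
    {e : ℚ × ℚ} : vfilt rows T q a v = some e ↔ a v = some e ∧ vdot (rows v) T ≤ q := by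
  unfold vfilt
  split_ifs with h <;> simp [h]

variable {G : SimpleGraph (Fin n)}

theorem mem_supp_adjRows {u v : Fin n} : u ∈ supp (adjRows G v) ↔ G.Adj v u := by
  simp only [supp, adjRows, Set.mem_ofPred_eq]
  split_ifs with h <;> simp [h]

theorem vdot_adjRows (v : Fin n) (T : Vec n) :
    vdot (adjRows G v) T = {u | G.Adj v u ∧ u ∈ supp T}.ncard := by
  classical
  have : {u | G.Adj v u ∧ u ∈ supp T} =
      ((Finset.univ.filter fun u => (adjRows G v u).isSome ∧ (T u).isSome : Finset _) :
        Set (Fin n)) := by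
    ext u
    simp only [Set.mem_ofPred_eq, Finset.coe_filter, Finset.mem_univ, true_and]
    exact and_congr mem_supp_adjRows.symm Iff.rfl
  rw [this, Set.ncard_coe_finset, Finset.card_filter]
  rfl

theorem vdot_le (a b : Vec n) : vdot a b ≤ n := by
  unfold vdot
  refine (Finset.sum_le_card_nsmul _ _ 1 fun v _ => ?_).trans (by simp)
  split_ifs <;> simp

theorem vdot_adjRows_eq_zero {v : Fin n} {T : Vec n} :
    vdot (adjRows G v) T ≤ 0 ↔ ∀ u ∈ supp T, ¬ G.Adj v u := by
  rw [vdot_adjRows, Nat.le_zero, Set.ncard_eq_zero]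
  constructor
  · intro h u hu huv
    have : u ∈ {u | G.Adj v u ∧ u ∈ supp T} := ⟨huv, hu⟩
    rw [h] at this
    exact this
  · intro h
    ext u
    simp only [Set.mem_ofPred_eq, Set.mem_empty_iff_false, iff_false, not_and]
    exact fun h1 h2 => h u h2 h1

theorem supp_growBy (A C : Vec n) : supp (growBy (adjRows G) A C) =
    supp C ∪ {v ∈ supp A | ∃ u ∈ supp A ∩ supp C, G.Adj v u} := by
  rw [growBy, supp_vmerge, supp_vdiff]
  congr 1
  ext v
  simp only [Set.mem_sdiff, Set.mem_ofPred_eq]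
  refine and_congr_right fun hv => ?_
  obtain ⟨e, he⟩ := mem_supp.mp hv
  rw [mem_supp, ← not_iff_not, not_not]
  simp only [vfilt_eq_some, vdot_adjRows_eq_zero, supp_vinter, he]
  constructor
  · rintro ⟨-, -, h⟩ ⟨u, hu, huv⟩
    exact h u hu huv
  · exact fun h => ⟨e, rfl, fun u hu huv => h ⟨u, hu, huv⟩⟩

/-! ### The conflict graph and its components -/

/-- Adjacency in the conflict graph of a list of layers. -/
def Conflict (G : SimpleGraph (Fin n)) (Ls : List (Vec n)) (u v : Fin n) : Prop :=
  G.Adj u v ∧ ∃ A ∈ Ls, u ∈ supp A ∧ v ∈ supp A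

theorem Conflict.symm {Ls : List (Vec n)} {u v : Fin n} (h : Conflict G Ls u v) :
    Conflict G Ls v u :=
  ⟨h.1.symm, h.2.imp fun _ hA => ⟨hA.1, hA.2.2, hA.2.1⟩⟩

/-- A set of vertices that no edge of the conflict graph leaves. -/
def ConflictClosed (G : SimpleGraph (Fin n)) (Ls : List (Vec n)) (D : Set (Fin n)) : Prop :=
  ∀ u ∈ D, ∀ v, Conflict G Ls u v → v ∈ D

theorem ConflictClosed.diff {Ls : List (Vec n)} {D C : Set (Fin n)} (hD : ConflictClosed G Ls D)
    (hC : ConflictClosed G Ls C) : ConflictClosed G Ls (D \ C) :=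
  fun u hu v huv => ⟨hD u hu.1 v huv, fun hv => hu.2 (hC v hv u huv.symm)⟩

theorem supp_subset_growAll (Ls : List (Vec n)) (C : Vec n) :
    supp C ⊆ supp (growAll (adjRows G) Ls C) := by
  induction Ls generalizing C with
  | nil => exact subset_rfl
  | cons A Ls ih =>
    refine subset_trans ?_ (ih _)
    rw [supp_growBy]
    exact Set.subset_union_left

theorem conflict_mem_growAll {Ls : List (Vec n)} {C : Vec n} {u v : Fin n} (hu : u ∈ supp C)
    (h : Conflict G Ls u v) : v ∈ supp (growAll (adjRows G) Ls C) := by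
  obtain ⟨huv, B, hB, huB, hvB⟩ := h
  induction Ls generalizing C with
  | nil => simp at hB
  | cons A Ls ih =>
    rcases List.mem_cons.mp hB with rfl | hB
    · refine supp_subset_growAll Ls _ ?_
      rw [supp_growBy]
      exact Or.inr ⟨hvB, u, ⟨huB, hu⟩, huv.symm⟩
    · refine ih ?_ hB
      rw [supp_growBy]
      exact Or.inl hu

theorem growAll_subset {Ls : List (Vec n)} {D : Set (Fin n)} (hD : ConflictClosed G Ls D)
    {C : Vec n} (hC : supp C ⊆ D) : supp (growAll (adjRows G) Ls C) ⊆ D := by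
  induction Ls generalizing C with
  | nil => exact hC
  | cons A Ls ih =>
    refine ih (fun u hu v huv => hD u hu v ⟨huv.1, ?_⟩) ?_
    · obtain ⟨B, hB, h⟩ := huv.2
      exact ⟨B, List.mem_cons_of_mem _ hB, h⟩
    · rw [supp_growBy]
      rintro v (hv | ⟨hv, u, hu, hvu⟩)
      · exact hC hv
      · exact hD u (hC hu.2) v ⟨hvu.symm, A, by simp, hu.1, hv⟩

theorem iterate_growAll_subset {Ls : List (Vec n)} {D : Set (Fin n)}
    (hD : ConflictClosed G Ls D) (j : ℕ) {C : Vec n} (hC : supp C ⊆ D) :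
    supp ((growAll (adjRows G) Ls)^[j] C) ⊆ D := by
  induction j generalizing C with
  | zero => exact hC
  | succ j ih => exact ih (growAll_subset hD hC)

theorem closure_subset {Ls : List (Vec n)} {D : Set (Fin n)} (hD : ConflictClosed G Ls D)
    {C : Vec n} (hC : supp C ⊆ D) : supp (closure (adjRows G) Ls C) ⊆ D :=
  iterate_growAll_subset hD n hC

theorem subset_closure (Ls : List (Vec n)) (C : Vec n) :
    supp C ⊆ supp (closure (adjRows G) Ls C) := by
  have key : ∀ j (C : Vec n), supp C ⊆ supp ((growAll (adjRows G) Ls)^[j] C) := by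
    intro j
    induction j with
    | zero => exact fun C => subset_rfl
    | succ j ih => exact fun C => (supp_subset_growAll Ls C).trans (ih _)
  exact key n C

/-- Each round of growth adds a vertex unless the set is already closed, so after `n` rounds it is
closed or contains all vertices. -/
theorem conflictClosed_closure (Ls : List (Vec n)) (C : Vec n) :
    ConflictClosed G Ls (supp (closure (adjRows G) Ls C)) := by
  have key : ∀ j, ConflictClosed G Ls (supp ((growAll (adjRows G) Ls)^[j] C)) ∨
      j ≤ (supp ((growAll (adjRows G) Ls)^[j] C)).ncard := by
    intro j
    induction j with
    | zero => exact Or.inr (Nat.zero_le _)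
    | succ j ih =>
      rw [Function.iterate_succ_apply']
      set D := (growAll (adjRows G) Ls)^[j] C
      have hsub := supp_subset_growAll (G := G) Ls D
      by_cases heq : supp (growAll (adjRows G) Ls D) = supp D
      · left
        rw [heq]
        intro u hu v huv
        rw [← heq]
        exact conflict_mem_growAll hu huv
      · rcases ih with ih | ih
        · exact absurd ((growAll_subset ih subset_rfl).antisymm hsub) heq
        · right
          have := Set.ncard_lt_ncard (hsub.ssubset_of_ne fun h => heq h.symm) (Set.toFinite _)
          omega
  rcases key n with h | h
  · exact h
  · have : supp (closure (adjRows G) Ls C) = Set.univ := by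
      refine Set.eq_of_subset_of_ncard_le (Set.subset_univ _) ?_ (Set.toFinite _)
      rw [Set.ncard_univ, Nat.card_eq_fintype_card, Fintype.card_fin]
      exact h
    intro u _ v _
    rw [this]
    trivial

theorem supp_vfirst_subset (a : Vec n) : supp (vfirst a) ⊆ supp a := by
  intro v hv
  simp only [supp, vfirst, Set.mem_ofPred_eq] at hv ⊢
  split_ifs at hv with h
  · exact hv
  · simp at hv

theorem exists_supp_vfirst {a : Vec n} (h : (supp a).Nonempty) :
    ∃ v ∈ supp a, supp (vfirst a) = {v} := by
  classical
  obtain ⟨v, hv, hmin⟩ := Set.exists_min_image (supp a) id (Set.toFinite _) h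
  refine ⟨v, hv, ?_⟩
  ext w
  simp only [supp, vfirst, Set.mem_ofPred_eq, Set.mem_singleton_iff]
  constructor
  · intro hw
    split_ifs at hw with hlt
    · refine le_antisymm ?_ (hmin w hw)
      by_contra hcon
      have := hlt v (not_le.mp hcon)
      rw [← notMem_supp] at this
      exact this hv
    · simp at hw
  · rintro rfl
    rw [if_pos]
    · exact hv
    · intro u hu
      rw [← notMem_supp]
      exact fun h => absurd (hmin u h) (not_le.mpr hu)

/-! ### Feasibility -/

/-- `s` takes its entries from the layers `Ls`. -/
def Covered (s : Vec n) (Ls : List (Vec n)) : Prop :=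
  ∀ v e, s v = some e → ∃ A ∈ Ls, A v = some e

/-- Adjacent vertices have different colors. -/
def Proper (G : SimpleGraph (Fin n)) (s : Vec n) : Prop :=
  ∀ u v e e', G.Adj u v → s u = some e → s v = some e' → e.2 ≠ e'.2

/-- Each layer has only one color, and different layers have different colors. -/
structure Separated (Ls : List (Vec n)) : Prop where
  mono : ∀ A ∈ Ls, ∀ u v e e', A u = some e → A v = some e' → e.2 = e'.2
  pairwise : Ls.Pairwise fun A B => ∀ u v e e', A u = some e → B v = some e' → e.2 ≠ e'.2

theorem Separated.eq {Ls : List (Vec n)} (h : Separated Ls) {A B : Vec n} (hA : A ∈ Ls)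
    (hB : B ∈ Ls) {u v : Fin n} {e e' : ℚ × ℚ} (hu : A u = some e) (hv : B v = some e')
    (he : e.2 = e'.2) : A = B := by
  by_contra hne
  have : Std.Symm fun A B : Vec n => ∀ u v e e', A u = some e → B v = some e' → e.2 ≠ e'.2 :=
    ⟨fun A B hAB u v e e' hu hv hee => hAB v u e' e hv hu hee.symm⟩
  exact h.pairwise.forall hA hB hne u v e e' hu hv he

def Sub (a b : Vec n) : Prop := ∀ v e, a v = some e → b v = some e

theorem Sub.refl (a : Vec n) : Sub a a := fun _ _ h => h

theorem Sub.trans {a b c : Vec n} (h : Sub a b) (h' : Sub b c) : Sub a c :=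
  fun v e hv => h' v e (h v e hv)

theorem Sub.supp_subset {a b : Vec n} (h : Sub a b) : supp a ⊆ supp b := fun v hv => by
  obtain ⟨e, he⟩ := mem_supp.mp hv
  exact mem_supp_of (h v e he)

theorem forall₂_refl {α : Type*} {R : α → α → Prop} (h : ∀ a, R a a) (l : List α) :
    List.Forall₂ R l l :=
  List.forall₂_same.mpr fun a _ => h a

theorem exists_of_forall₂ {α : Type*} {R : α → α → Prop} {l l' : List α}
    (h : List.Forall₂ R l l') {a : α} (ha : a ∈ l) : ∃ b ∈ l', R a b := by
  induction h with
  | nil => simp at ha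
  | cons h1 _ ih =>
    rcases List.mem_cons.mp ha with rfl | ha
    · exact ⟨_, by simp, h1⟩
    · obtain ⟨b, hb, hab⟩ := ih ha
      exact ⟨b, by simp [hb], hab⟩

theorem Separated.anti {Ls Ls' : List (Vec n)} (h : Separated Ls)
    (hs : List.Forall₂ Sub Ls' Ls) : Separated Ls' := by
  refine ⟨fun A hA u v e e' hu hv => ?_, ?_⟩
  · obtain ⟨B, hB, hAB⟩ := exists_of_forall₂ hs hA
    exact h.mono B hB u v e e' (hAB _ _ hu) (hAB _ _ hv)
  · have hp := h.pairwise
    clear h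
    induction hs with
    | nil => exact List.Pairwise.nil
    | @cons A B l l' hAB hs ih =>
      rw [List.pairwise_cons] at hp ⊢
      refine ⟨fun A' hA' u v e e' hu hv => ?_, ih hp.2⟩
      obtain ⟨B', hB', hAB'⟩ := exists_of_forall₂ hs hA'
      exact hp.1 B' hB' u v e e' (hAB _ _ hu) (hAB' _ _ hv)

theorem Covered.mono {s : Vec n} {Ls Ls' : List (Vec n)} (h : Covered s Ls')
    (hs : List.Forall₂ Sub Ls' Ls) : Covered s Ls := by
  intro v e hv
  obtain ⟨A, hA, hAv⟩ := h v e hv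
  obtain ⟨B, hB, hAB⟩ := exists_of_forall₂ hs hA
  exact ⟨B, hB, hAB v e hAv⟩

theorem sub_vfilt (rows : Fin n → Vec n) (T : Vec n) (q : ℕ) (a : Vec n) :
    Sub (vfilt rows T q a) a := fun _ _ h => (vfilt_eq_some.mp h).1

theorem sub_vdiff (a b : Vec n) : Sub (vdiff a b) a := fun _ _ h => (vdiff_eq_some.mp h).1

theorem sub_vinter (a b : Vec n) : Sub (vinter a b) a := fun _ _ h => (vinter_eq_some.mp h).1

theorem cut_eq_some {Y A : Vec n} {v : Fin n} {e : ℚ × ℚ} :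
    cut (adjRows G) Y A v = some e ↔
      A v = some e ∧ (v ∈ supp Y → ∀ u ∈ supp A, u ∉ supp Y → ¬ G.Adj v u) := by
  have hA : supp (vdiff A Y) = supp A \ supp Y := supp_vdiff A Y
  constructor
  · intro h
    rcases pick_eq_some h with h | h
    · rw [vdiff_eq_some] at h
      exact ⟨h.1, fun hv => absurd hv h.2⟩
    · rw [vfilt_eq_some, vinter_eq_some, vdot_adjRows_eq_zero, hA] at h
      exact ⟨h.1.1, fun _ u hu huY => h.2 u ⟨hu, huY⟩⟩
  · rintro ⟨h1, h2⟩
    by_cases hv : v ∈ supp Y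
    · have ha : vdiff A Y v = none := by
        rw [← notMem_supp, hA]
        exact fun h => h.2 hv
      have hb : vfilt (adjRows G) (vdiff A Y) 0 (vinter A Y) v = some e := by
        rw [vfilt_eq_some, vinter_eq_some, vdot_adjRows_eq_zero, hA]
        exact ⟨⟨h1, hv⟩, fun u hu => h2 hv u hu.1 hu.2⟩
      rw [cut, vmerge, ha, hb]
      rfl
    · have ha : vdiff A Y v = some e := vdiff_eq_some.mpr ⟨h1, hv⟩
      have hb : vfilt (adjRows G) (vdiff A Y) 0 (vinter A Y) v = none := by
        rw [← notMem_supp]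
        intro h
        obtain ⟨e', he'⟩ := mem_supp.mp h
        rw [vfilt_eq_some, vinter_eq_some] at he'
        exact hv he'.1.2
      rw [cut, vmerge, ha, hb]
      rfl

theorem sub_cut (Y A : Vec n) : Sub (cut (adjRows G) Y A) A := fun _ _ h => (cut_eq_some.mp h).1

theorem degMove_sub (q : ℕ) (Ls : List (Vec n)) :
    List.Forall₂ Sub (degMove (adjRows G) q Ls) Ls := by
  cases Ls with
  | nil => exact List.Forall₂.nil
  | cons A Ls => exact List.Forall₂.cons (sub_vfilt _ _ _ _) (forall₂_refl Sub.refl _)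

theorem nbrMove_sub (r Y : Vec n) (Ls : List (Vec n)) :
    List.Forall₂ Sub (nbrMove r Y Ls) Ls := by
  cases Ls with
  | nil => exact List.Forall₂.nil
  | cons A Ls => exact List.Forall₂.cons (sub_vdiff _ _) (forall₂_refl Sub.refl _)

theorem cutMove_sub (Y : Vec n) (Ls : List (Vec n)) :
    List.Forall₂ Sub (cutMove (adjRows G) Y Ls) Ls := by
  cases Ls with
  | nil => exact List.Forall₂.nil
  | cons A Ls => exact List.Forall₂.cons (sub_cut _ _) (forall₂_refl Sub.refl _)

theorem rotMove_perm (Ls : List (Vec n)) : (rotMove Ls).Perm Ls := by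
  cases Ls with
  | nil => exact List.Perm.nil
  | cons A Ls => exact List.perm_append_singleton A Ls

theorem Separated.perm {Ls Ls' : List (Vec n)} (h : Separated Ls) (hp : Ls'.Perm Ls) :
    Separated Ls' := by
  refine ⟨fun A hA => h.mono A (hp.mem_iff.mp hA), ?_⟩
  exact (hp.pairwise_iff fun hAB u v e e' hu hv hee => hAB v u e' e hv hu hee.symm).mpr h.pairwise

theorem Covered.perm {s : Vec n} {Ls Ls' : List (Vec n)} (h : Covered s Ls') (hp : Ls'.Perm Ls) :
    Covered s Ls := fun v e hv => by
  obtain ⟨A, hA, hAv⟩ := h v e hv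
  exact ⟨A, hp.mem_iff.mp hA, hAv⟩

theorem leaf_eq_some {rows : Fin n → Vec n} {q : ℕ} {Ls : List (Vec n)} {v : Fin n} {e : ℚ × ℚ}
    (h : leaf rows q Ls v = some e) : ∃ A ∈ Ls, A v = some e ∧ vdot (rows v) A ≤ q := by
  induction Ls with
  | nil => simp [leaf, vzero] at h
  | cons A Ls ih =>
    rcases pick_eq_some h with h | h
    · exact ⟨A, by simp, vfilt_eq_some.mp h⟩
    · obtain ⟨B, hB, h⟩ := ih h
      exact ⟨B, by simp [hB], h⟩

theorem exists_leaf_ge {rows : Fin n → Vec n} {q : ℕ} {Ls : List (Vec n)} {A : Vec n}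
    (hA : A ∈ Ls) {v : Fin n} {e : ℚ × ℚ} (he : A v = some e) (hq : vdot (rows v) A ≤ q) :
    ∃ e', leaf rows q Ls v = some e' ∧ e.1 ≤ e'.1 := by
  induction Ls with
  | nil => simp at hA
  | cons B Ls ih =>
    rcases List.mem_cons.mp hA with rfl | hA
    · have : vfilt rows A q A v = some e := vfilt_eq_some.mpr ⟨he, hq⟩
      simp only [leaf, vmerge, this]
      exact exists_pick_left _ _
    · obtain ⟨e', h1, h2⟩ := ih hA
      simp only [leaf, vmerge, h1]
      obtain ⟨e'', h3, h4⟩ := exists_pick_right (vfilt rows B q B v) e'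
      exact ⟨e'', h3, h2.trans h4⟩

theorem mem_supp_leaf {Ls : List (Vec n)} {rows : Fin n → Vec n} {v : Fin n} :
    v ∈ supp (leaf rows n Ls) ↔ ∃ A ∈ Ls, v ∈ supp A := by
  constructor
  · intro h
    obtain ⟨e, he⟩ := mem_supp.mp h
    obtain ⟨A, hA, h, -⟩ := leaf_eq_some he
    exact ⟨A, hA, mem_supp_of h⟩
  · rintro ⟨A, hA, h⟩
    obtain ⟨e, he⟩ := mem_supp.mp h
    obtain ⟨e', h, -⟩ := exists_leaf_ge hA he (vdot_le (rows v) A)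
    exact mem_supp_of h

theorem conflictClosed_leaf (Ls : List (Vec n)) (rows : Fin n → Vec n) :
    ConflictClosed G Ls (supp (leaf rows n Ls)) := by
  rintro u - v ⟨-, A, hA, -, hv⟩
  exact mem_supp_leaf.mpr ⟨A, hA, hv⟩

/-- `s` is a feasible solution with entries from the layers `Ls`. -/
def Feasible (G : SimpleGraph (Fin n)) (Ls : List (Vec n)) (s : Vec n) : Prop :=
  Covered s Ls ∧ Proper G s

/-- Equal colors come from the same layer, and with threshold `0` a chosen vertex has no neighbour
in its layer. -/
theorem feasible_leaf {Ls : List (Vec n)} (h : Separated Ls) :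
    Feasible G Ls (leaf (adjRows G) 0 Ls) := by
  refine ⟨fun v e hv => ?_, fun u v e e' huv hu hv he => ?_⟩
  · obtain ⟨A, hA, h1, -⟩ := leaf_eq_some hv
    exact ⟨A, hA, h1⟩
  · obtain ⟨A, hA, h1, h2⟩ := leaf_eq_some hu
    obtain ⟨B, hB, h3, -⟩ := leaf_eq_some hv
    obtain rfl := h.eq hA hB h1 h3 he
    exact vdot_adjRows_eq_zero.mp h2 v (mem_supp_of h3) huv

theorem map_vinter_sub (C : Vec n) (Ls : List (Vec n)) :
    List.Forall₂ Sub (Ls.map fun A => vinter A C) Ls := by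
  induction Ls with
  | nil => exact List.Forall₂.nil
  | cons A Ls ih => exact List.Forall₂.cons (sub_vinter _ _) ih

theorem covered_map_vinter {s C : Vec n} {Ls : List (Vec n)}
    (h : Covered s (Ls.map fun A => vinter A C)) : supp s ⊆ supp C := by
  intro v hv
  obtain ⟨e, he⟩ := mem_supp.mp hv
  obtain ⟨A, hA, hAv⟩ := h v e he
  obtain ⟨B, -, rfl⟩ := List.mem_map.mp hA
  exact (vinter_eq_some.mp hAv).2

/-- A color determines its layer, so adjacent vertices of equal color are in conflict and cannot
come from different components. -/
theorem feasible_comps {slv : List (Vec n) → Vec n} {Ls : List (Vec n)} (hLs : Separated Ls)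
    (hslv : ∀ Ls', Separated Ls' → Feasible G Ls' (slv Ls')) (f : ℕ) :
    ∀ R : Vec n, ConflictClosed G Ls (supp R) →
      Feasible G Ls (comps slv (adjRows G) Ls f R) ∧
      supp (comps slv (adjRows G) Ls f R) ⊆ supp R := by
  induction f with
  | zero =>
    intro R _
    refine ⟨⟨fun v e h => ?_, fun u v e e' _ h => ?_⟩, by simp [comps]⟩ <;>
      simp [comps, vzero] at h
  | succ f ih =>
    intro R hR
    simp only [comps]
    set C := closure (adjRows G) Ls (vfirst R) with hC
    have hCc : ConflictClosed G Ls (supp C) := conflictClosed_closure Ls _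
    have hCR : supp C ⊆ supp R := closure_subset hR (supp_vfirst_subset R)
    obtain ⟨⟨hcov, hprop⟩, hsub⟩ := ih (vdiff R C) (by rw [supp_vdiff]; exact hR.diff hCc)
    rw [supp_vdiff] at hsub
    obtain ⟨hcov', hprop'⟩ := hslv (Ls.map fun A => vinter A C) (hLs.anti (map_vinter_sub C Ls))
    have hsub' := covered_map_vinter hcov'
    replace hcov' := hcov'.mono (map_vinter_sub C Ls)
    generalize slv (Ls.map fun A => vinter A C) = s₁ at *
    generalize comps slv (adjRows G) Ls f (vdiff R C) = s₂ at *
    have cross : ∀ u v e e', G.Adj u v → s₁ u = some e → s₂ v = some e' → e.2 ≠ e'.2 := by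
      intro u v e e' huv hu hv he
      obtain ⟨A, hA, h1⟩ := hcov' u e hu
      obtain ⟨B, hB, h2⟩ := hcov v e' hv
      obtain rfl := hLs.eq hA hB h1 h2 he
      exact (hsub (mem_supp_of hv)).2 (hCc u (hsub' (mem_supp_of hu)) v
        ⟨huv, A, hA, mem_supp_of h1, mem_supp_of h2⟩)
    refine ⟨⟨fun v e hv => ?_, fun u v e e' huv hu hv => ?_⟩, ?_⟩
    · rcases pick_eq_some hv with hv | hv
      · exact hcov' v e hv
      · exact hcov v e hv
    · rcases pick_eq_some hu with hu | hu <;> rcases pick_eq_some hv with hv | hv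
      · exact hprop' u v e e' huv hu hv
      · exact cross u v e e' huv hu hv
      · exact (cross v u e' e huv.symm hv hu).symm
      · exact hprop u v e e' huv hu hv
    · rw [supp_vmerge]
      exact Set.union_subset (hsub'.trans hCR) (hsub.trans Set.sdiff_subset)

theorem feasible_better {Ls : List (Vec n)} {s s' : Vec n} (h : Feasible G Ls s)
    (h' : Feasible G Ls s') : Feasible G Ls (better s s') := by
  unfold better
  split_ifs
  · exact h'
  · exact h

theorem Feasible.mono {s : Vec n} {Ls Ls' : List (Vec n)} (h : Feasible G Ls' s)
    (hs : List.Forall₂ Sub Ls' Ls) : Feasible G Ls s := ⟨h.1.mono hs, h.2⟩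

/-- The invariant on `q` makes the threshold equal to `n` when the rows are used up; then the set
handed to `comps` is closed under conflicts. -/
theorem feasible_loop {slv : Vec n → List (Vec n) → Vec n} {Ls : List (Vec n)}
    (hLs : Separated Ls) (hslv : ∀ Y Ls', Separated Ls' → Feasible G Ls' (slv Y Ls'))
    (Y : Vec n) (rs : List (Vec n)) :
    ∀ q, rs.length + q = n → Feasible G Ls (loop slv (adjRows G) rs q Y Ls) := by
  have hsub : ∀ Y Ls', List.Forall₂ Sub Ls' Ls → Feasible G Ls (slv Y Ls') :=
    fun Y Ls' h => (hslv Y Ls' (hLs.anti h)).mono h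
  induction rs with
  | nil =>
    intro q hq
    obtain rfl : q = n := by simpa using hq
    refine feasible_better (feasible_leaf hLs) (feasible_better (hsub _ _ (cutMove_sub Y Ls))
      (feasible_better ?_ ?_))
    · have := hslv Y _ (hLs.perm (rotMove_perm Ls))
      exact ⟨this.1.perm (rotMove_perm Ls), this.2⟩
    · exact (feasible_comps hLs (hslv vzero) _ _ (conflictClosed_leaf Ls _)).1
  | cons r rs ih =>
    intro q hq
    refine feasible_better (hsub _ _ (degMove_sub q Ls)) (feasible_better
      (hsub _ _ (nbrMove_sub r Y Ls)) (feasible_better (hslv _ _ hLs) (feasible_better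
      (hslv _ _ hLs) (ih (q + 1) ?_))))
    simp only [List.length_cons] at hq
    omega

/-- Moves only delete or permute candidates, so wrong guesses may cost revenue but never properness.
This holds for every graph `G`. -/
theorem feasible_solve (b : ℕ) : ∀ (Y : Vec n) (Ls : List (Vec n)), Separated Ls →
    Feasible G Ls (solve (adjRows G) b Y Ls) := by
  induction b with
  | zero => exact fun Y Ls h => feasible_leaf h
  | succ b ih => exact fun Y Ls h => feasible_loop h ih Y _ 0 (by simp)

end PartialColoringAlgorithm

namespace PartialColoringAlgorithm

variable {m n : ℕ} {G : SimpleGraph (Fin n)}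

/-! ### The moves and the value of the search -/

theorem le_better_left (a b : Vec n) : vtotal a ≤ vtotal (better a b) := by
  unfold better
  split_ifs with h
  · exact h
  · exact le_rfl

theorem le_better_right (a b : Vec n) : vtotal b ≤ vtotal (better a b) := by
  unfold better
  split_ifs with h
  · exact le_rfl
  · exact (not_le.mp h).le

section Moves

variable {slv : Vec n → List (Vec n) → Vec n} {rows : Fin n → Vec n} {Y : Vec n}
  {Ls : List (Vec n)}

theorem loopEnd_le_loop (rs : List (Vec n)) :
    ∀ q, vtotal (loopEnd slv rows (q + rs.length) Y Ls) ≤ vtotal (loop slv rows rs q Y Ls) := by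
  induction rs with
  | nil => exact fun q => le_rfl
  | cons r rs ih =>
    intro q
    refine le_trans ?_ ((le_better_right _ _).trans ((le_better_right _ _).trans
      ((le_better_right _ _).trans (le_better_right _ _))))
    refine le_trans (le_of_eq ?_) (ih (q + 1))
    rw [List.length_cons, add_right_comm, add_assoc]

theorem moves_le_loop (rs : List (Vec n)) : ∀ (q i : ℕ) (hi : i < rs.length),
    vtotal (slv Y (degMove rows (q + i) Ls)) ≤ vtotal (loop slv rows rs q Y Ls) ∧
    vtotal (slv Y (nbrMove rs[i] Y Ls)) ≤ vtotal (loop slv rows rs q Y Ls) ∧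
    vtotal (slv rs[i] Ls) ≤ vtotal (loop slv rows rs q Y Ls) ∧
    vtotal (slv (vinter Y rs[i]) Ls) ≤ vtotal (loop slv rows rs q Y Ls) := by
  induction rs with
  | nil => exact fun q i hi => absurd hi (by simp)
  | cons r rs ih =>
    intro q i hi
    rcases i with _ | i
    · refine ⟨le_better_left _ _, (le_better_left _ _).trans (le_better_right _ _),
        (le_better_left _ _).trans ((le_better_right _ _).trans (le_better_right _ _)),
        (le_better_left _ _).trans ((le_better_right _ _).trans ((le_better_right _ _).trans
        (le_better_right _ _)))⟩
    · have h := ih (q + 1) i (by simpa using hi)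
      rw [show q + 1 + i = q + (i + 1) by omega] at h
      have hle : vtotal (loop slv rows rs (q + 1) Y Ls) ≤
          vtotal (loop slv rows (r :: rs) q Y Ls) :=
        (le_better_right _ _).trans ((le_better_right _ _).trans
          ((le_better_right _ _).trans (le_better_right _ _)))
      exact ⟨h.1.trans hle, h.2.1.trans hle, h.2.2.1.trans hle, h.2.2.2.trans hle⟩

variable {b : ℕ}

theorem loopEnd_le_solve : vtotal (loopEnd (solve rows b) rows n Y Ls) ≤
    vtotal (solve rows (b + 1) Y Ls) := by
  have := loopEnd_le_loop (slv := solve rows b) (rows := rows) (Y := Y) (Ls := Ls)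
    (List.ofFn rows) 0
  simpa [solve] using this

theorem leaf_le_solve : vtotal (leaf rows 0 Ls) ≤ vtotal (solve rows b Y Ls) := by
  cases b with
  | zero => exact le_rfl
  | succ b => exact (le_better_left _ _).trans loopEnd_le_solve

theorem cutMove_le_solve : vtotal (solve rows b Y (cutMove rows Y Ls)) ≤
    vtotal (solve rows (b + 1) Y Ls) :=
  ((le_better_left _ _).trans (le_better_right _ _)).trans loopEnd_le_solve

theorem rotMove_le_solve : vtotal (solve rows b Y (rotMove Ls)) ≤
    vtotal (solve rows (b + 1) Y Ls) :=
  ((le_better_left _ _).trans ((le_better_right _ _).trans (le_better_right _ _))).trans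
    loopEnd_le_solve

theorem comps_le_solve : vtotal (comps (solve rows b vzero) rows Ls n (leaf rows n Ls)) ≤
    vtotal (solve rows (b + 1) Y Ls) :=
  ((le_better_right _ _).trans ((le_better_right _ _).trans (le_better_right _ _))).trans
    loopEnd_le_solve

theorem degMove_le_solve {q : ℕ} (hq : q < n) : vtotal (solve rows b Y (degMove rows q Ls)) ≤
    vtotal (solve rows (b + 1) Y Ls) := by
  simpa [solve] using (moves_le_loop (slv := solve rows b) (rows := rows) (Y := Y) (Ls := Ls)
    (List.ofFn rows) 0 q (by simpa using hq)).1

theorem nbrMove_le_solve (v : Fin n) : vtotal (solve rows b Y (nbrMove (rows v) Y Ls)) ≤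
    vtotal (solve rows (b + 1) Y Ls) := by
  simpa [solve] using (moves_le_loop (slv := solve rows b) (rows := rows) (Y := Y) (Ls := Ls)
    (List.ofFn rows) 0 v (by simp)).2.1

theorem set_le_solve (v : Fin n) : vtotal (solve rows b (rows v) Ls) ≤
    vtotal (solve rows (b + 1) Y Ls) := by
  simpa [solve] using (moves_le_loop (slv := solve rows b) (rows := rows) (Y := Y) (Ls := Ls)
    (List.ofFn rows) 0 v (by simp)).2.2.1

theorem inter_le_solve (v : Fin n) : vtotal (solve rows b (vinter Y (rows v)) Ls) ≤
    vtotal (solve rows (b + 1) Y Ls) := by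
  simpa [solve] using (moves_le_loop (slv := solve rows b) (rows := rows) (Y := Y) (Ls := Ls)
    (List.ofFn rows) 0 v (by simp)).2.2.2

end Moves

/-! ### Sequences of moves -/

/-- The state `(Y', Ls')` can be reached from `(Y, Ls)` with at most `c` moves. -/
def Reach (G : SimpleGraph (Fin n)) (c : ℕ) (Y : Vec n) (Ls : List (Vec n)) (Y' : Vec n)
    (Ls' : List (Vec n)) : Prop :=
  ∃ c' ≤ c, ∀ b, vtotal (solve (adjRows G) b Y' Ls') ≤ vtotal (solve (adjRows G) (b + c') Y Ls)

section Reach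

variable {Y Y' Y'' : Vec n} {Ls Ls' Ls'' : List (Vec n)} {c c' : ℕ}

theorem Reach.refl (Y : Vec n) (Ls : List (Vec n)) : Reach G 0 Y Ls Y Ls :=
  ⟨0, le_rfl, fun _ => le_rfl⟩

theorem Reach.mono (h : Reach G c Y Ls Y' Ls') (hc : c ≤ c') : Reach G c' Y Ls Y' Ls' :=
  h.imp fun _ h => ⟨h.1.trans hc, h.2⟩

theorem Reach.trans (h : Reach G c Y Ls Y' Ls') (h' : Reach G c' Y' Ls' Y'' Ls'') :
    Reach G (c + c') Y Ls Y'' Ls'' := by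
  obtain ⟨d, hd, h⟩ := h
  obtain ⟨d', hd', h'⟩ := h'
  refine ⟨d + d', by omega, fun b => (h' b).trans ((h _).trans (le_of_eq ?_))⟩
  rw [add_assoc, add_comm d']

theorem reach_deg {q : ℕ} (hq : q < n) : Reach G 1 Y Ls Y (degMove (adjRows G) q Ls) :=
  ⟨1, le_rfl, fun _ => degMove_le_solve hq⟩

theorem reach_nbr (v : Fin n) : Reach G 1 Y Ls Y (nbrMove (adjRows G v) Y Ls) :=
  ⟨1, le_rfl, fun _ => nbrMove_le_solve v⟩

theorem reach_set (v : Fin n) : Reach G 1 Y Ls (adjRows G v) Ls :=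
  ⟨1, le_rfl, fun _ => set_le_solve v⟩

theorem reach_inter (v : Fin n) : Reach G 1 Y Ls (vinter Y (adjRows G v)) Ls :=
  ⟨1, le_rfl, fun _ => inter_le_solve v⟩

theorem reach_cut : Reach G 1 Y Ls Y (cutMove (adjRows G) Y Ls) :=
  ⟨1, le_rfl, fun _ => cutMove_le_solve⟩

theorem reach_rot : Reach G 1 Y Ls Y (rotMove Ls) :=
  ⟨1, le_rfl, fun _ => rotMove_le_solve⟩

/-- The first vertex overwrites the register and the others intersect it, which is why `K` must be
nonempty. -/
theorem reach_commonNbrs {K : Finset (Fin n)} (hK : K.Nonempty) (Y : Vec n)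
    (Ls : List (Vec n)) : ∃ Y', supp Y' = {u | ∀ x ∈ K, G.Adj x u} ∧
      Reach G K.card Y Ls Y' Ls := by
  induction hK using Finset.Nonempty.cons_induction with
  | singleton a =>
    refine ⟨adjRows G a, ?_, by simpa using reach_set a⟩
    ext u
    simp [mem_supp_adjRows]
  | cons a s ha hs ih =>
    obtain ⟨Y', hY', hr⟩ := ih
    refine ⟨vinter Y' (adjRows G a), ?_, ?_⟩
    · rw [supp_vinter, hY']
      ext u
      simp only [Set.mem_inter_iff, Set.mem_ofPred_eq, mem_supp_adjRows, Finset.mem_cons,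
        forall_eq_or_imp]
      exact and_comm
    · rw [Finset.card_cons]
      exact hr.trans (reach_inter a)

/-- Treat the front layer with `c` moves and rotate it to the back with one more. Allowing an
arbitrary tail `L₂` lets the induction carry the layers already treated. -/
theorem reach_layers {P : Vec n → Vec n → Prop} (L₁ : List (Vec n)) : ∀ L₂ : List (Vec n),
    (∀ A ∈ L₁, ∀ rest, ∃ A', P A A' ∧ Reach G c Y (A :: rest) Y (A' :: rest)) →
    ∃ L₁', List.Forall₂ P L₁ L₁' ∧
      Reach G (L₁.length * (c + 1)) Y (L₁ ++ L₂) Y (L₂ ++ L₁') := by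
  induction L₁ with
  | nil =>
    intro L₂ _
    refine ⟨[], List.Forall₂.nil, ?_⟩
    simpa using Reach.refl Y L₂
  | cons A L₁ ih =>
    intro L₂ h
    obtain ⟨A', hA', hr⟩ := h A (by simp) (L₁ ++ L₂)
    obtain ⟨L₁', hP, hr'⟩ := ih (L₂ ++ [A']) fun B hB => h B (by simp [hB])
    refine ⟨A' :: L₁', List.Forall₂.cons hA' hP, ?_⟩
    have h2 := (hr.trans (reach_rot (Ls := A' :: (L₁ ++ L₂)))).trans
      (Y'' := Y) (Ls'' := (L₂ ++ [A']) ++ L₁') (c' := L₁.length * (c + 1)) (by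
        simpa [rotMove] using hr')
    simp only [List.append_assoc, List.singleton_append] at h2
    refine h2.mono (le_of_eq ?_)
    rw [List.length_cons]
    ring

end Reach

/-! ### Restricting a layer -/

/-- The layer `A'` is part of `A` and contains all entries which `A` and `X` have in common. -/
def Keeps (X A A' : Vec n) : Prop :=
  Sub A' A ∧ ∀ v e, X v = some e → A v = some e → A' v = some e

theorem Keeps.refl (X A : Vec n) : Keeps X A A := ⟨Sub.refl A, fun _ _ _ h => h⟩

theorem Keeps.trans {X A B C : Vec n} (h : Keeps X A B) (h' : Keeps X B C) : Keeps X A C :=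
  ⟨h'.1.trans h.1, fun v e hX hA => h'.2 v e hX (h.2 v e hX hA)⟩

/-- The vertices where `X` takes its entry from the layer `A`. -/
def common (X A : Vec n) : Set (Fin n) := {v | ∃ e, X v = some e ∧ A v = some e}

theorem common_subset (X A : Vec n) : common X A ⊆ supp A := fun _ h => by
  obtain ⟨e, -, h⟩ := h
  exact mem_supp_of h

theorem Keeps.common_eq {X A B : Vec n} (h : Keeps X A B) : common X B = common X A := by
  ext v
  exact ⟨fun ⟨e, h1, h2⟩ => ⟨e, h1, h.1 v e h2⟩, fun ⟨e, h1, h2⟩ => ⟨e, h1, h.2 v e h1 h2⟩⟩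

def MonoColored (A : Vec n) : Prop := ∀ u v e e', A u = some e → A v = some e' → e.2 = e'.2

theorem MonoColored.anti {A B : Vec n} (h : MonoColored A) (hs : Sub B A) : MonoColored B :=
  fun u v e e' hu hv => h u v e e' (hs u e hu) (hs v e' hv)

theorem not_adj_common {X A : Vec n} (hX : Proper G X) (hA : MonoColored A) :
    ∀ a ∈ common X A, ∀ b ∈ common X A, ¬ G.Adj a b := by
  rintro a ⟨e, h1, h2⟩ b ⟨e', h3, h4⟩ hab
  exact hX a b e e' hab h1 h3 (hA a b e e' h2 h4)

/-- The vertices that `X` takes from one layer share a color and are independent, so none of them is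
a neighbour of `v`. -/
theorem keeps_vdiff {X A r Y : Vec n} {v : Fin n} (hX : Proper G X) (hA : MonoColored A)
    (hv : v ∈ common X A) (hr : r = adjRows G v) : Keeps X A (vdiff A (vdiff r Y)) := by
  refine ⟨sub_vdiff _ _, fun u e h1 h2 => vdiff_eq_some.mpr ⟨h2, ?_⟩⟩
  rw [supp_vdiff, hr]
  exact fun hu => not_adj_common hX hA v hv u ⟨e, h1, h2⟩ (mem_supp_adjRows.mp hu.1)

/-- After few choices all vertices that are used have small degree. -/
theorem reach_small_common {X : Vec n} (hX : Proper G X) (q : ℕ) (rest : List (Vec n)) (N : ℕ) :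
    ∀ A : Vec n, (supp A).ncard ≤ N → MonoColored A → ∃ A', Keeps X A A' ∧
      (∀ x ∈ common X A', vdot (adjRows G x) A' ≤ q) ∧
      Reach G ((supp A).ncard / (q + 1)) vzero (A :: rest) vzero (A' :: rest) := by
  induction N with
  | zero =>
    intro A hN hA
    refine ⟨A, Keeps.refl X A, fun x hx => ?_, (Reach.refl _ _).mono (Nat.zero_le _)⟩
    have : supp A = ∅ := by
      rwa [Nat.le_zero, Set.ncard_eq_zero] at hN
    have := common_subset X A hx
    simp_all
  | succ N ih =>
    intro A hN hA
    by_cases hx : ∃ x ∈ common X A, q < vdot (adjRows G x) A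
    · obtain ⟨x, hx, hq⟩ := hx
      have hk : Keeps X A (vdiff A (vdiff (adjRows G x) vzero)) := keeps_vdiff hX hA hx rfl
      have hsupp : supp (vdiff A (vdiff (adjRows G x) vzero)) =
          supp A \ {u | G.Adj x u ∧ u ∈ supp A} := by
        rw [supp_vdiff, supp_vdiff, supp_vzero, Set.sdiff_empty]
        ext u
        rw [Set.mem_sdiff, Set.mem_sdiff, mem_supp_adjRows]
        exact and_congr_right fun hu => not_congr ⟨fun h => ⟨h, hu⟩, fun h => h.1⟩
      rw [vdot_adjRows] at hq
      have hcard := Set.ncard_sdiff_add_ncard_of_subset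
        (s := {u | G.Adj x u ∧ u ∈ supp A}) (t := supp A) (fun u hu => hu.2) (Set.toFinite _)
      rw [← hsupp] at hcard
      obtain ⟨A', hA', hsmall, hr⟩ := ih (vdiff A (vdiff (adjRows G x) vzero)) (by omega)
        (hA.anti hk.1)
      have hr₁ : Reach G 1 vzero (A :: rest) vzero (vdiff A (vdiff (adjRows G x) vzero) :: rest) :=
        reach_nbr x
      refine ⟨A', hk.trans hA', hsmall, (hr₁.trans hr).mono ?_⟩
      -- The move removed at least `q + 1` vertices, and this pays for it.
      calc 1 + (supp (vdiff A (vdiff (adjRows G x) vzero))).ncard / (q + 1)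
          = ((supp (vdiff A (vdiff (adjRows G x) vzero))).ncard + (q + 1)) / (q + 1) := by
            rw [Nat.add_div_right _ (Nat.succ_pos q), add_comm]
        _ ≤ _ := Nat.div_le_div_right (by omega)
    · push Not at hx
      exact ⟨A, Keeps.refl X A, hx, (Reach.refl _ _).mono (Nat.zero_le _)⟩

/-- The maximum degree inside the layer `A` is at most `q`. -/
def DegreeLE (G : SimpleGraph (Fin n)) (q : ℕ) (A : Vec n) : Prop :=
  ∀ u ∈ supp A, vdot (adjRows G u) A ≤ q

theorem vdot_mono {r a b : Vec n} (h : Sub a b) : vdot r a ≤ vdot r b := by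
  refine Finset.sum_le_sum fun v _ => ?_
  by_cases hv : (r v).isSome ∧ (a v).isSome
  · rw [if_pos hv, if_pos ⟨hv.1, h.supp_subset hv.2⟩]
  · rw [if_neg hv]
    exact Nat.zero_le _

theorem DegreeLE.anti {q : ℕ} {A B : Vec n} (h : DegreeLE G q A) (hs : Sub B A) :
    DegreeLE G q B := fun u hu => (vdot_mono hs).trans (h u (hs.supp_subset hu))

/-- Once all vertices used by `X` have degree at most `q`, one degree move discards the other
offenders without touching `X`. -/
theorem reach_degreeLE {X : Vec n} (hX : Proper G X) {q : ℕ} (hq : q < n) {A : Vec n}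
    (hm : (supp A).ncard ≤ m) (hA : MonoColored A) (rest : List (Vec n)) :
    ∃ A', (Keeps X A A' ∧ DegreeLE G q A') ∧
      Reach G (m / (q + 1) + 1) vzero (A :: rest) vzero (A' :: rest) := by
  obtain ⟨A₁, hk, hsmall, hr⟩ := reach_small_common hX q rest _ A hm hA
  refine ⟨vfilt (adjRows G) A₁ q A₁, ⟨hk.trans ⟨sub_vfilt _ _ _ _, ?_⟩, ?_⟩, ?_⟩
  · exact fun v e h1 h2 => vfilt_eq_some.mpr ⟨h2, hsmall v ⟨e, h1, h2⟩⟩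
  · intro u hu
    obtain ⟨e, he⟩ := mem_supp.mp hu
    exact (vdot_mono (sub_vfilt _ _ _ _)).trans (vfilt_eq_some.mp he).2
  · refine (hr.trans (reach_deg hq)).mono ?_
    exact Nat.add_le_add_right (Nat.div_le_div_right hm) 1

theorem DegreeLE.card_clique_le {q : ℕ} {A : Vec n} (h : DegreeLE G q A) (Q : Finset (Fin n))
    (hQ : ∀ a ∈ Q, a ∈ supp A) (hc : ∀ a ∈ Q, ∀ b ∈ Q, a ≠ b → G.Adj a b) :
    Q.card ≤ q + 1 := by
  classical
  rcases Q.eq_empty_or_nonempty with rfl | ⟨a, ha⟩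
  · simp
  · have h1 := h a (hQ a ha)
    rw [vdot_adjRows] at h1
    have h2 : ((Q.erase a : Finset (Fin n)) : Set (Fin n)) ⊆ {u | G.Adj a u ∧ u ∈ supp A} := by
      intro b hb
      have hb' := Finset.mem_erase.mp (Finset.mem_coe.mp hb)
      exact ⟨hc a ha b hb'.2 hb'.1.symm, hQ b hb'.2⟩
    have h3 := Set.ncard_le_ncard h2 (Set.toFinite _)
    rw [Set.ncard_coe_finset] at h3
    have h4 := Finset.card_erase_add_one ha
    omega

theorem reach_delete_nbrs {X Y : Vec n} (hX : Proper G X) (rest : List (Vec n))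
    (S : Finset (Fin n)) : ∀ A : Vec n, MonoColored A → (∀ s ∈ S, s ∈ common X A) →
      ∃ A', Keeps X A A' ∧ (∀ w ∈ supp A', w ∉ supp Y → ∀ s ∈ S, ¬ G.Adj s w) ∧
        Reach G S.card Y (A :: rest) Y (A' :: rest) := by
  classical
  induction S using Finset.induction_on with
  | empty => exact fun A _ _ => ⟨A, Keeps.refl X A, by simp, Reach.refl _ _⟩
  | insert a S ha ih =>
    intro A hA hS
    have hk : Keeps X A (vdiff A (vdiff (adjRows G a) Y)) :=
      keeps_vdiff hX hA (hS a (by simp)) rfl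
    obtain ⟨A', hA', hdel, hr⟩ := ih _ (hA.anti hk.1) (by
      rw [hk.common_eq]
      exact fun s hs => hS s (by simp [hs]))
    refine ⟨A', hk.trans hA', fun w hw hwY s hs => ?_, ?_⟩
    · rcases Finset.mem_insert.mp hs with rfl | hs
      · have := hA'.1.supp_subset hw
        rw [supp_vdiff, supp_vdiff] at this
        exact fun hsw => this.2 ⟨mem_supp_adjRows.mpr hsw, hwY⟩
      · exact hdel w hw hwY s hs
    · rw [Finset.card_insert_of_notMem ha, add_comm]
      exact (reach_nbr a).trans hr

/-- No edge of the layer `A` joins the common neighbourhood of `K` to its complement. -/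
def Decoupled (G : SimpleGraph (Fin n)) (K : Finset (Fin n)) (A : Vec n) : Prop :=
  ∀ u ∈ supp A, ∀ w ∈ supp A, (∀ x ∈ K, G.Adj x u) → ¬ (∀ x ∈ K, G.Adj x w) → ¬ G.Adj u w

theorem Decoupled.anti {K : Finset (Fin n)} {A B : Vec n} (h : Decoupled G K A) (hs : Sub B A) :
    Decoupled G K B :=
  fun u hu w hw => h u (hs.supp_subset hu) w (hs.supp_subset hw)

/-- Guess a small set `S` that dominates outside `supp Y` what `X` dominates from inside, and delete
the neighbours of `S` outside. A surviving outside vertex then has no neighbour among the inside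
vertices used by `X`, so the cut spares them. The cost is `max 2 (q + 1)` deletions and one cut. -/
theorem reach_decoupled (h : IsBullEFree G) {X Y : Vec n} (hX : Proper G X) {q : ℕ}
    (hq : 1 ≤ q) {A : Vec n} (hA : MonoColored A) (hdeg : DegreeLE G q A) {K : Finset (Fin n)}
    (hK : ∀ a ∈ K, ∀ b ∈ K, a ≠ b → G.Adj a b) (hY : supp Y = {u | ∀ x ∈ K, G.Adj x u})
    (rest : List (Vec n)) :
    ∃ A', (Keeps X A A' ∧ Decoupled G K A') ∧
      Reach G (q + 2) Y (A :: rest) Y (A' :: rest) := by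
  have hind := not_adj_common hX hA
  obtain ⟨S, hS, hcard, hdom⟩ := h.exists_dominating (K := (K : Set (Fin n)))
    (I := common X A ∩ supp Y) (A := supp A) (ω := q + 1) (by simpa using hK)
    (fun a ha b hb => hind a ha.1 b hb.1) (by
      intro v hv a ha
      have := ha.2
      rw [hY] at this
      exact this v hv) hdeg.card_clique_le
  obtain ⟨A₁, hk, hdel, hr⟩ := reach_delete_nbrs (Y := Y) hX rest S A hA fun s hs => (hS s hs).1
  refine ⟨cut (adjRows G) Y A₁, ⟨hk.trans ⟨sub_cut _ _, ?_⟩, ?_⟩, ?_⟩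
  · refine fun v e h1 h2 => cut_eq_some.mpr ⟨h2, fun hv u hu huY hvu => ?_⟩
    have huK : ¬ ∀ x ∈ K, G.Adj x u := by
      rw [hY] at huY
      exact huY
    push Not at huK
    obtain ⟨s, hs, hsu⟩ := hdom u (hk.1.supp_subset hu) huK
      ⟨v, ⟨⟨e, h1, hk.1 v e h2⟩, hv⟩, hvu⟩
    exact hdel u hu huY s hs hsu
  · intro u hu w hw huK hwK huw
    obtain ⟨e, he⟩ := mem_supp.mp hu
    refine (cut_eq_some.mp he).2 ?_ w ((sub_cut Y A₁).supp_subset hw) ?_ huw <;> rw [hY]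
    · exact huK
    · exact hwK
  · refine (hr.trans reach_cut).mono ?_
    have : max 2 (q + 1) = q + 1 := by omega
    omega

theorem forall₂_trans {α : Type*} {R S T : α → α → Prop} (h : ∀ a b c, R a b → S b c → T a c)
    {l₁ l₂ l₃ : List α} (h₁ : List.Forall₂ R l₁ l₂) (h₂ : List.Forall₂ S l₂ l₃) :
    List.Forall₂ T l₁ l₃ := by
  induction h₁ generalizing l₃ with
  | nil => cases h₂; exact List.Forall₂.nil
  | cons h1 _ ih =>
    cases h₂ with
    | cons h2 h₂ => exact List.Forall₂.cons (h _ _ _ h1 h2) (ih h₂)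

theorem exists_of_forall₂_right {α : Type*} {R : α → α → Prop} {l l' : List α}
    (h : List.Forall₂ R l l') {b : α} (hb : b ∈ l') : ∃ a ∈ l, R a b :=
  exists_of_forall₂ h.flip hb

/-- For each clique, at most `d` moves load its common neighbourhood into the register, which serves
all layers; each layer then needs `q + 2` moves and a rotation. What was decoupled earlier stays so,
since layers only shrink. -/
theorem reach_all_decoupled (h : IsBullEFree G) {X : Vec n} (hX : Proper G X) {q d : ℕ}
    (hq : 1 ≤ q) (Ks : List (Finset (Fin n))) : ∀ (Y : Vec n) (Ls : List (Vec n)),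
    (∀ K ∈ Ks, K.Nonempty ∧ K.card ≤ d ∧ ∀ a ∈ K, ∀ b ∈ K, a ≠ b → G.Adj a b) →
    (∀ A ∈ Ls, MonoColored A ∧ DegreeLE G q A) →
    ∃ Y' Ls', List.Forall₂ (fun A A' => Keeps X A A' ∧ ∀ K ∈ Ks, Decoupled G K A') Ls Ls' ∧
      Reach G (Ks.length * (d + Ls.length * (q + 3))) Y Ls Y' Ls' := by
  induction Ks with
  | nil =>
    refine fun Y Ls _ _ => ⟨Y, Ls, forall₂_refl (fun A => ⟨Keeps.refl X A, by simp⟩) Ls, ?_⟩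
    simpa using Reach.refl Y Ls
  | cons K Ks ih =>
    intro Y Ls hKs hLs
    obtain ⟨hne, hd, hcl⟩ := hKs K (by simp)
    obtain ⟨Y₁, hY₁, hr₁⟩ := reach_commonNbrs hne Y Ls
    obtain ⟨Ls₂, hP₂, hr₂⟩ := reach_layers (G := G) (Y := Y₁) (c := q + 2)
      (P := fun A A' => Keeps X A A' ∧ Decoupled G K A') Ls []
      fun A hA => reach_decoupled h hX hq (hLs A hA).1 (hLs A hA).2 hcl hY₁
    simp only [List.append_nil, List.nil_append] at hr₂
    obtain ⟨Y', Ls', hP', hr'⟩ := ih Y₁ Ls₂ (fun K hK => hKs K (by simp [hK])) (by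
      intro B hB
      obtain ⟨A, hA, hAB⟩ := exists_of_forall₂_right hP₂ hB
      exact ⟨(hLs A hA).1.anti hAB.1.1, (hLs A hA).2.anti hAB.1.1⟩)
    refine ⟨Y', Ls', forall₂_trans (fun A B C h1 h2 => ?_) hP₂ hP', ?_⟩
    · refine ⟨h1.1.trans h2.1, fun K' hK' => ?_⟩
      rcases List.mem_cons.mp hK' with rfl | hK'
      · exact h1.2.anti h2.1.1
      · exact h2.2 K' hK'
    · refine ((hr₁.trans hr₂).trans hr').mono ?_
      rw [← hP₂.length_eq, List.length_cons, show q + 2 + 1 = q + 3 from rfl]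
      have : K.card + Ls.length * (q + 3) ≤ d + Ls.length * (q + 3) := by omega
      calc _ ≤ (d + Ls.length * (q + 3)) + Ks.length * (d + Ls.length * (q + 3)) := by omega
        _ = _ := by ring

/-! ### Solving the components -/

theorem vtotal_vmerge {a b : Vec n} (h : Disjoint (supp a) (supp b)) :
    vtotal (vmerge a b) = vtotal a + vtotal b := by
  unfold vtotal
  rw [← Finset.sum_add_distrib]
  refine Finset.sum_congr rfl fun v _ => ?_
  unfold vmerge
  by_cases hv : v ∈ supp a
  · rw [notMem_supp.mp (Set.disjoint_left.mp h hv)]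
    obtain ⟨e, he⟩ := mem_supp.mp hv
    simp [he, pick, weight]
  · rw [notMem_supp.mp hv]
    simp [pick, weight]

theorem vtotal_vinter_split (X : Vec n) {R C : Vec n} (h : supp C ⊆ supp R) :
    vtotal (vinter X R) = vtotal (vinter X C) + vtotal (vinter X (vdiff R C)) := by
  unfold vtotal
  rw [← Finset.sum_add_distrib]
  refine Finset.sum_congr rfl fun v _ => ?_
  by_cases hC : v ∈ supp C
  · have hR := h hC
    have h1 : (C v).isSome := hC
    have h2 : (R v).isSome := hR
    simp [vinter, vdiff, h1, h2, weight]
  · have h1 : C v = none := notMem_supp.mp hC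
    simp [vinter, vdiff, h1, weight]

/-- The value of `X` is the sum of its values on the components, so solving each component at least
as well as `X` suffices. The minimality offered to `hopt` allows the size of a component to be
bounded by that of any closed set meeting it. -/
theorem vtotal_vinter_le_comps {slv : List (Vec n) → Vec n} {Ls : List (Vec n)} {X : Vec n}
    (hcov : ∀ Ls', List.Forall₂ Sub Ls' Ls → Covered (slv Ls') Ls')
    (hLs : Separated Ls) (hfeas : ∀ Ls', Separated Ls' → Feasible G Ls' (slv Ls'))
    (hopt : ∀ C : Vec n, (∀ v ∈ supp C, ∃ A ∈ Ls, v ∈ supp A) →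
      (∀ v ∈ supp C, ∀ D, v ∈ D → ConflictClosed G Ls D → supp C ⊆ D) →
      vtotal (vinter X C) ≤ vtotal (slv (Ls.map fun A => vinter A C))) (f : ℕ) :
    ∀ R : Vec n, ConflictClosed G Ls (supp R) → (∀ v ∈ supp R, ∃ A ∈ Ls, v ∈ supp A) →
      (supp R).ncard ≤ f → vtotal (vinter X R) ≤ vtotal (comps slv (adjRows G) Ls f R) := by
  induction f with
  | zero =>
    intro R _ _ hf
    have hR : supp R = ∅ := by
      rwa [Nat.le_zero, Set.ncard_eq_zero] at hf
    have : vinter X R = vzero := by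
      funext v
      refine notMem_supp.mp ?_
      rw [supp_vinter, hR]
      simp
    rw [this]
    exact le_rfl
  | succ f ih =>
    intro R hR hU hf
    simp only [comps]
    set C := closure (adjRows G) Ls (vfirst R) with hC
    have hCc : ConflictClosed G Ls (supp C) := conflictClosed_closure Ls _
    have hCR : supp C ⊆ supp R := closure_subset hR (supp_vfirst_subset R)
    have hRC : supp (vdiff R C) = supp R \ supp C := supp_vdiff R C
    have hcl : ConflictClosed G Ls (supp (vdiff R C)) := by
      rw [hRC]
      exact hR.diff hCc
    have hsub := (feasible_comps hLs hfeas f (vdiff R C) hcl).2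
    have hsub' := covered_map_vinter (hcov _ (map_vinter_sub C Ls))
    have hdisj : Disjoint (supp (slv (Ls.map fun A => vinter A C)))
        (supp (comps slv (adjRows G) Ls f (vdiff R C))) := by
      rw [hRC] at hsub
      exact Set.disjoint_left.mpr fun v h1 h2 => (hsub h2).2 (hsub' h1)
    rw [vtotal_vinter_split X hCR, vtotal_vmerge hdisj]
    refine add_le_add (hopt C (fun v hv => hU v (hCR hv)) ?_) (ih _ hcl ?_ ?_)
    · intro v hv D hvD hD
      rcases (supp R).eq_empty_or_nonempty with hRe | hRne
      · have := hCR hv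
        rw [hRe] at this
        exact absurd this (Set.notMem_empty v)
      · obtain ⟨v₀, -, hv₀⟩ := exists_supp_vfirst hRne
        -- The component grew from the single vertex `v₀`. If `v₀` lay outside `D`, the closed
        -- complement of `D` would contain the whole component.
        by_cases hvD₀ : v₀ ∈ D
        · exact closure_subset hD (by rw [hv₀]; exact Set.singleton_subset_iff.mpr hvD₀)
        · have hDc : ConflictClosed G Ls Dᶜ := fun u hu w huw hw => hu (hD w hw u huw.symm)
          have := closure_subset (C := vfirst R) hDc
            (by rw [hv₀]; exact Set.singleton_subset_iff.mpr hvD₀) hv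
          exact absurd hvD this
    · intro v hv
      rw [hRC] at hv
      exact hU v hv.1
    · rcases (supp R).eq_empty_or_nonempty with hRe | hRne
      · rw [hRC, hRe]
        simp
      · obtain ⟨v₀, hv₀R, hv₀⟩ := exists_supp_vfirst hRne
        have hv₀C : v₀ ∈ supp C := subset_closure Ls _ (by rw [hv₀]; rfl)
        have : (supp (vdiff R C)).ncard < (supp R).ncard := by
          rw [hRC]
          exact Set.ncard_lt_ncard ⟨Set.sdiff_subset, fun h => (h hv₀R).2 hv₀C⟩ (Set.toFinite _)
        omega

/-! ### Optimality -/

/-- The vertices that occur in some layer. -/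
def alive (Ls : List (Vec n)) : Set (Fin n) := {v | ∃ A ∈ Ls, v ∈ supp A}

def NonnegEntries (Ls : List (Vec n)) : Prop := ∀ A ∈ Ls, ∀ v e, A v = some e → 0 ≤ e.1

theorem NonnegEntries.anti {Ls Ls' : List (Vec n)} (h : NonnegEntries Ls)
    (hs : List.Forall₂ Sub Ls' Ls) : NonnegEntries Ls' := by
  intro A hA v e he
  obtain ⟨B, hB, hAB⟩ := exists_of_forall₂ hs hA
  exact h B hB v e (hAB v e he)

theorem alive_anti {Ls Ls' : List (Vec n)} (hs : List.Forall₂ Sub Ls' Ls) :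
    alive Ls' ⊆ alive Ls := by
  rintro v ⟨A, hA, hv⟩
  obtain ⟨B, hB, hAB⟩ := exists_of_forall₂ hs hA
  exact ⟨B, hB, hAB.supp_subset hv⟩

/-- With at most one alive vertex nothing conflicts, so taking the best color is optimal;
nonnegativity covers the case that `X` leaves the vertex out. -/
theorem vtotal_le_leaf {X : Vec n} {Ls : List (Vec n)} (hX : Covered X Ls)
    (h0 : NonnegEntries Ls) (h1 : (alive Ls).ncard ≤ 1) :
    vtotal X ≤ vtotal (leaf (adjRows G) 0 Ls) := by
  refine Finset.sum_le_sum fun v _ => ?_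
  rcases hXv : X v with _ | e
  · rcases hl : leaf (adjRows G) 0 Ls v with _ | e'
    · exact le_rfl
    · obtain ⟨A, hA, hAv, -⟩ := leaf_eq_some hl
      exact h0 A hA v e' hAv
  · obtain ⟨A, hA, hAv⟩ := hX v e hXv
    obtain ⟨e', he', hle⟩ := exists_leaf_ge (rows := adjRows G) (q := 0) hA hAv (by
      rw [vdot_adjRows_eq_zero]
      intro u hu huv
      refine G.ne_of_adj huv ?_
      exact (Set.ncard_le_one (Set.toFinite _)).mp h1 v ⟨A, hA, mem_supp_of hAv⟩ u ⟨A, hA, hu⟩)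
    rw [he']
    exact hle

theorem card_clique_le_of_layers {q : ℕ} {Ls : List (Vec n)} (hdeg : ∀ A ∈ Ls, DegreeLE G q A)
    {K : Finset (Fin n)} (hK : ∀ a ∈ K, a ∈ alive Ls)
    (hc : ∀ a ∈ K, ∀ b ∈ K, a ≠ b → G.Adj a b) : K.card ≤ Ls.length * (q + 1) := by
  classical
  have hsub : K ⊆ Ls.toFinset.biUnion fun A => K.filter fun v => v ∈ supp A := by
    intro v hv
    obtain ⟨A, hA, hvA⟩ := hK v hv
    exact Finset.mem_biUnion.mpr ⟨A, List.mem_toFinset.mpr hA, Finset.mem_filter.mpr ⟨hv, hvA⟩⟩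
  refine (Finset.card_le_card hsub).trans ((Finset.card_biUnion_le_card_mul _ _ (q + 1) ?_).trans
    (Nat.mul_le_mul_right _ (List.toFinset_card_le Ls)))
  intro A hA
  refine (hdeg A (List.mem_toFinset.mp hA)).card_clique_le _ ?_ ?_
  · intro a ha
    exact (Finset.mem_filter.mp ha).2
  · intro a ha b hb
    exact hc a (Finset.mem_filter.mp ha).1 b (Finset.mem_filter.mp hb).1

/-- A few moves lead to a state in which the conflict graph has only small components. -/
theorem reach_small_components (h : IsBullEFree G) {X : Vec n} (hX : Proper G X)
    {Ls : List (Vec n)} (hLs : Separated Ls) (hcov : Covered X Ls)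
    (hm : (alive Ls).ncard = m) (hm2 : 2 ≤ m) :
    ∃ Y' Ls', List.Forall₂ Sub Ls' Ls ∧ Covered X Ls' ∧
      Reach G (33 * (Ls.length * Nat.sqrt m)) vzero Ls Y' Ls' ∧
      ∀ v ∈ alive Ls', ∃ D, v ∈ D ∧ 3 * D.ncard ≤ 2 * m ∧ ConflictClosed G Ls' D := by
  have hmn : m ≤ n := by
    rw [← hm]
    refine (Set.ncard_le_ncard (Set.subset_univ _) (Set.toFinite _)).trans ?_
    rw [Set.ncard_univ, Nat.card_eq_fintype_card, Fintype.card_fin]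
  -- This threshold balances the at most `m / (q + 1)` deletions per layer against the clique bound
  -- `q + 1`.
  set q := Nat.sqrt m with hq
  have hq1 : 1 ≤ q := Nat.sqrt_pos.mpr (by omega)
  have hqn : q < n := (Nat.sqrt_lt_self (by omega)).trans_le hmn
  have hmq : m / (q + 1) ≤ q :=
    Nat.lt_succ_iff.mp ((Nat.div_lt_iff_lt_mul (Nat.succ_pos q)).mpr (Nat.lt_succ_sqrt m))
  obtain ⟨Ls₁, hP₁, hr₁⟩ := reach_layers (G := G) (Y := vzero) (c := m / (q + 1) + 1)
    (P := fun A A' => Keeps X A A' ∧ DegreeLE G q A') Ls []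
    fun A hA => reach_degreeLE hX hqn (by
      rw [← hm]
      exact Set.ncard_le_ncard (fun v hv => ⟨A, hA, hv⟩) (Set.toFinite _)) (hLs.mono A hA)
  simp only [List.append_nil, List.nil_append] at hr₁
  have hsub₁ : List.Forall₂ Sub Ls₁ Ls := (hP₁.imp fun A B h => h.1.1).flip
  have hdeg₁ : ∀ A ∈ Ls₁, DegreeLE G q A := fun B hB => by
    obtain ⟨A, -, hAB⟩ := exists_of_forall₂_right hP₁ hB
    exact hAB.2
  obtain ⟨Ks, hKs5, hKs, hcell⟩ := h.exists_cliques (U := alive Ls₁) (m := m) (by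
    rw [← hm]
    exact Set.ncard_le_ncard (alive_anti hsub₁) (Set.toFinite _)) hm2
  obtain ⟨Y', Ls', hP', hr'⟩ := reach_all_decoupled h hX hq1 (d := Ls.length * (q + 1)) Ks vzero
    Ls₁ (fun K hK => ⟨(hKs K hK).1, by
      have := card_clique_le_of_layers hdeg₁ (hKs K hK).2.1 (hKs K hK).2.2
      rwa [← hP₁.length_eq] at this, (hKs K hK).2.2⟩)
    (fun A hA => ⟨(hLs.anti hsub₁).mono A hA, hdeg₁ A hA⟩)
  have hsub' : List.Forall₂ Sub Ls' Ls₁ := (hP'.imp fun A B h => h.1.1).flip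
  refine ⟨Y', Ls', forall₂_trans (fun A B C h1 h2 => h1.trans h2) hsub' hsub₁, ?_, ?_, ?_⟩
  · intro v e hv
    obtain ⟨A, hA, hAv⟩ := hcov v e hv
    obtain ⟨B, hB, hAB⟩ := exists_of_forall₂ hP₁ hA
    obtain ⟨C, hC, hBC⟩ := exists_of_forall₂ hP' hB
    exact ⟨C, hC, hBC.1.2 v e hv (hAB.1.2 v e hv hAv)⟩
  · refine (hr₁.trans hr').mono ?_
    rw [← hP₁.length_eq]
    set k := Ls.length
    have h1 : k * (m / (q + 1) + 1 + 1) ≤ k * (3 * q) := Nat.mul_le_mul_left _ (by omega)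
    have h2 : k * (q + 1) + k * (q + 3) ≤ k * (6 * q) := by
      rw [← Nat.mul_add]
      exact Nat.mul_le_mul_left _ (by omega)
    -- Here `33 = 3 + 5 · 6`: the degree reduction, and five cliques with loading and decoupling at
    -- `6 k q` each.
    calc _ ≤ k * (3 * q) + 5 * (k * (6 * q)) :=
          Nat.add_le_add h1 (Nat.mul_le_mul hKs5 h2)
      _ = _ := by ring
  · intro v hv
    obtain ⟨D, hDU, hvD, hD, hsep⟩ := hcell v (alive_anti hsub' hv)
    refine ⟨D, hvD, hD, ?_⟩
    -- A conflict edge leaving `D` would have exactly one end complete to some listed clique, but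
    -- its layer is decoupled for that clique.
    rintro u hu w ⟨huw, A, hA, huA, hwA⟩
    by_contra hwD
    obtain ⟨K, hK, hne⟩ := hsep u hu w (alive_anti hsub' ⟨A, hA, hwA⟩) hwD huw
    obtain ⟨B, -, hBA⟩ := exists_of_forall₂_right hP' hA
    have hdec := hBA.2 K hK
    by_cases h1 : ∀ x ∈ K, G.Adj x u <;> by_cases h2 : ∀ x ∈ K, G.Adj x w
    · exact hne ⟨fun _ => h2, fun _ => h1⟩
    · exact hdec u huA w hwA h1 h2 huw
    · exact hdec w hwA u huA h2 h1 huw.symm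
    · exact hne ⟨fun hh => absurd hh h1, fun hh => absurd hh h2⟩

theorem sqrt_two_thirds_le : √(2 / 3 : ℝ) ≤ 0.82 := by
  rw [Real.sqrt_le_left (by norm_num)]
  norm_num

/-- With a budget of `200 k √m` moves the search is optimal when `m` vertices are alive. -/
theorem vtotal_le_solve (h : IsBullEFree G) (m : ℕ) : ∀ (b : ℕ) (Ls : List (Vec n)) (X : Vec n),
    1 ≤ Ls.length → Separated Ls → NonnegEntries Ls → Covered X Ls → Proper G X →
    (alive Ls).ncard ≤ m → 200 * Ls.length * √(m : ℝ) ≤ b →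
    vtotal X ≤ vtotal (solve (adjRows G) b vzero Ls) := by
  induction m using Nat.strong_induction_on with
  | _ m ih =>
  intro b Ls X hk hLs h0 hcov hX hm hb
  rcases Nat.lt_or_ge (alive Ls).ncard 2 with hlt | hge
  · exact (vtotal_le_leaf hcov h0 (by omega)).trans leaf_le_solve
  rcases Nat.lt_or_ge (alive Ls).ncard m with hlt | hge'
  · refine ih _ hlt b Ls X hk hLs h0 hcov hX le_rfl (le_trans ?_ hb)
    gcongr
  have hm' : (alive Ls).ncard = m := le_antisymm hm hge'
  have hm2 : 2 ≤ m := by omega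
  obtain ⟨Y', Ls', hsub, hcov', ⟨c, hc, hr⟩, hcell⟩ :=
    reach_small_components h hX hLs hcov hm' hm2
  have hlen : Ls'.length = Ls.length := hsub.length_eq
  set k := Ls.length
  have hq : (Nat.sqrt m : ℝ) ≤ √(m : ℝ) := Real.nat_sqrt_le_real_sqrt
  have hq1 : 1 ≤ Nat.sqrt m := Nat.sqrt_pos.mpr (by omega)
  have hc' : (c : ℝ) + 1 ≤ 34 * (k * √(m : ℝ)) := by
    have h1 : c + 1 ≤ 34 * (k * Nat.sqrt m) := by
      have : 1 ≤ k * Nat.sqrt m := Nat.mul_le_mul hk hq1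
      omega
    have h2 : (c : ℝ) + 1 ≤ 34 * (k * (Nat.sqrt m : ℝ)) := by exact_mod_cast h1
    refine h2.trans ?_
    gcongr
  have hkm : (0 : ℝ) ≤ k * √(m : ℝ) := by positivity
  have hcb : c + 1 ≤ b := by
    have : (c : ℝ) + 1 ≤ b := by linarith
    exact_mod_cast this
  -- The round takes `c` moves, the splitting one, and `b'` moves remain for each component.
  obtain ⟨b', rfl⟩ : ∃ b', b = b' + 1 + c := ⟨b - (c + 1), by omega⟩
  refine le_trans ?_ (hr (b' + 1))
  refine le_trans ?_ comps_le_solve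
  have hLs' := hLs.anti hsub
  have hXR : vinter X (leaf (adjRows G) n Ls') = X := by
    funext v
    rcases hXv : X v with _ | e
    · simp [vinter, hXv]
    · obtain ⟨A, hA, hAv⟩ := hcov' v e hXv
      rw [vinter_eq_some]
      exact ⟨hXv, mem_supp_leaf.mpr ⟨A, hA, mem_supp_of hAv⟩⟩
  refine le_trans (le_of_eq (congrArg vtotal hXR.symm)) (vtotal_vinter_le_comps (G := G)
    (fun Ls'' hs => (feasible_solve b' vzero Ls'' (hLs'.anti hs)).1) hLs'
    (fun Ls'' hs => feasible_solve b' vzero Ls'' hs) ?_ n _ (conflictClosed_leaf Ls' _)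
    (fun v hv => mem_supp_leaf.mp hv) ?_)
  swap
  · refine (Set.ncard_le_ncard (Set.subset_univ _) (Set.toFinite _)).trans ?_
    rw [Set.ncard_univ, Nat.card_eq_fintype_card, Fintype.card_fin]
  intro C hCU hCmin
  have hsubC := map_vinter_sub C Ls'
  have hcard : (alive (Ls'.map fun A => vinter A C)).ncard ≤ 2 * m / 3 := by
    have hsubset : alive (Ls'.map fun A => vinter A C) ⊆ supp C := by
      rintro v ⟨A, hA, hv⟩
      obtain ⟨B, -, rfl⟩ := List.mem_map.mp hA
      rw [supp_vinter] at hv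
      exact hv.2
    rcases (supp C).eq_empty_or_nonempty with hCe | ⟨v, hv⟩
    · rw [hCe, Set.subset_empty_iff] at hsubset
      rw [hsubset]
      simp
    · obtain ⟨D, hvD, hD, hcl⟩ := hcell v (hCU v hv)
      have := Set.ncard_le_ncard (hsubset.trans (hCmin v hv D hvD hcl)) (Set.toFinite _)
      omega
  refine ih (2 * m / 3) (by omega) b' _ _ ?_ (hLs'.anti hsubC) ((h0.anti hsub).anti hsubC) ?_ ?_
    hcard ?_
  · rw [List.length_map, hlen]
    exact hk
  · intro v e hv
    rw [vinter_eq_some] at hv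
    obtain ⟨A, hA, hAv⟩ := hcov' v e hv.1
    exact ⟨vinter A C, List.mem_map.mpr ⟨A, hA, rfl⟩, vinter_eq_some.mpr ⟨hAv, hv.2⟩⟩
  · intro u v e e' huv hu hv
    exact hX u v e e' huv (vinter_eq_some.mp hu).1 (vinter_eq_some.mp hv).1
  · rw [List.length_map, hlen]
    have h1 : √((2 * m / 3 : ℕ) : ℝ) ≤ √(2 / 3 : ℝ) * √(m : ℝ) := by
      rw [← Real.sqrt_mul (by norm_num)]
      apply Real.sqrt_le_sqrt
      have := @Nat.cast_div_le ℝ _ _ _ (2 * m) 3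
      push_cast at this
      linarith
    -- The components need `200 · 0.82 = 164` units of `k √m`, and the round together with the
    -- splitting at most `34`, so `200` is enough.
    have h2 : √((2 * m / 3 : ℕ) : ℝ) ≤ 0.82 * √(m : ℝ) :=
      h1.trans (mul_le_mul_of_nonneg_right sqrt_two_thirds_le (Real.sqrt_nonneg _))
    have h3 : 200 * (k : ℝ) * √((2 * m / 3 : ℕ) : ℝ) ≤ 200 * k * (0.82 * √(m : ℝ)) := by
      gcongr
    push_cast at hb
    linarith

end PartialColoringAlgorithm

namespace PartialColoringAlgorithm

/-! ## The program -/

/-- With the function bodies `F`, the expression `e` evaluates to `v` in at most `T` steps. -/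
def Ev (F : List Exp) (env : List Val) (e : Exp) (v : Val) (T : ℕ) : Prop :=
  ∃ t ≤ T, Eval F env e v t

namespace Ev

variable {F : List Exp} {env : List Val} {a b e₀ e₁ : Exp} {u v x y : Val} {p q : ℚ}
  {r s t : ℕ}

theorem mono (h : Ev F env a v s) (hst : s ≤ t) : Ev F env a v t :=
  h.imp fun _ h => ⟨h.1.trans hst, h.2⟩

theorem var {i : ℕ} (h : env[i]? = some v) : Ev F env (.var i) v 1 := ⟨1, le_rfl, .var h⟩

theorem nil : Ev F env .nil .nil 1 := ⟨1, le_rfl, .nil⟩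

theorem num : Ev F env (.num q) (.num q) 1 := ⟨1, le_rfl, .num⟩

theorem cons (ha : Ev F env a u s) (hb : Ev F env b v t) :
    Ev F env (.cons a b) (.cons u v) (s + t + 1) := by
  obtain ⟨s', hs, ha⟩ := ha
  obtain ⟨t', ht, hb⟩ := hb
  exact ⟨_, by omega, .cons ha hb⟩

theorem letIn (ha : Ev F env a u s) (hb : Ev F (u :: env) b v t) :
    Ev F env (.letIn a b) v (s + t + 1) := by
  obtain ⟨s', hs, ha⟩ := ha
  obtain ⟨t', ht, hb⟩ := hb
  exact ⟨_, by omega, .letIn ha hb⟩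

theorem caseNil (ha : Ev F env a .nil s) (hb : Ev F env e₀ v t) :
    Ev F env (.caseList a e₀ e₁) v (s + t + 1) := by
  obtain ⟨s', hs, ha⟩ := ha
  obtain ⟨t', ht, hb⟩ := hb
  exact ⟨_, by omega, .caseNil ha hb⟩

theorem caseCons (ha : Ev F env a (.cons x y) s) (hb : Ev F (x :: y :: env) e₁ v t) :
    Ev F env (.caseList a e₀ e₁) v (s + t + 1) := by
  obtain ⟨s', hs, ha⟩ := ha
  obtain ⟨t', ht, hb⟩ := hb
  exact ⟨_, by omega, .caseCons ha hb⟩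

theorem add (ha : Ev F env a (.num p) s) (hb : Ev F env b (.num q) t) :
    Ev F env (.add a b) (.num (p + q)) (s + t + 1) := by
  obtain ⟨s', hs, ha⟩ := ha
  obtain ⟨t', ht, hb⟩ := hb
  exact ⟨_, by omega, .add ha hb⟩

theorem sub (ha : Ev F env a (.num p) s) (hb : Ev F env b (.num q) t) :
    Ev F env (.sub a b) (.num (p - q)) (s + t + 1) := by
  obtain ⟨s', hs, ha⟩ := ha
  obtain ⟨t', ht, hb⟩ := hb
  exact ⟨_, by omega, .sub ha hb⟩

theorem ifLeTrue (ha : Ev F env a (.num p) s) (hb : Ev F env b (.num q) t) (hpq : p ≤ q)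
    (he : Ev F env e₁ v r) : Ev F env (.ifLe a b e₁ e₀) v (s + t + r + 1) := by
  obtain ⟨s', hs, ha⟩ := ha
  obtain ⟨t', ht, hb⟩ := hb
  obtain ⟨r', hr, he⟩ := he
  exact ⟨_, by omega, .ifLeTrue ha hb hpq he⟩

theorem ifLeFalse (ha : Ev F env a (.num p) s) (hb : Ev F env b (.num q) t) (hpq : ¬ p ≤ q)
    (he : Ev F env e₀ v r) : Ev F env (.ifLe a b e₁ e₀) v (s + t + r + 1) := by
  obtain ⟨s', hs, ha⟩ := ha
  obtain ⟨t', ht, hb⟩ := hb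
  obtain ⟨r', hr, he⟩ := he
  exact ⟨_, by omega, .ifLeFalse ha hb hpq he⟩

theorem ifLe {v₁ v₀ : Val} (ha : Ev F env a (.num p) s) (hb : Ev F env b (.num q) t)
    (he₁ : Ev F env e₁ v₁ r) (he₀ : Ev F env e₀ v₀ r) :
    Ev F env (.ifLe a b e₁ e₀) (if p ≤ q then v₁ else v₀) (s + t + r + 1) := by
  split_ifs with h
  · exact ifLeTrue ha hb h he₁
  · exact ifLeFalse ha hb h he₀

theorem call {f : ℕ} {body : Exp} (hf : F[f]? = some body) (ha : Ev F env a u s)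
    (hb : Ev F [u] body v t) : Ev F env (.call f a) v (s + t + 1) := by
  obtain ⟨s', hs, ha⟩ := ha
  obtain ⟨t', ht, hb⟩ := hb
  exact ⟨_, by omega, .call hf ha hb⟩

end Ev

/-! ### Function bodies -/

/-- `(a, b) ↦ vinter a b` -/
def interBody : Exp :=
  .caseList (.var 0) .nil (.caseList (.var 0) .nil (.caseList (.var 3) .nil
    (.cons (.caseList (.var 0) .nil (.var 4)) (.call 0 (.cons (.var 3) (.var 1))))))

/-- `(a, b) ↦ vdiff a b` -/
def diffBody : Exp :=
  .caseList (.var 0) .nil (.caseList (.var 0) .nil (.caseList (.var 3) .nil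
    (.cons (.caseList (.var 0) (.var 2) .nil) (.call 1 (.cons (.var 3) (.var 1))))))

/-- `(a, b) ↦ vmerge a b` -/
def mergeBody : Exp :=
  .caseList (.var 0) .nil (.caseList (.var 0) .nil (.caseList (.var 3) .nil
    (.cons
      (.caseList (.var 2) (.var 0) (.caseList (.var 2) (.var 4)
        (.ifLe (.var 2) (.var 0) (.var 4) (.var 6))))
      (.call 2 (.cons (.var 3) (.var 1))))))

/-- `(a, b) ↦ vdot a b` -/
def dotBody : Exp :=
  .caseList (.var 0) .nil (.caseList (.var 0) (.num 0) (.caseList (.var 3) .nil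
    (.add (.caseList (.var 2) (.num 0) (.caseList (.var 2) (.num 0) (.num 1)))
      (.call 3 (.cons (.var 3) (.var 1))))))

/-- `(rows, a, T, q) ↦ vfilt rows T q a` -/
def filtBody : Exp :=
  .caseList (.var 0) .nil (.caseList (.var 1) .nil (.caseList (.var 1) .nil
    (.caseList (.var 4) .nil (.caseList (.var 4) .nil
      (.cons (.ifLe (.call 3 (.cons (.var 2) (.var 4))) (.var 5) (.var 0) .nil)
        (.call 4 (.cons (.var 3) (.cons (.var 1) (.var 7)))))))))

/-- `a ↦ vtotal a` -/
def totalBody : Exp :=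
  .caseList (.var 0) (.num 0)
    (.add (.caseList (.var 0) (.num 0) (.var 0)) (.call 5 (.var 1)))

/-- `(a, b) ↦ better a b` -/
def betterBody : Exp :=
  .caseList (.var 0) .nil (.ifLe (.call 5 (.var 0)) (.call 5 (.var 1)) (.var 1) (.var 0))

/-- `(Ls, C) ↦ Ls.map fun A => vinter A C` -/
def mapInterBody : Exp :=
  .caseList (.var 0) .nil (.caseList (.var 0) .nil
    (.cons (.call 0 (.cons (.var 0) (.var 3))) (.call 7 (.cons (.var 1) (.var 3)))))

/-- `(Ls, rows, q, Y) ↦ leaf rows q Ls` -/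
def leafBody : Exp :=
  .caseList (.var 0) .nil (.caseList (.var 1) .nil (.caseList (.var 1) .nil
    (.caseList (.var 4) (.call 1 (.cons (.var 1) (.var 1)))
      (.call 2 (.cons (.call 4 (.cons (.var 4) (.cons (.var 0) (.cons (.var 0) (.var 2)))))
        (.call 8 (.cons (.var 1) (.var 7))))))))

/-- `(l, x) ↦ l ++ [x]` -/
def snocBody : Exp :=
  .caseList (.var 0) .nil (.caseList (.var 0) (.cons (.var 1) .nil)
    (.cons (.var 0) (.call 9 (.cons (.var 1) (.var 3)))))

/-- `(Ls, rows, C) ↦ growAll rows Ls C` -/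
def growAllBody : Exp :=
  .caseList (.var 0) .nil (.caseList (.var 1) .nil (.caseList (.var 2) (.var 1)
    (.call 10 (.cons (.var 1) (.cons (.var 2)
      (.call 2 (.cons (.var 3) (.call 1 (.cons (.var 0)
        (.call 4 (.cons (.var 2) (.cons (.var 0)
          (.cons (.call 0 (.cons (.var 0) (.var 3))) (.num 0))))))))))))))

/-- `(f, Ls, rows, C) ↦ (growAll rows Ls)^[f.length] C` -/
def closureBody : Exp :=
  .caseList (.var 0) .nil (.caseList (.var 1) .nil (.caseList (.var 1) .nil
    (.caseList (.var 4) (.var 1)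
      (.call 11 (.cons (.var 1) (.cons (.var 4) (.cons (.var 2)
        (.call 10 (.cons (.var 4) (.var 5))))))))))

/-- `a ↦ vfirst a` -/
def firstBody : Exp :=
  .caseList (.var 0) .nil (.caseList (.var 0) (.cons .nil (.call 12 (.var 1)))
    (.cons (.var 2) (.call 1 (.cons (.var 3) (.var 3)))))

/-- `(f, R, b, rows, vzero, Ls) ↦ comps (solve rows b vzero) rows Ls f.length R` -/
def compsBody : Exp :=
  .caseList (.var 0) .nil (.caseList (.var 1) .nil (.caseList (.var 1) .nil
    (.caseList (.var 1) .nil (.caseList (.var 1) .nil (.caseList (.var 8) (.var 0)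
      (.letIn
        (.call 11 (.cons (.var 4) (.cons (.var 3) (.cons (.var 4) (.call 12 (.var 8))))))
        (.call 2 (.cons
          (.call 14 (.cons (.var 7) (.cons (.var 5) (.cons (.var 3)
            (.call 7 (.cons (.var 4) (.var 0)))))))
          (.call 13 (.cons (.var 2) (.cons (.call 1 (.cons (.var 9) (.var 0)))
            (.var 10))))))))))))

/-- `(b, rows, Y, Ls) ↦ solve rows b Y Ls` -/
def solveBody : Exp :=
  .caseList (.var 0) .nil (.caseList (.var 1) .nil (.caseList (.var 1) .nil
    (.ifLe (.var 4) (.num 0)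
      (.call 8 (.cons (.var 1) (.cons (.var 2) (.cons (.num 0) (.var 0)))))
      (.call 15 (.cons (.var 2) (.cons (.num 0) (.cons (.sub (.var 4) (.num 1)) (.var 5))))))))

/-- `(rs, q, b, rows, Y, Ls) ↦ loop (solve rows b) rows rs q Y Ls` -/
def loopBody : Exp :=
  .caseList (.var 0) .nil (.caseList (.var 1) .nil (.caseList (.var 1) .nil
    (.caseList (.var 1) .nil (.caseList (.var 1) .nil
      (.caseList (.var 8) (.call 16 (.cons (.var 6) (.var 7)))
        (.call 6 (.cons
          (.call 14 (.cons (.var 6) (.cons (.var 4) (.cons (.var 2)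
            (.call 17 (.cons (.var 3) (.cons (.var 4) (.var 8))))))))
        (.call 6 (.cons
          (.call 14 (.cons (.var 6) (.cons (.var 4) (.cons (.var 2)
            (.call 18 (.cons (.var 3) (.cons (.var 0) (.var 2))))))))
        (.call 6 (.cons
          (.call 14 (.cons (.var 6) (.cons (.var 4) (.cons (.var 0) (.var 3)))))
        (.call 6 (.cons
          (.call 14 (.cons (.var 6) (.cons (.var 4)
            (.cons (.call 0 (.cons (.var 2) (.var 0))) (.var 3)))))
          (.call 15 (.cons (.var 1) (.cons (.add (.var 8) (.num 1)) (.var 9)))))))))))))))))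

/-- `(q, b, rows, Y, Ls) ↦ loopEnd (solve rows b) rows q Y Ls` -/
def loopEndBody : Exp :=
  .caseList (.var 0) .nil (.caseList (.var 1) .nil (.caseList (.var 1) .nil
    (.caseList (.var 1) .nil
      (.call 6 (.cons
        (.call 8 (.cons (.var 1) (.cons (.var 2) (.cons (.num 0) (.var 0)))))
      (.call 6 (.cons
        (.call 14 (.cons (.var 4) (.cons (.var 2) (.cons (.var 0)
          (.call 19 (.cons (.var 1) (.cons (.var 2) (.var 0))))))))
      (.call 6 (.cons
        (.call 14 (.cons (.var 4) (.cons (.var 2) (.cons (.var 0) (.call 20 (.var 1))))))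
        (.call 13 (.cons (.var 2) (.cons
          (.call 8 (.cons (.var 1) (.cons (.var 2) (.cons (.var 6) (.var 0)))))
          (.cons (.var 4) (.cons (.var 2)
            (.cons (.call 1 (.cons (.var 0) (.var 0))) (.var 1))))))))))))))))

/-- `(Ls, rows, q) ↦ degMove rows q Ls` -/
def degBody : Exp :=
  .caseList (.var 0) .nil (.caseList (.var 1) .nil (.caseList (.var 2) .nil
    (.cons (.call 4 (.cons (.var 2) (.cons (.var 0) (.cons (.var 0) (.var 3))))) (.var 1))))

/-- `(Ls, r, Y) ↦ nbrMove r Y Ls` -/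
def nbrBody : Exp :=
  .caseList (.var 0) .nil (.caseList (.var 0) .nil
    (.cons (.call 1 (.cons (.var 0) (.call 1 (.var 3)))) (.var 1)))

/-- `(Ls, rows, Y) ↦ cutMove rows Y Ls` -/
def cutBody : Exp :=
  .caseList (.var 0) .nil (.caseList (.var 1) .nil (.caseList (.var 2) .nil
    (.cons
      (.call 2 (.cons (.call 1 (.cons (.var 0) (.var 3)))
        (.call 4 (.cons (.var 2) (.cons (.call 0 (.cons (.var 0) (.var 3)))
          (.cons (.call 1 (.cons (.var 0) (.var 3))) (.num 0)))))))
      (.var 1))))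

/-- `Ls ↦ rotMove Ls` -/
def rotBody : Exp :=
  .caseList (.var 0) .nil (.call 9 (.cons (.var 1) (.var 0)))

/-- a row of the adjacency matrix as a vector -/
def rowBody : Exp :=
  .caseList (.var 0) .nil
    (.cons (.ifLe (.var 0) (.num 0) .nil (.cons (.num 0) (.num 0))) (.call 21 (.var 1)))

/-- the rows of the adjacency matrix of an instance -/
def rowsBody : Exp :=
  .caseList (.var 0) .nil (.caseList (.var 0) .nil (.cons (.call 21 (.var 0)) (.call 22 (.var 3))))

/-- `(L, c)`: the first revenue of each vertex, with the color number `c` -/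
def headsBody : Exp :=
  .caseList (.var 0) .nil (.caseList (.var 0) .nil (.caseList (.var 0) .nil
    (.caseList (.var 1) .nil
      (.cons (.cons (.var 0) (.var 7)) (.call 23 (.cons (.var 5) (.var 7)))))))

/-- drop the first revenue of each vertex -/
def tailsBody : Exp :=
  .caseList (.var 0) .nil (.caseList (.var 0) .nil (.caseList (.var 1) .nil
    (.cons (.cons (.var 2) (.var 1)) (.call 24 (.var 5)))))

/-- `(L, c, k)`: the layers of the colors `c, …, k` -/
def layersBody : Exp :=
  .caseList (.var 0) .nil (.caseList (.var 1) .nil (.ifLe (.var 0) (.var 1)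
    (.cons (.call 23 (.cons (.var 2) (.var 0)))
      (.call 25 (.cons (.call 24 (.var 2)) (.cons (.add (.var 0) (.num 1)) (.var 1)))))
    .nil))

/-- `(l, c, j ^ 2, j, b, s)`: for each element of `l` increase `c`, and if it exceeds `j ^ 2`,
increase `j` by `1` and `b` by `s`; return `b` -/
def budgetBody : Exp :=
  .caseList (.var 0) .nil (.caseList (.var 1) .nil (.caseList (.var 1) .nil
    (.caseList (.var 1) .nil (.caseList (.var 1) .nil (.caseList (.var 8) (.var 0)
      (.ifLe (.add (.var 8) (.num 1)) (.var 6)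
        (.call 26 (.cons (.var 1) (.cons (.add (.var 8) (.num 1)) (.var 9))))
        (.call 26 (.cons (.var 1) (.cons (.add (.var 8) (.num 1))
          (.cons (.add (.var 6) (.add (.var 4) (.add (.var 4) (.num 1))))
            (.cons (.add (.var 4) (.num 1)) (.cons (.add (.var 2) (.var 3)) (.var 3)))))))))))))

/-- the color numbers of a vector -/
def decodeBody : Exp :=
  .caseList (.var 0) .nil
    (.cons (.caseList (.var 0) (.num 0) (.var 1)) (.call 27 (.var 1)))

/-- `l ↦ vzero` -/
def zeroBody : Exp :=
  .caseList (.var 0) .nil (.cons .nil (.call 28 (.var 1)))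

def funs : List Exp :=
  [interBody, diffBody, mergeBody, dotBody, filtBody, totalBody, betterBody, mapInterBody,
    leafBody, snocBody, growAllBody, closureBody, firstBody, compsBody, solveBody, loopBody,
    loopEndBody, degBody, nbrBody, cutBody, rotBody, rowBody, rowsBody, headsBody, tailsBody,
    layersBody, budgetBody, decodeBody, zeroBody]

/-- The list of rows doubles as a unary counter for `n`: the budget and the iteration counts are
read off its length by recursion. -/
def program (k : ℕ) : Program where
  funs := funs
  main :=
    .letIn (.call 22 (.var 0))
      (.call 27 (.call 14 (.cons
        (.call 26 (.cons (.var 0) (.cons (.num 0) (.cons (.num 0) (.cons (.num 0)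
          (.cons (.num 0) (.num (200 * k))))))))
        (.cons (.var 0) (.cons (.call 28 (.var 0))
          (.call 25 (.cons (.var 1) (.cons (.num 1) (.num k)))))))))

/-! ### Encodings -/

def encE : Option (ℚ × ℚ) → Val
  | none => .nil
  | some e => .cons (.num e.1) (.num e.2)

def encV {n : ℕ} (a : Vec n) : Val := Val.ofList (List.ofFn fun v => encE (a v))

def encL {n : ℕ} (Ls : List (Vec n)) : Val := Val.ofList (Ls.map encV)

variable {m n : ℕ}

theorem encV_zero (a : Vec 0) : encV a = .nil := by simp [encV, Val.ofList]

theorem encV_succ (a : Vec (n + 1)) :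
    encV a = .cons (encE (a 0)) (encV fun i => a i.succ) := by
  simp [encV, List.ofFn_succ, Val.ofList]

theorem encL_nil : encL ([] : List (Vec n)) = .nil := rfl

theorem encL_cons (A : Vec n) (Ls : List (Vec n)) :
    encL (A :: Ls) = .cons (encV A) (encL Ls) := rfl

/-! ### Running times of the vector operations -/

theorem ev_inter (a b : Vec n) :
    Ev funs [.cons (encV a) (encV b)] interBody (encV (vinter a b)) (30 * n + 30) := by
  induction n with
  | zero =>
    simp only [encV_zero]
    exact (Ev.caseCons (.var rfl) (.caseNil (.var rfl) .nil)).mono (by omega)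
  | succ n ih =>
    rw [encV_succ a, encV_succ b, encV_succ (vinter a b)]
    have hx : Ev funs [encE (b 0), encV fun i => b i.succ, encE (a 0), encV fun i => a i.succ,
        encV a, encV b, .cons (encV a) (encV b)] (.caseList (.var 0) .nil (.var 4))
        (encE (vinter a b 0)) 3 := by
      unfold vinter
      rcases b 0 with _ | y
      · exact .caseNil (.var rfl) .nil
      · exact .caseCons (.var rfl) (.var rfl)
    rw [encV_succ a, encV_succ b] at hx
    exact (Ev.caseCons (.var rfl) (.caseCons (.var rfl) (.caseCons (.var rfl)
      (.cons hx (.call rfl (.cons (.var rfl) (.var rfl)) (ih _ _)))))).mono (by omega)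

end PartialColoringAlgorithm

namespace PartialColoringAlgorithm

variable {m n : ℕ}

theorem Ev.of_eq {F : List Exp} {env : List Val} {a : Exp} {u v : Val} {t : ℕ}
    (h : Ev F env a u t) (huv : u = v) : Ev F env a v t := huv ▸ h

theorem ev_diff (a b : Vec n) :
    Ev funs [.cons (encV a) (encV b)] diffBody (encV (vdiff a b)) (30 * n + 30) := by
  induction n with
  | zero =>
    simp only [encV_zero]
    exact (Ev.caseCons (.var rfl) (.caseNil (.var rfl) .nil)).mono (by omega)
  | succ n ih =>
    rw [encV_succ a, encV_succ b, encV_succ (vdiff a b)]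
    have hx : Ev funs [encE (b 0), encV fun i => b i.succ, encE (a 0), encV fun i => a i.succ,
        encV a, encV b, .cons (encV a) (encV b)] (.caseList (.var 0) (.var 2) .nil)
        (encE (vdiff a b 0)) 3 := by
      unfold vdiff
      rcases b 0 with _ | y
      · exact .caseNil (.var rfl) (.var rfl)
      · exact .caseCons (.var rfl) .nil
    rw [encV_succ a, encV_succ b] at hx
    exact (Ev.caseCons (.var rfl) (.caseCons (.var rfl) (.caseCons (.var rfl)
      (.cons hx (.call rfl (.cons (.var rfl) (.var rfl)) (ih _ _)))))).mono (by omega)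

/-- The program produces an empty vector of the right length by subtracting a vector from itself. -/
theorem vdiff_self (a : Vec n) : vdiff a a = vzero := by
  funext v
  unfold vdiff vzero
  rcases a v with _ | x <;> rfl

theorem ev_merge (a b : Vec n) :
    Ev funs [.cons (encV a) (encV b)] mergeBody (encV (vmerge a b)) (30 * n + 30) := by
  induction n with
  | zero =>
    simp only [encV_zero]
    exact (Ev.caseCons (.var rfl) (.caseNil (.var rfl) .nil)).mono (by omega)
  | succ n ih =>
    rw [encV_succ a, encV_succ b, encV_succ (vmerge a b)]
    have hx : Ev funs [encE (b 0), encV fun i => b i.succ, encE (a 0), encV fun i => a i.succ,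
        encV a, encV b, .cons (encV a) (encV b)]
        (.caseList (.var 2) (.var 0) (.caseList (.var 2) (.var 4)
          (.ifLe (.var 2) (.var 0) (.var 4) (.var 6))))
        (encE (vmerge a b 0)) 8 := by
      unfold vmerge
      rcases a 0 with _ | x <;> rcases b 0 with _ | y
      · exact (Ev.caseNil (.var rfl) (.var rfl)).mono (by omega)
      · exact (Ev.caseNil (.var rfl) (.var rfl)).mono (by omega)
      · exact (Ev.caseCons (.var rfl) (.caseNil (.var rfl) (.var rfl))).mono (by omega)
      · refine (Ev.caseCons (.var rfl) (.caseCons (.var rfl)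
          (.of_eq (.ifLe (.var rfl) (.var rfl) (.var rfl) (.var rfl)) ?_))).mono (by omega)
        simp only [pick]
        split_ifs <;> rfl
    rw [encV_succ a, encV_succ b] at hx
    exact (Ev.caseCons (.var rfl) (.caseCons (.var rfl) (.caseCons (.var rfl)
      (.cons hx (.call rfl (.cons (.var rfl) (.var rfl)) (ih _ _)))))).mono (by omega)

theorem ev_dot (a b : Vec n) :
    Ev funs [.cons (encV a) (encV b)] dotBody (.num (vdot a b : ℕ)) (30 * n + 30) := by
  induction n with
  | zero =>
    simp only [encV_zero]
    refine (Ev.caseCons (.var rfl) (.caseNil (.var rfl) (.of_eq .num ?_))).mono (by omega)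
    simp [vdot]
  | succ n ih =>
    rw [encV_succ a, encV_succ b]
    have hx : Ev funs [encE (b 0), encV fun i => b i.succ, encE (a 0), encV fun i => a i.succ,
        encV a, encV b, .cons (encV a) (encV b)]
        (.caseList (.var 2) (.num 0) (.caseList (.var 2) (.num 0) (.num 1)))
        (.num (if (a 0).isSome ∧ (b 0).isSome then 1 else 0)) 5 := by
      rcases a 0 with _ | x <;> rcases b 0 with _ | y
      · exact (Ev.caseNil (.var rfl) (.of_eq .num (by simp))).mono (by omega)
      · exact (Ev.caseNil (.var rfl) (.of_eq .num (by simp))).mono (by omega)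
      · exact (Ev.caseCons (.var rfl) (.caseNil (.var rfl) (.of_eq .num (by simp)))).mono
          (by omega)
      · exact (Ev.caseCons (.var rfl) (.caseCons (.var rfl) (.of_eq .num (by simp)))).mono
          (by omega)
    rw [encV_succ a, encV_succ b] at hx
    refine (Ev.caseCons (.var rfl) (.caseCons (.var rfl) (.caseCons (.var rfl)
      (.of_eq (.add hx (.call rfl (.cons (.var rfl) (.var rfl)) (ih _ _))) ?_)))).mono (by omega)
    unfold vdot
    rw [Fin.sum_univ_succ]
    push_cast
    rfl

theorem encRows_succ (rows : Fin (m + 1) → Vec n) : encL (List.ofFn rows) =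
    .cons (encV (rows 0)) (encL (List.ofFn fun i => rows i.succ)) := by
  rw [List.ofFn_succ, encL_cons]

/-- The number of rows and their length are separate parameters, so the induction can remove a row
without shortening the others. -/
theorem ev_filt_aux (rows : Fin m → Vec n) (T : Vec n) (q : ℕ) (a : Vec m) :
    Ev funs [.cons (encL (List.ofFn rows)) (.cons (encV a) (.cons (encV T) (.num (q : ℚ))))]
      filtBody (encV (vfilt rows T q a)) (m * (30 * n + 70) + 20) := by
  induction m with
  | zero =>
    simp only [encV_zero, List.ofFn_zero, encL_nil]
    exact (Ev.caseCons (.var rfl) (.caseCons (.var rfl) (.caseCons (.var rfl)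
      (.caseNil (.var rfl) .nil)))).mono (by omega)
  | succ m ih =>
    rw [encV_succ a, encRows_succ, encV_succ (vfilt rows T q a)]
    refine (Ev.caseCons (.var rfl) (.caseCons (.var rfl) (.caseCons (.var rfl)
      (.caseCons (.var rfl) (.caseCons (.var rfl) (.cons (.of_eq (.ifLe (r := 1)
        (.call rfl (.cons (.var rfl) (.var rfl)) (ev_dot (rows 0) T)) (.var rfl) (.var rfl) .nil)
        ?_) (.call rfl (.cons (.var rfl) (.cons (.var rfl) (.var rfl))) (ih _ _)))))))).mono ?_
    · unfold vfilt
      simp only [Nat.cast_le]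
      split_ifs <;> rfl
    · rw [Nat.succ_mul m]
      omega

theorem ev_filt (rows : Fin n → Vec n) (T : Vec n) (q : ℕ) (a : Vec n) :
    Ev funs [.cons (encL (List.ofFn rows)) (.cons (encV a) (.cons (encV T) (.num (q : ℚ))))]
      filtBody (encV (vfilt rows T q a)) (100 * (n + 1) ^ 2) :=
  (ev_filt_aux rows T q a).mono (by nlinarith)

theorem ev_total (a : Vec n) :
    Ev funs [encV a] totalBody (.num (vtotal a)) (30 * n + 30) := by
  induction n with
  | zero =>
    simp only [encV_zero]
    exact (Ev.caseNil (.var rfl) (.of_eq .num (by simp [vtotal]))).mono (by omega)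
  | succ n ih =>
    rw [encV_succ a]
    have hx : Ev funs [encE (a 0), encV fun i => a i.succ, encV a]
        (.caseList (.var 0) (.num 0) (.var 0)) (.num (weight (a 0))) 3 := by
      rcases a 0 with _ | x
      · exact .caseNil (.var rfl) .num
      · exact .caseCons (.var rfl) (.var rfl)
    rw [encV_succ a] at hx
    refine (Ev.caseCons (.var rfl) (.of_eq (.add hx (.call rfl (.var rfl) (ih _))) ?_)).mono
      (by omega)
    unfold vtotal
    rw [Fin.sum_univ_succ]

theorem ev_better (a b : Vec n) :
    Ev funs [.cons (encV a) (encV b)] betterBody (encV (better a b)) (60 * n + 80) := by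
  refine (Ev.caseCons (.var rfl) (.of_eq (.ifLe (.call rfl (.var rfl) (ev_total a))
    (.call rfl (.var rfl) (ev_total b)) (.var rfl) (.var rfl)) ?_)).mono (t := 60 * n + 80)
    (by omega)
  unfold better
  split_ifs <;> rfl

theorem ev_mapInter (Ls : List (Vec n)) (C : Vec n) :
    Ev funs [.cons (encL Ls) (encV C)] mapInterBody (encL (Ls.map fun A => vinter A C))
      ((Ls.length + 1) * (30 * n + 60)) := by
  induction Ls with
  | nil =>
    exact (Ev.caseCons (.var rfl) (.caseNil (.var rfl) .nil)).mono (by simp)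
  | cons A Ls ih =>
    refine (Ev.caseCons (.var rfl) (.caseCons (.var rfl) (.cons
      (.call rfl (.cons (.var rfl) (.var rfl)) (ev_inter A C))
      (.call rfl (.cons (.var rfl) (.var rfl)) ih)))).mono ?_
    rw [List.length_cons, Nat.succ_mul (Ls.length + 1)]
    omega

theorem le_sq (n : ℕ) : n + 1 ≤ (n + 1) ^ 2 := Nat.le_self_pow (by norm_num) _

theorem ev_leaf (rows : Fin n → Vec n) (q : ℕ) (Y : Vec n) (Ls : List (Vec n)) :
    Ev funs [.cons (encL Ls) (.cons (encL (List.ofFn rows)) (.cons (.num (q : ℚ)) (encV Y)))]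
      leafBody (encV (leaf rows q Ls)) ((Ls.length + 1) * (200 * (n + 1) ^ 2)) := by
  have hsq := le_sq n
  induction Ls with
  | nil =>
    refine (Ev.caseCons (.var rfl) (.caseCons (.var rfl) (.caseCons (.var rfl)
      (.caseNil (.var rfl) (.call rfl (.cons (.var rfl) (.var rfl)) (.of_eq (ev_diff Y Y)
        ?_)))))).mono ?_
    · rw [vdiff_self]
      rfl
    · simp only [List.length_nil]
      omega
  | cons A Ls ih =>
    refine (Ev.caseCons (.var rfl) (.caseCons (.var rfl) (.caseCons (.var rfl)
      (.caseCons (.var rfl) (.call rfl (.cons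
        (.call rfl (.cons (.var rfl) (.cons (.var rfl) (.cons (.var rfl) (.var rfl))))
          (ev_filt rows A q A))
        (.call rfl (.cons (.var rfl) (.var rfl)) ih)) (ev_merge _ _)))))).mono ?_
    rw [List.length_cons, Nat.succ_mul (Ls.length + 1)]
    omega

theorem ev_snoc (Ls : List (Vec n)) (A : Vec n) :
    Ev funs [.cons (encL Ls) (encV A)] snocBody (encL (Ls ++ [A])) ((Ls.length + 1) * 20) := by
  induction Ls with
  | nil =>
    exact (Ev.caseCons (.var rfl) (.caseNil (.var rfl) (.cons (.var rfl) .nil))).mono (by simp)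
  | cons B Ls ih =>
    refine (Ev.caseCons (.var rfl) (.caseCons (.var rfl) (.cons (.var rfl)
      (.call rfl (.cons (.var rfl) (.var rfl)) ih)))).mono ?_
    rw [List.length_cons]
    omega

theorem ev_growAll (rows : Fin n → Vec n) (Ls : List (Vec n)) : ∀ C : Vec n,
    Ev funs [.cons (encL Ls) (.cons (encL (List.ofFn rows)) (encV C))]
      growAllBody (encV (growAll rows Ls C)) ((Ls.length + 1) * (250 * (n + 1) ^ 2)) := by
  have hsq := le_sq n
  induction Ls with
  | nil =>
    intro C
    refine (Ev.caseCons (.var rfl) (.caseCons (.var rfl) (.caseNil (.var rfl) (.var rfl)))).mono ?_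
    simp only [List.length_nil]
    omega
  | cons A Ls ih =>
    intro C
    refine (Ev.caseCons (.var rfl) (.caseCons (.var rfl) (.caseCons (.var rfl) (.call rfl
      (.cons (.var rfl) (.cons (.var rfl) (.call rfl (.cons (.var rfl)
        (.call rfl (.cons (.var rfl) (.call rfl (.cons (.var rfl) (.cons (.var rfl)
          (.cons (.call rfl (.cons (.var rfl) (.var rfl)) (ev_inter A C))
            (.of_eq (.num) (by rw [Nat.cast_zero])))))
            (ev_filt rows (vinter A C) 0 A))) (ev_diff _ _))) (ev_merge _ _))))
      (ih (growBy rows A C)))))).mono ?_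
    rw [List.length_cons, Nat.succ_mul (Ls.length + 1)]
    omega

/-- The list `l` matters only through its length, which counts the rounds. -/
theorem ev_closure_aux (rows : Fin n → Vec n) (Ls l : List (Vec n)) : ∀ C : Vec n,
    Ev funs [.cons (encL l) (.cons (encL Ls) (.cons (encL (List.ofFn rows)) (encV C)))]
      closureBody (encV ((growAll rows Ls)^[l.length] C))
      ((l.length + 1) * ((Ls.length + 1) * (250 * (n + 1) ^ 2) + 30)) := by
  induction l with
  | nil =>
    intro C
    refine (Ev.caseCons (.var rfl) (.caseCons (.var rfl) (.caseCons (.var rfl)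
      (.caseNil (.var rfl) (.var rfl))))).mono ?_
    simp only [List.length_nil]
    omega
  | cons A l ih =>
    intro C
    refine (Ev.caseCons (.var rfl) (.caseCons (.var rfl) (.caseCons (.var rfl)
      (.caseCons (.var rfl) (.call rfl (.cons (.var rfl) (.cons (.var rfl) (.cons (.var rfl)
        (.call rfl (.cons (.var rfl) (.var rfl)) (ev_growAll rows Ls C)))))
        (ih (growAll rows Ls C))))))).mono ?_
    rw [List.length_cons, Nat.succ_mul (l.length + 1)]
    omega

theorem ev_closure (rows : Fin n → Vec n) (Ls : List (Vec n)) (C : Vec n) :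
    Ev funs [.cons (encL (List.ofFn rows)) (.cons (encL Ls)
      (.cons (encL (List.ofFn rows)) (encV C)))] closureBody (encV (closure rows Ls C))
      ((Ls.length + 1) * (280 * (n + 1) ^ 3)) := by
  have h := ev_closure_aux rows Ls (List.ofFn rows) C
  rw [List.length_ofFn] at h
  refine h.mono ?_
  have h1 : 1 ≤ (n + 1) ^ 2 := Nat.one_le_pow _ _ (Nat.succ_pos n)
  have h2 : (Ls.length + 1) * (250 * (n + 1) ^ 2) + 30 ≤ (Ls.length + 1) * (280 * (n + 1) ^ 2) := by
    nlinarith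
  calc _ ≤ (n + 1) * ((Ls.length + 1) * (280 * (n + 1) ^ 2)) := Nat.mul_le_mul_left _ h2
    _ = _ := by ring

theorem vfirst_zero (a : Vec (n + 1)) : vfirst a 0 = a 0 := by
  unfold vfirst
  rw [if_pos]
  intro u hu
  exact absurd hu (Fin.not_lt_zero u)

theorem vfirst_succ_of_none {a : Vec (n + 1)} (h : a 0 = none) :
    (fun i : Fin n => vfirst a i.succ) = vfirst fun i => a i.succ := by
  funext i
  unfold vfirst
  have : (∀ u < i.succ, a u = none) ↔ ∀ u < i, a u.succ = none := by
    constructor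
    · exact fun hh u hu => hh _ (Fin.succ_lt_succ_iff.mpr hu)
    · intro hh u hu
      rcases Fin.eq_zero_or_eq_succ u with rfl | ⟨j, rfl⟩
      · exact h
      · exact hh j (Fin.succ_lt_succ_iff.mp hu)
  simp only [this]

theorem vfirst_succ_of_some {a : Vec (n + 1)} (h : a 0 ≠ none) :
    (fun i : Fin n => vfirst a i.succ) = vzero := by
  funext i
  unfold vfirst
  rw [if_neg]
  · rfl
  · exact fun hh => h (hh 0 (Fin.succ_pos i))

theorem ev_first (a : Vec n) :
    Ev funs [encV a] firstBody (encV (vfirst a)) (60 * n + 60) := by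
  induction n with
  | zero =>
    simp only [encV_zero]
    exact (Ev.caseNil (.var rfl) .nil).mono (by omega)
  | succ n ih =>
    rw [encV_succ (vfirst a), encV_succ a, vfirst_zero]
    rcases ha : a 0 with _ | x
    · rw [vfirst_succ_of_none ha]
      exact (Ev.caseCons (.var rfl) (.caseNil (.var rfl) (.cons .nil
        (.call rfl (.var rfl) (ih _))))).mono (by omega)
    · rw [vfirst_succ_of_some (by simp [ha]), ← vdiff_self fun i => a i.succ]
      exact (Ev.caseCons (.var rfl) (.caseCons (.var rfl) (.cons (.var rfl)
        (.call rfl (.cons (.var rfl) (.var rfl)) (ev_diff _ _))))).mono (by omega)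

theorem ev_degMove (rows : Fin n → Vec n) (q : ℕ) (Ls : List (Vec n)) :
    Ev funs [.cons (encL Ls) (.cons (encL (List.ofFn rows)) (.num (q : ℚ)))] degBody
      (encL (degMove rows q Ls)) (100 * (n + 1) ^ 2 + 20) := by
  cases Ls with
  | nil =>
    exact (Ev.caseCons (.var rfl) (.caseCons (.var rfl) (.caseNil (.var rfl) .nil))).mono
      (by omega)
  | cons A Ls =>
    exact (Ev.caseCons (.var rfl) (.caseCons (.var rfl) (.caseCons (.var rfl) (.cons
      (.call rfl (.cons (.var rfl) (.cons (.var rfl) (.cons (.var rfl) (.var rfl))))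
        (ev_filt rows A q A)) (.var rfl))))).mono (by omega)

theorem ev_nbrMove (r Y : Vec n) (Ls : List (Vec n)) :
    Ev funs [.cons (encL Ls) (.cons (encV r) (encV Y))] nbrBody
      (encL (nbrMove r Y Ls)) (60 * n + 80) := by
  cases Ls with
  | nil => exact (Ev.caseCons (.var rfl) (.caseNil (.var rfl) .nil)).mono (by omega)
  | cons A Ls =>
    exact (Ev.caseCons (.var rfl) (.caseCons (.var rfl) (.cons (.call rfl (.cons (.var rfl)
      (.call rfl (.var rfl) (ev_diff r Y))) (ev_diff A _)) (.var rfl)))).mono (by omega)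

theorem ev_cutMove (rows : Fin n → Vec n) (Y : Vec n) (Ls : List (Vec n)) :
    Ev funs [.cons (encL Ls) (.cons (encL (List.ofFn rows)) (encV Y))] cutBody
      (encL (cutMove rows Y Ls)) (300 * (n + 1) ^ 2) := by
  have hsq := le_sq n
  cases Ls with
  | nil =>
    exact (Ev.caseCons (.var rfl) (.caseCons (.var rfl) (.caseNil (.var rfl) .nil))).mono
      (by omega)
  | cons A Ls =>
    exact (Ev.caseCons (.var rfl) (.caseCons (.var rfl) (.caseCons (.var rfl) (.cons
      (.call rfl (.cons (.call rfl (.cons (.var rfl) (.var rfl)) (ev_diff A Y))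
        (.call rfl (.cons (.var rfl) (.cons
          (.call rfl (.cons (.var rfl) (.var rfl)) (ev_inter A Y))
          (.cons (.call rfl (.cons (.var rfl) (.var rfl)) (ev_diff A Y))
            (.of_eq .num (by rw [Nat.cast_zero])))))
          (ev_filt rows (vdiff A Y) 0 (vinter A Y)))) (ev_merge _ _)) (.var rfl))))).mono
      (by omega)

theorem ev_rotMove (Ls : List (Vec n)) :
    Ev funs [encL Ls] rotBody (encL (rotMove Ls)) ((Ls.length + 1) * 20 + 10) := by
  cases Ls with
  | nil => exact (Ev.caseNil (.var rfl) .nil).mono (by omega)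
  | cons A Ls =>
    refine (Ev.caseCons (.var rfl) (.call rfl (.cons (.var rfl) (.var rfl))
      (ev_snoc Ls A))).mono ?_
    rw [List.length_cons]
    omega

end PartialColoringAlgorithm

namespace PartialColoringAlgorithm

variable {m n : ℕ}

/-! ### Running time of the search -/

/-- The encoding of a state of the search. -/
def encState (rows : Fin n → Vec n) (b : ℕ) (Y : Vec n) (Ls : List (Vec n)) : Val :=
  .cons (.num (b : ℚ)) (.cons (encL (List.ofFn rows)) (.cons (encV Y) (encL Ls)))

/-- The search with `b` moves takes at most `S` steps on states with `L` layers. -/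
def SolveTime (rows : Fin n → Vec n) (b L S : ℕ) : Prop :=
  ∀ (Y : Vec n) (Ls : List (Vec n)), Ls.length = L →
    Ev funs [encState rows b Y Ls] solveBody (encV (solve rows b Y Ls)) S

theorem degMove_length (rows : Fin n → Vec n) (q : ℕ) (Ls : List (Vec n)) :
    (degMove rows q Ls).length = Ls.length := by cases Ls <;> rfl

theorem nbrMove_length (r Y : Vec n) (Ls : List (Vec n)) :
    (nbrMove r Y Ls).length = Ls.length := by cases Ls <;> rfl

theorem cutMove_length (rows : Fin n → Vec n) (Y : Vec n) (Ls : List (Vec n)) :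
    (cutMove rows Y Ls).length = Ls.length := by cases Ls <;> rfl

theorem rotMove_length (Ls : List (Vec n)) : (rotMove Ls).length = Ls.length :=
  by cases Ls <;> simp [rotMove]

theorem ev_comps {rows : Fin n → Vec n} {b S : ℕ} {Ls : List (Vec n)}
    (hS : SolveTime rows b Ls.length S) (l : List (Vec n)) : ∀ R : Vec n,
    Ev funs [.cons (encL l) (.cons (encV R) (encState rows b vzero Ls))] compsBody
      (encV (comps (solve rows b vzero) rows Ls l.length R))
      (l.length * (S + (Ls.length + 1) * (600 * (n + 1) ^ 3)) + 20) := by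
  induction l with
  | nil =>
    intro R
    exact (Ev.caseCons (.var rfl) (.caseCons (.var rfl) (.caseCons (.var rfl)
      (.caseCons (.var rfl) (.caseCons (.var rfl) (.caseNil (.var rfl) (.var rfl))))))).mono
      (by omega)
  | cons A l ih =>
    intro R
    refine (Ev.caseCons (.var rfl) (.caseCons (.var rfl) (.caseCons (.var rfl)
      (.caseCons (.var rfl) (.caseCons (.var rfl) (.caseCons (.var rfl) (.letIn
        (.call rfl (.cons (.var rfl) (.cons (.var rfl) (.cons (.var rfl)
          (.call rfl (.var rfl) (ev_first R))))) (ev_closure rows Ls (vfirst R)))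
        (.call rfl (.cons
          (.call rfl (.cons (.var rfl) (.cons (.var rfl) (.cons (.var rfl)
            (.call rfl (.cons (.var rfl) (.var rfl)) (ev_mapInter Ls _)))))
            (hS vzero _ (by rw [List.length_map])))
          (.call rfl (.cons (.var rfl) (.cons (.call rfl (.cons (.var rfl) (.var rfl))
            (ev_diff R _)) (.var rfl))) (ih _)))
        (ev_merge _ _))))))))).mono ?_
    rw [List.length_cons, Nat.succ_mul l.length]
    have h3 : n + 1 ≤ (n + 1) ^ 3 := Nat.le_self_pow (by norm_num) _
    have h4 : (Ls.length + 1) * (30 * n + 60) ≤ (Ls.length + 1) * (60 * (n + 1) ^ 3) :=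
      Nat.mul_le_mul_left _ (by omega)
    have h5 : 1 * (260 * (n + 1) ^ 3) ≤ (Ls.length + 1) * (260 * (n + 1) ^ 3) :=
      Nat.mul_le_mul_right _ (by omega)
    have h6 : (Ls.length + 1) * (600 * (n + 1) ^ 3) = (Ls.length + 1) * (280 * (n + 1) ^ 3) +
      (Ls.length + 1) * (60 * (n + 1) ^ 3) + (Ls.length + 1) * (260 * (n + 1) ^ 3) := by ring
    omega

theorem ev_loopEnd {rows : Fin n → Vec n} {b S : ℕ} {Ls : List (Vec n)}
    (hS : SolveTime rows b Ls.length S) (q : ℕ) (Y : Vec n) :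
    Ev funs [.cons (.num (q : ℚ)) (encState rows b Y Ls)] loopEndBody
      (encV (loopEnd (solve rows b) rows q Y Ls))
      ((n + 2) * S + (Ls.length + 1) * (2000 * (n + 1) ^ 4)) := by
  have hc := ev_comps hS (List.ofFn rows) (leaf rows q Ls)
  rw [List.length_ofFn] at hc
  have hz := ev_diff Y Y
  rw [vdiff_self] at hz
  have h0 : Ev funs [.cons (encL Ls) (.cons (encL (List.ofFn rows)) (.cons (.num 0) (encV Y)))]
      leafBody (encV (leaf rows 0 Ls)) ((Ls.length + 1) * (200 * (n + 1) ^ 2)) := by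
    simpa using ev_leaf rows 0 Y Ls
  refine (Ev.caseCons (.var rfl) (.caseCons (.var rfl) (.caseCons (.var rfl)
    (.caseCons (.var rfl) (.call rfl (.cons
      (.call rfl (.cons (.var rfl) (.cons (.var rfl) (.cons .num (.var rfl)))) h0)
      (.call rfl (.cons
        (.call rfl (.cons (.var rfl) (.cons (.var rfl) (.cons (.var rfl)
          (.call rfl (.cons (.var rfl) (.cons (.var rfl) (.var rfl))) (ev_cutMove rows Y Ls)))))
          (hS Y _ (cutMove_length rows Y Ls)))
        (.call rfl (.cons
          (.call rfl (.cons (.var rfl) (.cons (.var rfl) (.cons (.var rfl)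
            (.call rfl (.var rfl) (ev_rotMove Ls))))) (hS Y _ (rotMove_length Ls)))
          (.call rfl (.cons (.var rfl) (.cons
            (.call rfl (.cons (.var rfl) (.cons (.var rfl) (.cons (.var rfl) (.var rfl))))
              (ev_leaf rows q Y Ls))
            (.cons (.var rfl) (.cons (.var rfl) (.cons (.call rfl (.cons (.var rfl) (.var rfl)) hz)
              (.var rfl)))))) hc)) (ev_better _ _))) (ev_better _ _)))
      (ev_better _ _)))))).mono ?_
  have hsq := le_sq n
  have h1 : n * (S + (Ls.length + 1) * (600 * (n + 1) ^ 3)) + 2 * S ≤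
      (n + 2) * S + (Ls.length + 1) * (600 * (n + 1) ^ 4) := by
    have : n * ((Ls.length + 1) * (600 * (n + 1) ^ 3)) ≤
        (n + 1) * ((Ls.length + 1) * (600 * (n + 1) ^ 3)) := Nat.mul_le_mul_right _ (by omega)
    calc _ = (n + 2) * S + n * ((Ls.length + 1) * (600 * (n + 1) ^ 3)) := by ring
      _ ≤ (n + 2) * S + (n + 1) * ((Ls.length + 1) * (600 * (n + 1) ^ 3)) := by omega
      _ = _ := by ring
  have h24 : (n + 1) ^ 2 ≤ (n + 1) ^ 4 := Nat.pow_le_pow_right (Nat.succ_pos n) (by norm_num)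
  have h2 : (Ls.length + 1) * (200 * (n + 1) ^ 2) ≤ (Ls.length + 1) * (200 * (n + 1) ^ 4) :=
    Nat.mul_le_mul_left _ (by omega)
  have h3 : (Ls.length + 1) * 20 ≤ (Ls.length + 1) * (20 * (n + 1) ^ 4) :=
    Nat.mul_le_mul_left _ (by omega)
  have h4 : 1 * (900 * (n + 1) ^ 4) ≤ (Ls.length + 1) * (900 * (n + 1) ^ 4) :=
    Nat.mul_le_mul_right _ (by omega)
  have h5 : (Ls.length + 1) * (2000 * (n + 1) ^ 4) = (Ls.length + 1) * (600 * (n + 1) ^ 4) +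
    2 * ((Ls.length + 1) * (200 * (n + 1) ^ 4)) + (Ls.length + 1) * (20 * (n + 1) ^ 4) +
    (Ls.length + 1) * (900 * (n + 1) ^ 4) + (Ls.length + 1) * (80 * (n + 1) ^ 4) := by ring
  omega

theorem ev_loop {rows : Fin n → Vec n} {b S : ℕ} {Ls : List (Vec n)}
    (hS : SolveTime rows b Ls.length S) (Y : Vec n) (rs : List (Vec n)) : ∀ q : ℕ,
    Ev funs [.cons (encL rs) (.cons (.num (q : ℚ)) (encState rows b Y Ls))] loopBody
      (encV (loop (solve rows b) rows rs q Y Ls))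
      (rs.length * (4 * S + 800 * (n + 1) ^ 2) + ((n + 2) * S +
        (Ls.length + 1) * (2000 * (n + 1) ^ 4)) + 30) := by
  have hsq := le_sq n
  induction rs with
  | nil =>
    intro q
    refine (Ev.caseCons (.var rfl) (.caseCons (.var rfl) (.caseCons (.var rfl)
      (.caseCons (.var rfl) (.caseCons (.var rfl) (.caseNil (.var rfl)
        (.call rfl (.cons (.var rfl) (.var rfl)) (ev_loopEnd hS q Y)))))))).mono ?_
    simp only [List.length_nil]
    omega
  | cons r rs ih =>
    intro q
    have ih' := ih (q + 1)
    rw [Nat.cast_add, Nat.cast_one] at ih'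
    refine (Ev.caseCons (.var rfl) (.caseCons (.var rfl) (.caseCons (.var rfl)
      (.caseCons (.var rfl) (.caseCons (.var rfl) (.caseCons (.var rfl) (.call rfl (.cons
        (.call rfl (.cons (.var rfl) (.cons (.var rfl) (.cons (.var rfl)
          (.call rfl (.cons (.var rfl) (.cons (.var rfl) (.var rfl))) (ev_degMove rows q Ls)))))
          (hS Y _ (degMove_length rows q Ls)))
        (.call rfl (.cons
          (.call rfl (.cons (.var rfl) (.cons (.var rfl) (.cons (.var rfl)
            (.call rfl (.cons (.var rfl) (.cons (.var rfl) (.var rfl))) (ev_nbrMove r Y Ls)))))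
            (hS Y _ (nbrMove_length r Y Ls)))
          (.call rfl (.cons
            (.call rfl (.cons (.var rfl) (.cons (.var rfl) (.cons (.var rfl) (.var rfl))))
              (hS r Ls rfl))
            (.call rfl (.cons
              (.call rfl (.cons (.var rfl) (.cons (.var rfl) (.cons
                (.call rfl (.cons (.var rfl) (.var rfl)) (ev_inter Y r)) (.var rfl))))
                (hS (vinter Y r) Ls rfl))
              (.call rfl (.cons (.var rfl) (.cons (.add (.var rfl) .num) (.var rfl))) ih'))
            (ev_better _ _))) (ev_better _ _))) (ev_better _ _)))
        (ev_better _ _)))))))).mono ?_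
    rw [List.length_cons, Nat.succ_mul rs.length]
    omega

/-- The loop makes `4n` recursive calls, and its end two for cutting and rotating and `n` for
components. The last unit of `5n + 3` absorbs the polynomial work of one call. -/
theorem solveTime (rows : Fin n → Vec n) (b L : ℕ) :
    SolveTime rows b L ((L + 1) * (3000 * (n + 1) ^ 4) * (5 * n + 3) ^ b) := by
  have hsq := le_sq n
  have h24 : (n + 1) ^ 2 ≤ (n + 1) ^ 4 := Nat.pow_le_pow_right (Nat.succ_pos n) (by norm_num)
  induction b with
  | zero =>
    intro Y Ls hL
    have h0 : Ev funs [.cons (encL Ls) (.cons (encL (List.ofFn rows)) (.cons (.num 0) (encV Y)))]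
        leafBody (encV (leaf rows 0 Ls)) ((Ls.length + 1) * (200 * (n + 1) ^ 2)) := by
      simpa using ev_leaf rows 0 Y Ls
    refine (Ev.caseCons (.var rfl) (.caseCons (.var rfl) (.caseCons (.var rfl)
      (.ifLeTrue (.var rfl) .num (by simp) (.call rfl
        (.cons (.var rfl) (.cons (.var rfl) (.cons .num (.var rfl)))) h0))))).mono ?_
    rw [hL, pow_zero, mul_one]
    have h1 : (L + 1) * (200 * (n + 1) ^ 2) ≤ (L + 1) * (200 * (n + 1) ^ 4) :=
      Nat.mul_le_mul_left _ (by omega)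
    have h2 : 1 * (2800 * (n + 1) ^ 4) ≤ (L + 1) * (2800 * (n + 1) ^ 4) :=
      Nat.mul_le_mul_right _ (by omega)
    have h3 : (L + 1) * (3000 * (n + 1) ^ 4) = (L + 1) * (200 * (n + 1) ^ 4) +
      (L + 1) * (2800 * (n + 1) ^ 4) := by ring
    omega
  | succ b ih =>
    intro Y Ls hL
    subst hL
    have hl := ev_loop ih Y (List.ofFn rows) 0
    rw [List.length_ofFn, Nat.cast_zero] at hl
    refine (Ev.caseCons (.var rfl) (.caseCons (.var rfl) (.caseCons (.var rfl)
      (.ifLeFalse (.var rfl) .num ?_ (.call rfl (.cons (.var rfl) (.cons .num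
        (.cons (.of_eq (.sub (.var rfl) .num) ?_) (.var rfl)))) hl))))).mono ?_
    · push_cast
      exact not_le.mpr (by positivity)
    · push_cast
      rw [add_sub_cancel_right]
    · set P := (Ls.length + 1) * (3000 * (n + 1) ^ 4) with hP
      have h1 : 1 ≤ (5 * n + 3) ^ b := Nat.one_le_pow _ _ (by omega)
      have h2 : P ≤ P * (5 * n + 3) ^ b := Nat.le_mul_of_pos_right _ h1
      have h3 : n * (800 * (n + 1) ^ 2) ≤ 800 * (n + 1) ^ 4 := by
        have : n * (n + 1) ^ 2 ≤ (n + 1) ^ 4 := by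
          calc n * (n + 1) ^ 2 ≤ (n + 1) ^ 2 * (n + 1) ^ 2 := Nat.mul_le_mul_right _ (by omega)
            _ = _ := by ring
        linarith
      have h4 : 1 * (1000 * (n + 1) ^ 4) ≤ (Ls.length + 1) * (1000 * (n + 1) ^ 4) :=
        Nat.mul_le_mul_right _ (by omega)
      have h5 : P = (Ls.length + 1) * (2000 * (n + 1) ^ 4) +
        (Ls.length + 1) * (1000 * (n + 1) ^ 4) := by rw [hP]; ring
      have h6 : P * (5 * n + 3) ^ (b + 1) = 4 * (n * (P * (5 * n + 3) ^ b)) +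
          (n + 2) * (P * (5 * n + 3) ^ b) + P * (5 * n + 3) ^ b := by ring
      have h7 : n * (4 * (P * (5 * n + 3) ^ b) + 800 * (n + 1) ^ 2) =
          4 * (n * (P * (5 * n + 3) ^ b)) + n * (800 * (n + 1) ^ 2) := by ring
      rw [h6, h7]
      omega

end PartialColoringAlgorithm

namespace PartialColoringAlgorithm

variable {m n k : ℕ}

/-! ### Reading the instance and writing the solution -/

theorem ofList_ofFn_zero (f : Fin 0 → Val) : Val.ofList (List.ofFn f) = .nil := by
  simp [Val.ofList]

theorem ofList_ofFn_succ (f : Fin (n + 1) → Val) : Val.ofList (List.ofFn f) =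
    .cons (f 0) (Val.ofList (List.ofFn fun i => f i.succ)) := by
  simp [List.ofFn_succ, Val.ofList]

theorem ev_row (f : Fin n → ℚ) :
    Ev funs [Val.ofList (List.ofFn fun u => Val.num (f u))] rowBody
      (encV fun u => if f u ≤ 0 then none else some (0, 0)) (30 * n + 30) := by
  induction n with
  | zero =>
    rw [ofList_ofFn_zero, encV_zero]
    exact (Ev.caseNil (.var rfl) .nil).mono (by omega)
  | succ n ih =>
    rw [ofList_ofFn_succ, encV_succ]
    refine (Ev.caseCons (.var rfl) (.cons (.of_eq (.ifLe (r := 3) (.var rfl) .num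
      (Ev.nil.mono (by omega)) (.cons .num .num)) ?_)
      (.call rfl (.var rfl) (ih _)))).mono (by omega)
    split_ifs <;> rfl

theorem ev_rows (f : Fin m → Fin n → ℚ) (r : Fin m → Val) :
    Ev funs [Val.ofList (List.ofFn fun v =>
      Val.cons (Val.ofList (List.ofFn fun u => Val.num (f v u))) (r v))] rowsBody
      (encL (List.ofFn fun v : Fin m => (fun u => if f v u ≤ 0 then none else some (0, 0) : Vec n)))
      (m * (30 * n + 60) + 20) := by
  induction m with
  | zero =>
    rw [ofList_ofFn_zero]
    exact (Ev.caseNil (.var rfl) .nil).mono (by omega)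
  | succ m ih =>
    rw [ofList_ofFn_succ, encRows_succ]
    refine (Ev.caseCons (.var rfl) (.caseCons (.var rfl) (.cons
      (.call rfl (.var rfl) (ev_row (f 0))) (.call rfl (.var rfl)
      (ih (fun v => f v.succ) fun v => r v.succ))))).mono ?_
    rw [Nat.succ_mul m]
    omega

theorem ev_heads (row rest : Fin n → Val) (r : Fin n → ℚ) (c : ℚ) :
    Ev funs [.cons (Val.ofList (List.ofFn fun v =>
      Val.cons (row v) (.cons (.num (r v)) (rest v)))) (.num c)] headsBody
      (encV fun v => some (r v, c)) (30 * n + 30) := by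
  induction n with
  | zero =>
    rw [ofList_ofFn_zero, encV_zero]
    exact (Ev.caseCons (.var rfl) (.caseNil (.var rfl) .nil)).mono (by omega)
  | succ n ih =>
    rw [ofList_ofFn_succ, encV_succ]
    exact (Ev.caseCons (.var rfl) (.caseCons (.var rfl) (.caseCons (.var rfl) (.caseCons (.var rfl)
      (.cons (.cons (.var rfl) (.var rfl)) (.call rfl (.cons (.var rfl) (.var rfl))
        (ih _ _ _))))))).mono (by omega)

theorem ev_tails (row rest : Fin n → Val) (r : Fin n → ℚ) :
    Ev funs [Val.ofList (List.ofFn fun v => Val.cons (row v) (.cons (.num (r v)) (rest v)))]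
      tailsBody (Val.ofList (List.ofFn fun v => Val.cons (row v) (rest v))) (30 * n + 30) := by
  induction n with
  | zero =>
    rw [ofList_ofFn_zero, ofList_ofFn_zero]
    exact (Ev.caseNil (.var rfl) .nil).mono (by omega)
  | succ n ih =>
    rw [ofList_ofFn_succ, ofList_ofFn_succ]
    exact (Ev.caseCons (.var rfl) (.caseCons (.var rfl) (.caseCons (.var rfl)
      (.cons (.cons (.var rfl) (.var rfl)) (.call rfl (.var rfl) (ih _ _ _)))))).mono (by omega)

theorem ev_layers (row : Fin n → Val) (j : ℕ) : ∀ (g : Fin j → Fin n → ℚ) (c : ℕ),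
    c + j = k + 1 →
    Ev funs [.cons (Val.ofList (List.ofFn fun v : Fin n =>
        Val.cons (row v) (Val.ofList (List.ofFn fun i : Fin j => Val.num (g i v)))))
      (.cons (.num (c : ℚ)) (.num (k : ℚ)))] layersBody
      (encL (List.ofFn fun i : Fin j => (fun v => some (g i v, (c : ℚ) + (i : ℕ)) : Vec n)))
      ((j + 1) * (60 * n + 100)) := by
  induction j with
  | zero =>
    intro g c hc
    refine (Ev.caseCons (.var rfl) (.caseCons (.var rfl) (.ifLeFalse (.var rfl) (.var rfl) ?_
      .nil))).mono (by omega)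
    rw [Nat.cast_le]
    omega
  | succ j ih =>
    intro g c hc
    have h1 := ih (fun i => g i.succ) (c + 1) (by omega)
    have hin : (fun v : Fin n => Val.cons (row v)
        (Val.ofList (List.ofFn fun i : Fin (j + 1) => Val.num (g i v)))) =
        fun v => Val.cons (row v) (.cons (.num (g 0 v))
          (Val.ofList (List.ofFn fun i : Fin j => Val.num (g i.succ v)))) := by
      funext v
      rw [ofList_ofFn_succ]
    rw [hin, encRows_succ]
    have hcol : (fun i : Fin j => (fun v => some (g i.succ v, ((c + 1 : ℕ) : ℚ) + (i : ℕ)) : Vec n))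
        = fun i => fun v => some (g i.succ v, (c : ℚ) + (i.succ : ℕ)) := by
      funext i v
      rw [Fin.val_succ]
      push_cast
      rw [add_assoc, add_comm (1 : ℚ)]
    rw [hcol] at h1
    have h2 := ev_heads row (fun v => Val.ofList (List.ofFn fun i : Fin j => Val.num (g i.succ v)))
      (g 0) c
    refine (Ev.caseCons (.var rfl) (.caseCons (.var rfl) (.ifLeTrue (.var rfl) (.var rfl) ?_
      (.cons (.of_eq (.call rfl (.cons (.var rfl) (.var rfl)) h2) ?_)
        (.call rfl (.cons (.call rfl (.var rfl) (ev_tails _ _ _))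
          (.cons (.of_eq (.add (.var rfl) .num) ?_) (.var rfl))) h1))))).mono ?_
    · rw [Nat.cast_le]
      omega
    · simp
    · push_cast
      rfl
    · rw [Nat.succ_mul (j + 1)]
      omega

/-! ### Computing the budget by additions -/

/-- Increase `j` whenever the counter exceeds `j ^ 2`. -/
def rootFrom : ℕ → ℕ → ℕ → ℕ
  | 0, _, j => j
  | m + 1, c, j => if c + 1 ≤ j * j then rootFrom m (c + 1) j else rootFrom m (c + 1) (j + 1)

/-- The invariant is that `j` is the square root of `c` rounded up; truncated subtraction makes the
case `j = 0` separate. -/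
theorem rootFrom_spec (m : ℕ) : ∀ c j, c ≤ j * j → (j = 0 ∨ (j - 1) * (j - 1) < c) →
    c + m ≤ rootFrom m c j * rootFrom m c j ∧
    (rootFrom m c j = 0 ∨ (rootFrom m c j - 1) * (rootFrom m c j - 1) < c + m) := by
  induction m with
  | zero => exact fun c j h1 h2 => ⟨h1, h2⟩
  | succ m ih =>
    intro c j h1 h2
    unfold rootFrom
    rw [show c + (m + 1) = c + 1 + m by omega]
    split_ifs with h
    · exact ih (c + 1) j h (h2.imp id fun h => by omega)
    · refine ih (c + 1) (j + 1) (by nlinarith) (Or.inr ?_)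
      rw [Nat.add_sub_cancel]
      omega

/-- Without multiplication the square and the product are maintained incrementally: `(j + 1)² = j² +
j + j + 1` and `s (j + 1) = s j + s`. -/
theorem ev_budget (l : List (Vec n)) (s : ℚ) : ∀ c j : ℕ,
    Ev funs [.cons (encL l) (.cons (.num (c : ℚ)) (.cons (.num ((j : ℚ) * j))
      (.cons (.num (j : ℚ)) (.cons (.num (s * j)) (.num s)))))] budgetBody
      (.num (s * (rootFrom l.length c j : ℕ))) ((l.length + 1) * 60) := by
  induction l with
  | nil =>
    intro c j
    exact (Ev.caseCons (.var rfl) (.caseCons (.var rfl) (.caseCons (.var rfl)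
      (.caseCons (.var rfl) (.caseCons (.var rfl) (.caseNil (.var rfl) (.var rfl))))))).mono
      (by simp)
  | cons A l ih =>
    intro c j
    have hc : Val.num ((c : ℚ) + 1) = .num ((c + 1 : ℕ) : ℚ) := by push_cast; rfl
    rw [List.length_cons, rootFrom]
    by_cases h : c + 1 ≤ j * j
    · rw [if_pos h]
      refine (Ev.caseCons (.var rfl) (.caseCons (.var rfl) (.caseCons (.var rfl)
        (.caseCons (.var rfl) (.caseCons (.var rfl) (.caseCons (.var rfl)
          (.ifLeTrue (.add (.var rfl) .num) (.var rfl) ?_ (.call rfl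
            (.cons (.var rfl) (.cons (.of_eq (.add (.var rfl) .num) hc) (.var rfl)))
            (ih (c + 1) j))))))))).mono (by omega)
      exact_mod_cast h
    · rw [if_neg h]
      refine (Ev.caseCons (.var rfl) (.caseCons (.var rfl) (.caseCons (.var rfl)
        (.caseCons (.var rfl) (.caseCons (.var rfl) (.caseCons (.var rfl)
          (.ifLeFalse (.add (.var rfl) .num) (.var rfl) ?_ (.call rfl
            (.cons (.var rfl) (.cons (.of_eq (.add (.var rfl) .num) hc)
              (.cons (.of_eq (.add (.var rfl) (.add (.var rfl) (.add (.var rfl) .num))) ?_)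
                (.cons (.of_eq (.add (.var rfl) .num) ?_)
                  (.cons (.of_eq (.add (.var rfl) (.var rfl)) ?_) (.var rfl))))))
            (ih (c + 1) (j + 1)))))))))).mono (by omega)
      · exact_mod_cast h
      · push_cast
        congr 1
        ring
      · push_cast
        rfl
      · push_cast
        congr 1
        ring

def decodeE : Option (ℚ × ℚ) → Val
  | none => .num 0
  | some e => .num e.2

theorem ev_decode (a : Vec n) :
    Ev funs [encV a] decodeBody (Val.ofList (List.ofFn fun v => decodeE (a v)))
      (30 * n + 30) := by
  induction n with
  | zero =>
    rw [ofList_ofFn_zero, encV_zero]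
    exact (Ev.caseNil (.var rfl) .nil).mono (by omega)
  | succ n ih =>
    rw [ofList_ofFn_succ, encV_succ]
    have hx : Ev funs [encE (a 0), encV fun i => a i.succ,
        .cons (encE (a 0)) (encV fun i => a i.succ)]
        (.caseList (.var 0) (.num 0) (.var 1)) (decodeE (a 0)) 3 := by
      rcases a 0 with _ | x
      · exact .caseNil (.var rfl) .num
      · exact .caseCons (.var rfl) (.var rfl)
    exact (Ev.caseCons (.var rfl) (.cons hx (.call rfl (.var rfl) (ih _)))).mono (by omega)

theorem ev_zero (rows : Fin m → Vec n) :
    Ev funs [encL (List.ofFn rows)] zeroBody (encV (vzero : Vec m)) (30 * m + 30) := by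
  induction m with
  | zero =>
    rw [encV_zero]
    exact (Ev.caseNil (.var rfl) .nil).mono (by omega)
  | succ m ih =>
    rw [encRows_succ, encV_succ]
    exact (Ev.caseCons (.var rfl) (.cons .nil (.call rfl (.var rfl) (ih _)))).mono (by omega)

/-- All vertices with their revenues for the color `i`. -/
def fullLayer (rev : Fin n → Fin k → NNRat) (i : Fin k) : Vec n :=
  fun v => some ((rev v i : ℚ), ((i : ℕ) : ℚ) + 1)

/-- The number of moves of the search. -/
def budget (n k : ℕ) : ℕ := 200 * k * rootFrom n 0 0

open Classical in
theorem ev_main (G : SimpleGraph (Fin n)) (rev : Fin n → Fin k → NNRat) :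
    Ev funs [encodeInstance G rev] (program k).main
      (Val.ofList (List.ofFn fun v => decodeE (solve (adjRows G) (budget n k) vzero
        (List.ofFn (fullLayer rev)) v)))
      ((k + 1) * (4000 * (n + 1) ^ 4) * (5 * n + 3) ^ budget n k) := by
  have h1 := ev_rows (fun v u => if G.Adj v u then (1 : ℚ) else 0)
    fun v => Val.ofList (List.ofFn fun i : Fin k => Val.num (rev v i : ℚ))
  have hrows : (fun v : Fin n => (fun u => if (if G.Adj v u then (1 : ℚ) else 0) ≤ 0 then none
      else some (0, 0) : Vec n)) = adjRows G := by
    funext v u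
    unfold adjRows
    by_cases h : G.Adj v u <;> simp [h]
  rw [hrows] at h1
  have h2 := ev_layers (k := k) (fun v => Val.ofList (List.ofFn fun u : Fin n =>
    Val.num (if G.Adj v u then (1 : ℚ) else 0))) k (fun i v => (rev v i : ℚ)) 1 (by omega)
  have hlay : (fun i : Fin k => (fun v => some ((rev v i : ℚ), ((1 : ℕ) : ℚ) + (i : ℕ)) : Vec n)) =
      fullLayer rev := by
    funext i v
    unfold fullLayer
    rw [Nat.cast_one, add_comm]
  rw [hlay] at h2
  have h3 := ev_budget (List.ofFn (adjRows G)) (200 * k) 0 0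
  have h4 := solveTime (adjRows G) (budget n k) k vzero (List.ofFn (fullLayer rev)) (by simp)
  rw [List.length_ofFn] at h3
  simp only [Nat.cast_zero, Nat.cast_one, mul_zero] at h2 h3
  refine (Ev.letIn (.call rfl (.var rfl) h1) (.call rfl (.call rfl (.cons (.of_eq (.call rfl
    (.cons (.var rfl) (.cons .num (.cons .num (.cons .num (.cons .num .num))))) h3) ?_)
    (.cons (.var rfl) (.cons (.call rfl (.var rfl) (ev_zero _))
      (.call rfl (.cons (.var rfl) (.cons .num .num)) h2)))) h4) (ev_decode _))).mono ?_
  · unfold budget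
    push_cast
    rfl
  · set P := (5 * n + 3) ^ budget n k
    have hP : 1 ≤ P := Nat.one_le_pow _ _ (by omega)
    have hN : (n + 1) ^ 2 ≤ (n + 1) ^ 4 := Nat.pow_le_pow_right (Nat.succ_pos n) (by norm_num)
    have hsq := le_sq n
    have e1 : n * (30 * n + 60) ≤ 60 * (n + 1) ^ 2 := by nlinarith
    have e2 : (k + 1) * (60 * n + 100) ≤ (k + 1) * (100 * (n + 1) ^ 4) :=
      Nat.mul_le_mul_left _ (by omega)
    have e3 : 1 * (900 * (n + 1) ^ 4) ≤ (k + 1) * (900 * (n + 1) ^ 4) :=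
      Nat.mul_le_mul_right _ (by omega)
    have e4 : (k + 1) * (1000 * (n + 1) ^ 4) * 1 ≤ (k + 1) * (1000 * (n + 1) ^ 4) * P :=
      Nat.mul_le_mul_left _ hP
    have e5 : (k + 1) * (1000 * (n + 1) ^ 4) * 1 = (k + 1) * (100 * (n + 1) ^ 4) +
      (k + 1) * (900 * (n + 1) ^ 4) := by ring
    have e6 : (k + 1) * (4000 * (n + 1) ^ 4) * P = (k + 1) * (1000 * (n + 1) ^ 4) * P +
      (k + 1) * (3000 * (n + 1) ^ 4) * P := by ring
    omega

/-! ### Correctness -/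

theorem fullLayer_eq_some {rev : Fin n → Fin k → NNRat} {A : Vec n}
    (hA : A ∈ List.ofFn (fullLayer rev)) {v : Fin n} {e : ℚ × ℚ} (h : A v = some e) :
    ∃ i : Fin k, A = fullLayer rev i ∧ e = ((rev v i : ℚ), ((i : ℕ) : ℚ) + 1) := by
  obtain ⟨i, rfl⟩ := (List.mem_ofFn' _ _).mp hA
  exact ⟨i, rfl, (Option.some.inj h).symm⟩

theorem separated_fullLayer (rev : Fin n → Fin k → NNRat) :
    Separated (List.ofFn (fullLayer rev)) := by
  refine ⟨fun A hA u v e e' hu hv => ?_, ?_⟩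
  · obtain ⟨i, rfl⟩ := (List.mem_ofFn' _ _).mp hA
    obtain rfl := Option.some.inj hu
    obtain rfl := Option.some.inj hv
    rfl
  · rw [List.pairwise_ofFn]
    intro i j hij u v e e' hu hv he
    obtain rfl := Option.some.inj hu
    obtain rfl := Option.some.inj hv
    simp only [add_left_inj, Nat.cast_inj] at he
    exact absurd (Fin.ext he) hij.ne

theorem nonneg_fullLayer (rev : Fin n → Fin k → NNRat) :
    NonnegEntries (List.ofFn (fullLayer rev)) := by
  intro A hA v e he
  obtain ⟨i, -, rfl⟩ := fullLayer_eq_some hA he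
  exact (rev v i).2

variable {G : SimpleGraph (Fin n)}

/-- A feasible solution as a vector. -/
def toVec (rev : Fin n → Fin k → NNRat) (S : PartialColoring G k) : Vec n :=
  fun v => if h : v ∈ S.X then fullLayer rev (S.c ⟨v, h⟩) v else none

theorem vtotal_toVec (rev : Fin n → Fin k → NNRat) (S : PartialColoring G k) :
    vtotal (toVec rev S) = (S.revenue rev : ℚ) := by
  let f : Fin n → ℚ := fun v => weight (toVec rev S v)
  have h1 : ∑ v ∈ S.X, f v = ∑ v : (S.X : Set (Fin n)), f v :=
    Finset.sum_subtype S.X (fun v => by simp) f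
  have h2 : ∑ v ∈ S.X, f v = ∑ v, f v := by
    refine Finset.sum_subset (Finset.subset_univ _) fun v _ hv => ?_
    simp [f, toVec, hv, weight]
  unfold vtotal PartialColoring.revenue
  rw [← h2, h1]
  push_cast
  refine Finset.sum_congr rfl fun v _ => ?_
  have hv : (v : Fin n) ∈ S.X := v.2
  simp [f, toVec, hv, weight, fullLayer]

theorem covered_toVec (rev : Fin n → Fin k → NNRat) (S : PartialColoring G k) :
    Covered (toVec rev S) (List.ofFn (fullLayer rev)) := by
  intro v e hv
  unfold toVec at hv
  split_ifs at hv with h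
  exact ⟨_, (List.mem_ofFn' _ _).mpr ⟨_, rfl⟩, hv⟩

theorem proper_toVec (rev : Fin n → Fin k → NNRat) (S : PartialColoring G k) :
    Proper G (toVec rev S) := by
  intro u v e e' huv hu hv he
  unfold toVec at hu hv
  split_ifs at hu with h1
  split_ifs at hv with h2
  obtain rfl := Option.some.inj hu
  obtain rfl := Option.some.inj hv
  simp only [add_left_inj, Nat.cast_inj] at he
  have hadj : (G.induce (S.X : Set (Fin n))).Adj ⟨u, h1⟩ ⟨v, h2⟩ := huv
  exact S.c.valid hadj (Fin.ext he)

theorem exists_toVec_eq (hk : 1 ≤ k) {rev : Fin n → Fin k → NNRat} {s : Vec n}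
    (hs : Feasible G (List.ofFn (fullLayer rev)) s) :
    ∃ S : PartialColoring G k, toVec rev S = s := by
  have hcol : ∀ v, ∃ i : Fin k, ∀ e, s v = some e → some e = fullLayer rev i v := by
    intro v
    rcases hv : s v with _ | e
    -- An unused vertex gets a dummy color, which exists because `1 ≤ k`.
    · exact ⟨⟨0, hk⟩, by simp⟩
    · obtain ⟨A, hA, hAv⟩ := hs.1 v e hv
      obtain ⟨i, rfl, -⟩ := fullLayer_eq_some hA hAv
      exact ⟨i, by rintro _ ⟨⟩; exact hAv.symm⟩
  choose col hcol using hcol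
  refine ⟨⟨Finset.univ.filter fun v => (s v).isSome, SimpleGraph.Coloring.mk
    (fun v => col v) ?_⟩, ?_⟩
  · rintro ⟨u, hu⟩ ⟨v, hv⟩ huv hcuv
    obtain ⟨e, he⟩ := Option.isSome_iff_exists.mp (by simpa using hu)
    obtain ⟨e', he'⟩ := Option.isSome_iff_exists.mp (by simpa using hv)
    refine hs.2 u v e e' huv he he' ?_
    rw [Option.some.inj (hcol u e he), Option.some.inj (hcol v e' he')]
    have hcuv' : col u = col v := hcuv
    simp [hcuv']
  · funext v
    rcases hv : s v with _ | e
    · simp [toVec, hv]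
    · rw [hcol v e hv]
      simp only [toVec, Finset.mem_filter, Finset.mem_univ, true_and, hv, Option.isSome_some,
        dif_pos]
      rfl

theorem encodeSolution_eq (rev : Fin n → Fin k → NNRat) (S : PartialColoring G k) :
    encodeSolution S = Val.ofList (List.ofFn fun v => decodeE (toVec rev S v)) := by
  unfold encodeSolution
  congr 2
  funext v
  unfold toVec
  split_ifs with h
  · rfl
  · rfl

theorem root_spec (n : ℕ) : n ≤ rootFrom n 0 0 * rootFrom n 0 0 ∧
    (rootFrom n 0 0 = 0 ∨ (rootFrom n 0 0 - 1) * (rootFrom n 0 0 - 1) < n) := by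
  simpa using rootFrom_spec n 0 0 le_rfl (Or.inl rfl)

theorem le_budget (n k : ℕ) : 200 * (k : ℝ) * √(n : ℝ) ≤ budget n k := by
  have h : √(n : ℝ) ≤ (rootFrom n 0 0 : ℝ) := by
    rw [Real.sqrt_le_left (Nat.cast_nonneg _), sq]
    exact_mod_cast (root_spec n).1
  unfold budget
  push_cast
  gcongr

theorem budget_le {n : ℕ} (hn : 1 ≤ n) (k : ℕ) : (budget n k : ℝ) ≤ 400 * (k * √(n : ℝ)) := by
  have h1 : (1 : ℝ) ≤ √(n : ℝ) := by
    rw [Real.one_le_sqrt]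
    exact_mod_cast hn
  have h : (rootFrom n 0 0 : ℝ) ≤ 2 * √(n : ℝ) := by
    rcases (root_spec n).2 with h | h
    · rw [h]
      simp
    · have h2 : ((rootFrom n 0 0 - 1 : ℕ) : ℝ) ≤ √(n : ℝ) := by
        rw [Real.le_sqrt (Nat.cast_nonneg _) (Nat.cast_nonneg _), sq]
        exact_mod_cast h.le
      -- Rounding up costs at most one, which `1 ≤ √n` turns into the factor `2`.
      have h3 : rootFrom n 0 0 ≤ (rootFrom n 0 0 - 1) + 1 := by omega
      have h4 : (rootFrom n 0 0 : ℝ) ≤ ((rootFrom n 0 0 - 1 : ℕ) : ℝ) + 1 := by exact_mod_cast h3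
      linarith
  unfold budget
  push_cast
  calc 200 * (k : ℝ) * (rootFrom n 0 0 : ℝ) ≤ 200 * k * (2 * √(n : ℝ)) := by gcongr
    _ = _ := by ring

/-- The number of steps of the program has the required order of magnitude. -/
theorem steps_le {n : ℕ} (hk : 1 ≤ k) (hn : 2 ≤ n) :
    (((k + 1) * (4000 * (n + 1) ^ 4) * (5 * n + 3) ^ budget n k : ℕ) : ℝ) ≤
      (2 : ℝ) ^ (2000 * ((k : ℝ) * √(n : ℝ) * (Real.logb 2 n) ^ (3 / 2 : ℝ))) := by
  have hn0 : (0 : ℝ) < n := by positivity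
  have hn2 : (2 : ℝ) ≤ n := by exact_mod_cast hn
  have hk1 : (1 : ℝ) ≤ k := by exact_mod_cast hk
  set l := Real.logb 2 n with hl
  have hpow : (2 : ℝ) ^ l = n := Real.rpow_logb (by norm_num) (by norm_num) hn0
  have hl1 : 1 ≤ l := by
    rw [hl, Real.le_logb_iff_rpow_le (by norm_num) hn0]
    simpa using hn2
  have hs1 : (1 : ℝ) ≤ √(n : ℝ) := by
    rw [Real.one_le_sqrt]
    linarith
  -- The search itself needs only the first power of the logarithm; for `n ≥ 2` the logarithm is at
  -- least `1`, so the stated power is larger.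
  have hl32 : l ≤ l ^ (3 / 2 : ℝ) := by
    calc l = l ^ (1 : ℝ) := (Real.rpow_one l).symm
      _ ≤ l ^ (3 / 2 : ℝ) := Real.rpow_le_rpow_of_exponent_le hl1 (by norm_num)
  set X := (k : ℝ) * √(n : ℝ) * l ^ (3 / 2 : ℝ) with hX
  have hks : (1 : ℝ) ≤ k * √(n : ℝ) := one_le_mul_of_one_le_of_one_le hk1 hs1
  have hXl : k * √(n : ℝ) * l ≤ X := by
    rw [hX]
    gcongr
  have hlX : l ≤ X := by nlinarith
  have hkX : (k : ℝ) ≤ X := by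
    refine le_trans ?_ hXl
    have : (k : ℝ) * 1 ≤ k * √(n : ℝ) := by gcongr
    nlinarith
  have e1 : ((k : ℝ) + 1) ≤ 2 ^ (k : ℝ) := by
    rw [Real.rpow_natCast]
    exact_mod_cast Nat.lt_two_pow_self
  have e2 : (4000 : ℝ) ≤ 2 ^ (12 : ℝ) := by norm_num
  have e3 : ((n : ℝ) + 1) ^ 4 ≤ 2 ^ (8 * l) := by
    rw [mul_comm 8 l, Real.rpow_mul (by norm_num), hpow, show (8 : ℝ) = ((8 : ℕ) : ℝ) by norm_num,
      Real.rpow_natCast]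
    calc ((n : ℝ) + 1) ^ 4 ≤ ((n : ℝ) ^ 2) ^ 4 := by
          gcongr
          nlinarith
      _ = _ := by ring
  have e4 : (5 * (n : ℝ) + 3) ^ budget n k ≤ 2 ^ (4 * l * (400 * (k * √(n : ℝ)))) := by
    have h1 : 5 * (n : ℝ) + 3 ≤ 2 ^ (4 * l) := by
      rw [mul_comm 4 l, Real.rpow_mul (by norm_num), hpow, show (4 : ℝ) = ((4 : ℕ) : ℝ) by norm_num,
        Real.rpow_natCast]
      have h2 : (n : ℝ) ^ 4 = (n ^ 3) * n := by ring
      have h3 : (2 : ℝ) ^ 3 ≤ (n : ℝ) ^ 3 := by gcongr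
      rw [h2]
      nlinarith
    rw [Real.rpow_mul (by norm_num), ← Real.rpow_natCast]
    calc (5 * (n : ℝ) + 3) ^ ((budget n k : ℕ) : ℝ) ≤ ((2 : ℝ) ^ (4 * l)) ^ ((budget n k : ℕ) : ℝ) :=
          Real.rpow_le_rpow (by positivity) h1 (Nat.cast_nonneg _)
      _ ≤ _ := Real.rpow_le_rpow_of_exponent_le (by
          refine le_trans ?_ h1
          linarith) (budget_le (by omega) k)
  push_cast
  calc ((k : ℝ) + 1) * (4000 * ((n : ℝ) + 1) ^ 4) * (5 * (n : ℝ) + 3) ^ budget n k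
      ≤ 2 ^ (k : ℝ) * (2 ^ (12 : ℝ) * 2 ^ (8 * l)) * 2 ^ (4 * l * (400 * (k * √(n : ℝ)))) := by
        gcongr
    _ = 2 ^ ((k : ℝ) + (12 + 8 * l) + 4 * l * (400 * (k * √(n : ℝ)))) := by
        rw [Real.rpow_add (by norm_num), Real.rpow_add (by norm_num), Real.rpow_add (by norm_num)]
    -- Since `1 ≤ l ≤ X`, the exponent is at most `(1 + 12 + 8 + 1600) X`, below `2000 X`.
    _ ≤ _ := by
        apply Real.rpow_le_rpow_of_exponent_le (by norm_num)
        nlinarith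

end PartialColoringAlgorithm

open PartialColoringAlgorithm in
/-- The exponent constant `C` is absolute. The base-2 logarithm vanishes at `n = 1`, so the time
bound is stated for `n ≥ 2`; the program is correct for every `n`. -/
theorem mainTheorem6 :
    ∃ C : ℝ, ∀ k : ℕ, 1 ≤ k → ∃ P : Program,
      ∀ (n : ℕ) (G : SimpleGraph (Fin n)), IsBullEFree G →
        ∀ rev : Fin n → Fin k → NNRat,
          ∃ (S : PartialColoring G k) (t : ℕ),
            P.Outputs (encodeInstance G rev) (encodeSolution S) t ∧
            S.IsOptimal rev ∧
            (2 ≤ n →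
              (t : ℝ) ≤
                (2 : ℝ) ^ (C * ((k : ℝ) * √(n : ℝ) * (Real.logb 2 n) ^ (3 / 2 : ℝ)))) := by
  refine ⟨2000, fun k hk => ⟨program k, fun n G hG rev => ?_⟩⟩
  have hLs := separated_fullLayer rev
  obtain ⟨S, hS⟩ := exists_toVec_eq hk (feasible_solve (G := G) (budget n k) vzero _ hLs)
  obtain ⟨t, ht, hev⟩ := ev_main G rev
  refine ⟨S, t, ?_, fun S' => ?_, fun hn => ?_⟩
  · rw [encodeSolution_eq rev, hS]
    exact hev
  -- The competitor `S'` plays the role of the guiding solution `X`, so no optimal solution has to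
  -- be fixed in advance.
  · have h := vtotal_le_solve hG n (budget n k) (List.ofFn (fullLayer rev)) (toVec rev S')
      (by rwa [List.length_ofFn]) hLs (nonneg_fullLayer rev) (covered_toVec rev S')
      (proper_toVec rev S') ?_ (by rw [List.length_ofFn]; exact le_budget n k)
    · rw [← hS, vtotal_toVec, vtotal_toVec] at h
      exact_mod_cast h
    · refine (Set.ncard_le_ncard (Set.subset_univ _) (Set.toFinite _)).trans ?_
      rw [Set.ncard_univ, Nat.card_eq_fintype_card, Fintype.card_fin]
  · exact (Nat.cast_le.mpr ht).trans (steps_le hk hn)
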